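/- Let $k$ be a field and let $B$ (written $\mathcal E(k)$) be a finite-dimensional local $k$-algebra with maximal ideal $\mathfrak m$ whose residue field is $k$, i.e. $k\to B/\mathfrak m$ is bijective. Let $e:k\to B$ be a ring homomorphism (not necessarily the structure map). For a finite $k$-algebra $C$, a ring homomorphism $f:k\to C$ and a $k$-scheme $X$, the prolongation space $\tau(X,C,f)$ is the Weil restriction of $X\times_{k,f}C$ from $C$ to $k$ (along the structure map $k\to C$), i.e. the $k$-scheme representing $U\mapsto \operatorname{Hom}_C(U\times_kC,\ X\times_{k,f}C)$. A homomorphism of $k$-algebras $\alpha:C\to C'$ induces a morphism $\tau(X,C,f)\to\tau(X,C',\alpha\circ f)$. For $i\ge 0$ put $B_i=B/\mathfrak m^{i+1}$ and let $e_i:k\to B\to B_i$ be induced by $e$; identify $B_0=k$, so that $e_0$ is an endomorphism of $k$, and let $X^{e_0}=X\times_{k,e_0}k$. The tangent bundle $TY$ of a $k$-scheme $Y$ is the Weil restriction of $Y\times_k k[\varepsilon]/(\varepsilon^2)$ from $k[\varepsilon]/(\varepsilon^2)$ to $k$, with its projection to $Y$ and its fibrewise addition. $(TY)^m$ denotes its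 $m$-fold fibre power over $Y$. **Proposition.** Let $X$ be a smooth and absolutely (geometrically) irreducible scheme over $k$. Then $\tau(X,B,e)$, all $\tau(X,B_i,e_i)$ and $TX^{e_0}$ exist. In the sequence induced by the quotient maps $$\cdots\to\tau(X,B_{i+1},e_{i+1})\to\tau(X,B_i,e_i)\to\cdots\to\tau(X,B_0,e_0)$$ one has $\tau(X,B_0,e_0)=X^{e_0}$, and $\tau(X,B,e)=\tau(X,B_d,e_d)$ canonically whenever $\mathfrak m^{d+1}=0$. Moreover, for every $i\ge 0$: (a) $\tau(X,B_i,e_i)$ is smooth and absolutely irreducible over $k$; (b) with $m=\dim_k(\mathfrak m^{i+1}/\mathfrak m^{i+2})$, the morphism $\tau(X,B_{i+1},e_{i+1})\to\tau(X,B_i,e_i)$ is a torsor for $(TX^{e_0})^m$. That is, there is a morphism $$\gamma:(TX^{e_0})^m\times_{X^{e_0}}\tau(X,B_{i+1},e_{i+1})\to\tau(X,B_{i+1},e_{i+1})$$ over $\tau(X,B_i,e_i)$ such that, on points with values in any $k$-scheme $U$, $\gamma$ is an action of the additive group of $m$-tuples of tangent vectors which is simply transitive: for every $U$-point $b$ of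 $\tau(X,B_i,e_i)$ with image $a$ in $X^{e_0}$, and any two $U$-points $c,c'$ of $\tau(X,B_{i+1},e_{i+1})$ over $b$, exactly one $y\in (T_aX^{e_0})^m(U)$ satisfies $\gamma(y,c)=c'$; and $\tau(X,B_{i+1},e_{i+1})\to\tau(X,B_i,e_i)$ has sections locally on the target for the Zariski topology (so all its fibres are non-empty). In particular, $\tau(X,B,e)$ is smooth and absolutely irreducible. -/

import Mathlib

open CategoryTheory CategoryTheory.Limits AlgebraicGeometry Opposite

universe u

noncomputable section

/-! ### Weil restriction of scalars -/

/-- The functor `U ↦ Hom_T(U ×_S T, Y)` on schemes over `S`, for a scheme `Y` over `T`. -/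
abbrev weilFunctor {T S : Scheme.{u}} (p : T ⟶ S) (Y : Over T) : (Over S)ᵒᵖ ⥤ Type u :=
  (Over.pullback p).op ⋙ yoneda.obj Y

/-- A Weil restriction of `Y` along `p : T ⟶ S`: a scheme over `S` together with a
representation of the functor `U ↦ Hom_T(U ×_S T, Y)`. -/
structure WeilRestriction {T S : Scheme.{u}} (p : T ⟶ S) (Y : Over T) where
  /-- The representing scheme. -/
  space : Over S
  /-- The natural bijection `Hom_S(U, space) ≃ Hom_T(U ×_S T, Y)`. -/
  repr : (weilFunctor p Y).RepresentableBy space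

/-! ### Prolongation spaces -/

section Prolongation

variable {k : Type u} [CommRing k]

/-- The morphism of spectra induced by a ring homomorphism. -/
abbrev specMap {B C : Type u} [CommRing B] [CommRing C] (e : B →+* C) :
    Spec (CommRingCat.of C) ⟶ Spec (CommRingCat.of B) :=
  Spec.map (CommRingCat.ofHom e)

/-- The base extension of a scheme `X` over `k` along a ring homomorphism `e : k → B`.  For an
endomorphism `e` of `k` this is the transform `X^e`. -/
abbrev transform {B : Type u} [CommRing B] (e : k →+* B) (X : Over (Spec (CommRingCat.of k))) :
    Over (Spec (CommRingCat.of B)) :=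
  (Over.pullback (specMap e)).obj X

/-- A prolongation space of `X` with respect to a `k`-algebra `B` and a second ring homomorphism
`e : k → B`: the Weil restriction, along the standard `k → B`, of the base extension of `X`
along `e`. -/
abbrev Prolongation {B : Type u} [CommRing B] [Algebra k B] (e : k →+* B)
    (X : Over (Spec (CommRingCat.of k))) :=
  WeilRestriction (specMap (algebraMap k B)) (transform e X)

/-- The `U`-points of a prolongation space: the `B`-morphisms `U ×_k B → X ×_{k,e} B`. -/
abbrev ProlongationPt {B : Type u} [CommRing B] [Algebra k B] (e : k →+* B)
    (X U : Over (Spec (CommRingCat.of k))) : Type u :=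
  (Over.pullback (specMap (algebraMap k B))).obj U ⟶ transform e X

lemma prolongationPt_comm {B : Type u} [CommRing B] [Algebra k B] {e : k →+* B}
    {X U : Over (Spec (CommRingCat.of k))} (g : ProlongationPt e X U) :
    (g.left ≫ pullback.fst X.hom (specMap e)) ≫ X.hom =
      pullback.snd U.hom (specMap (algebraMap k B)) ≫ specMap e := by
  have h : g.left ≫ pullback.snd X.hom (specMap e) =
      pullback.snd U.hom (specMap (algebraMap k B)) := Over.w g
  rw [Category.assoc, pullback.condition, ← Category.assoc, h]

/-- The morphism `U ×_k C → U ×_k B` induced by a homomorphism of `k`-algebras `B → C`. -/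
def baseRestrict {B C : Type u} [CommRing B] [Algebra k B] [CommRing C] [Algebra k C]
    (α : B →ₐ[k] C) (U : Over (Spec (CommRingCat.of k))) :
    pullback U.hom (specMap (algebraMap k C)) ⟶ pullback U.hom (specMap (algebraMap k B)) :=
  pullback.lift (pullback.fst _ _) (pullback.snd _ _ ≫ specMap α.toRingHom) (by
    rw [pullback.condition, Category.assoc, ← Spec.map_comp, ← CommRingCat.ofHom_comp]
    congr 3
    exact α.comp_algebraMap.symm)

/-- The map on points induced by a homomorphism of `k`-algebras `α : B → C` with `α ∘ e = f`:
restrict `U ×_k B → X` to `U ×_k C`. -/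
def comparePt {B C : Type u} [CommRing B] [Algebra k B] [CommRing C] [Algebra k C]
    {e : k →+* B} {f : k →+* C} (α : B →ₐ[k] C) (h : ∀ x, α (e x) = f x)
    {X U : Over (Spec (CommRingCat.of k))} (g : ProlongationPt e X U) : ProlongationPt f X U :=
  Over.homMk (pullback.lift (baseRestrict α U ≫ g.left ≫ pullback.fst X.hom (specMap e))
    (pullback.snd _ _) (by
      rw [Category.assoc, prolongationPt_comm, baseRestrict, pullback.lift_snd_assoc,
        Category.assoc, ← Spec.map_comp, ← CommRingCat.ofHom_comp]
      congr 3
      exact RingHom.ext h)) (by exact pullback.lift_snd _ _ _)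

/-- The morphism `τ(X, B, e) → τ(X, C, f)` induced by `α : B → C`. -/
def Prolongation.compare {B C : Type u} [CommRing B] [Algebra k B] [CommRing C] [Algebra k C]
    {e : k →+* B} {f : k →+* C} (α : B →ₐ[k] C) (h : ∀ x, α (e x) = f x)
    {X : Over (Spec (CommRingCat.of k))} (P : Prolongation e X) (Q : Prolongation f X) :
    P.space ⟶ Q.space :=
  Q.repr.homEquiv.symm (comparePt α h (P.repr.homEquiv (𝟙 P.space)))

/-- The composite `U → U ×_k B → X`, where the first morphism is induced by a homomorphism of
`k`-algebras `π : B → k`. -/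
def reducePt {B : Type u} [CommRing B] [Algebra k B] {e : k →+* B} (π : B →ₐ[k] k)
    {X U : Over (Spec (CommRingCat.of k))} (g : ProlongationPt e X U) : U.left ⟶ X.left :=
  pullback.lift (𝟙 U.left) (U.hom ≫ specMap π.toRingHom) (by
    rw [Category.assoc, ← Spec.map_comp, ← CommRingCat.ofHom_comp]
    have : (π.toRingHom).comp (algebraMap k B) = RingHom.id k := π.comp_algebraMap
    rw [this]
    simp) ≫ g.left ≫ pullback.fst X.hom (specMap e)

lemma reducePt_comm {B : Type u} [CommRing B] [Algebra k B] {e : k →+* B} (π : B →ₐ[k] k)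
    {X U : Over (Spec (CommRingCat.of k))} (g : ProlongationPt e X U) {f : k →+* k}
    (h : ∀ x, π (e x) = f x) : reducePt π g ≫ X.hom = U.hom ≫ specMap f := by
  rw [reducePt, Category.assoc, prolongationPt_comm, pullback.lift_snd_assoc, Category.assoc,
    ← Spec.map_comp, ← CommRingCat.ofHom_comp]
  congr 3
  exact RingHom.ext h

/-- The morphism `τ(X, B, e) → X^{f}` induced by an augmentation `π : B → k`, with
`f = π ∘ e`. -/
def Prolongation.toTransform {B : Type u} [CommRing B] [Algebra k B] {e : k →+* B}
    {X : Over (Spec (CommRingCat.of k))} (P : Prolongation e X) (π : B →ₐ[k] k) (f : k →+* k)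
    (h : ∀ x, π (e x) = f x) : P.space ⟶ transform f X :=
  Over.homMk (pullback.lift (reducePt π (P.repr.homEquiv (𝟙 P.space))) P.space.hom
    (reducePt_comm π _ h)) (by exact pullback.lift_snd _ _ _)

end Prolongation

/-! ### Tangent bundles -/

section Tangent

variable {k : Type u} [CommRing k]

/-- The tangent bundle of `Y`: the Weil restriction of `Y ×_k k[ε]` from `k[ε]` to `k`. -/
abbrev TangentScheme (Y : Over (Spec (CommRingCat.of k))) :=
  Prolongation (algebraMap k (DualNumber k)) Y

namespace TangentScheme

variable {Y : Over (Spec (CommRingCat.of k))}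

/-- The structure morphism `TY ⟶ Y`, given by `ε ↦ 0`. -/
def proj (T : TangentScheme Y) : T.space ⟶ Y :=
  Over.homMk (reducePt (TrivSqZeroExt.fstHom k k k) (T.repr.homEquiv (𝟙 T.space))) (by
    rw [reducePt_comm (f := RingHom.id k) _ _ (fun x => by
      simp [TrivSqZeroExt.algebraMap_eq_inl])]
    exact (congrArg (_ ≫ ·) (Spec.map_id _)).trans (Category.comp_id _))

/-- The zero tangent vector at a point `a : U ⟶ Y`: the constant extension of `a` to
`U ×_k k[ε]`. -/
def zeroAt (T : TangentScheme Y) {U : Over (Spec (CommRingCat.of k))} (a : U ⟶ Y) :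
    U ⟶ T.space :=
  T.repr.homEquiv.symm ((Over.pullback (specMap (algebraMap k (DualNumber k)))).map a)

/-- The tangent vectors `v`, `w`, `s` satisfy `s = v + w`: there is a point of `Y` with values in
`U ×_k k[ε₁, ε₂]/(ε₁, ε₂)²` restricting to `v` under `ε₂ ↦ 0, ε₁ ↦ ε`, to `w` under
`ε₁ ↦ 0, ε₂ ↦ ε`, and to `s` under `ε₁, ε₂ ↦ ε`. -/
def IsSum (T : TangentScheme Y) {U : Over (Spec (CommRingCat.of k))} (v w s : U ⟶ T.space) :
    Prop :=
  ∃ z : ProlongationPt (algebraMap k (TrivSqZeroExt k (k × k))) Y U,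
    comparePt (TrivSqZeroExt.map (LinearMap.fst k k k)) (AlgHom.commutes _) z =
      T.repr.homEquiv v ∧
    comparePt (TrivSqZeroExt.map (LinearMap.snd k k k)) (AlgHom.commutes _) z =
      T.repr.homEquiv w ∧
    comparePt (TrivSqZeroExt.map (LinearMap.fst k k k + LinearMap.snd k k k))
      (AlgHom.commutes _) z = T.repr.homEquiv s

/-- `add : TY ×_Y TY ⟶ TY` is the fibrewise addition of tangent vectors. -/
def IsAddition (T : TangentScheme Y) (add : pullback T.proj T.proj ⟶ T.space) : Prop :=
  add ≫ T.proj = pullback.fst _ _ ≫ T.proj ∧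
  ∀ ⦃U : Over (Spec (CommRingCat.of k))⦄ (v w : U ⟶ T.space) (h : v ≫ T.proj = w ≫ T.proj),
    T.IsSum v w (pullback.lift v w h ≫ add)

/-- The `m`-th power of the tangent bundle, that is, its `m`-fold fibre power over `Y`. -/
abbrev pow (T : TangentScheme Y) (m : ℕ) : Over (Spec (CommRingCat.of k)) :=
  widePullback Y (fun _ : Fin m => T.space) (fun _ => T.proj)

/-- The structure morphism `(TY)^m ⟶ Y`. -/
abbrev powProj (T : TangentScheme Y) (m : ℕ) : T.pow m ⟶ Y :=
  WidePullback.base (fun _ : Fin m => T.proj)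

/-- The `j`-th tangent vector of a point of `(TY)^m`. -/
abbrev coord (T : TangentScheme Y) {m : ℕ} {U : Over (Spec (CommRingCat.of k))}
    (y : U ⟶ T.pow m) (j : Fin m) : U ⟶ T.space :=
  y ≫ WidePullback.π (fun _ : Fin m => T.proj) j

lemma coord_proj (T : TangentScheme Y) {m : ℕ} {U : Over (Spec (CommRingCat.of k))}
    (y : U ⟶ T.pow m) (j : Fin m) : T.coord y j ≫ T.proj = y ≫ T.powProj m := by
  rw [Category.assoc, WidePullback.π_arrow]

end TangentScheme

/-- Let `q : P ⟶ Q` and `r : Q ⟶ Y` be morphisms of schemes over `k`.  A `k`-morphism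
`γ : (TY)^m ×_Y P ⟶ P` makes `q` into a torsor for `(TY)^m`: it is a morphism over `Q`, it is an
action of the additive group of `m`-tuples of tangent vectors (on points with values in any scheme
`U` over `k`), this action is simply transitive on the fibres of `q`, and `q` has sections locally
on `Q` for the Zariski topology. -/
structure IsTangentTorsor {Y : Over (Spec (CommRingCat.of k))} (T : TangentScheme Y)
    (add : pullback T.proj T.proj ⟶ T.space) {P Q : Over (Spec (CommRingCat.of k))}
    (q : P ⟶ Q) (r : Q ⟶ Y) (m : ℕ) (γ : pullback (T.powProj m) (q ≫ r) ⟶ P) : Prop where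
  over_base : γ ≫ q = pullback.snd (T.powProj m) (q ≫ r) ≫ q
  zero_act : ∀ ⦃U : Over (Spec (CommRingCat.of k))⦄ (c : U ⟶ P) (y : U ⟶ T.pow m)
    (hy : y ≫ T.powProj m = c ≫ q ≫ r),
    (∀ j, T.coord y j = T.zeroAt (c ≫ q ≫ r)) → pullback.lift y c hy ≫ γ = c
  add_act : ∀ ⦃U : Over (Spec (CommRingCat.of k))⦄ (c : U ⟶ P) (y z s : U ⟶ T.pow m)
    (hy : y ≫ T.powProj m = c ≫ q ≫ r) (hz : z ≫ T.powProj m = c ≫ q ≫ r)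
    (hs : s ≫ T.powProj m = c ≫ q ≫ r),
    (∀ j, T.coord s j = pullback.lift (T.coord y j) (T.coord z j)
      (by rw [T.coord_proj, T.coord_proj, hy, hz]) ≫ add) →
    pullback.lift s c hs ≫ γ =
      pullback.lift y (pullback.lift z c hz ≫ γ) (by
        rw [hy, Category.assoc, ← Category.assoc γ, over_base, Category.assoc,
          pullback.lift_snd_assoc]) ≫ γ
  simply_transitive : ∀ ⦃U : Over (Spec (CommRingCat.of k))⦄ (c c' : U ⟶ P),
    c ≫ q = c' ≫ q → ∃! y : U ⟶ T.pow m,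
      ∃ hy : y ≫ T.powProj m = c ≫ q ≫ r, pullback.lift y c hy ≫ γ = c'
  locally_trivial : ∀ b : Q.left, ∃ W : Q.left.Opens, b ∈ W ∧
    ∃ σ : (W : Scheme.{u}) ⟶ P.left, σ ≫ q.left = W.ι

end Tangent

/-! ### The filtration of a local algebra by powers of its maximal ideal -/

section Local

open IsLocalRing

variable (k : Type u) [Field k] {B : Type u} [CommRing B] [Algebra k B] [IsLocalRing B]

/-- The algebra `B_i = B / 𝔪^(i+1)`. -/
abbrev Level (B : Type u) [CommRing B] [IsLocalRing B] (i : ℕ) : Type u :=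
  B ⧸ maximalIdeal B ^ (i + 1)

/-- The quotient map `B_{i+1} → B_i`. -/
def levelMap (B : Type u) [CommRing B] [Algebra k B] [IsLocalRing B] (i : ℕ) :
    Level B (i + 1) →ₐ[k] Level B i :=
  Ideal.Quotient.factorₐ k (Ideal.pow_le_pow_right (Nat.le_succ (i + 1)))

/-- The dimension over `k` of `𝔪^(i+1) / 𝔪^(i+2)`. -/
def gradedDim (B : Type u) [CommRing B] [Algebra k B] [IsLocalRing B] (i : ℕ) : ℕ :=
  Module.finrank k (↥(maximalIdeal B ^ (i + 1)) ⧸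
    (maximalIdeal B ^ (i + 2)).submoduleOf (maximalIdeal B ^ (i + 1)))

variable {k}

/-- The ring homomorphism `e_i : k → B_i` induced by `e : k → B`. -/
def levelHom (e : k →+* B) (i : ℕ) : k →+* Level B i :=
  (Ideal.Quotient.mk _).comp e

lemma levelMap_levelHom (e : k →+* B) (i : ℕ) (x : k) :
    levelMap k B i (levelHom e (i + 1) x) = levelHom e i x := rfl

/-- The augmentation `B → k` of a local algebra with residue field `k`. -/
def augmentation (hres : Function.Bijective (algebraMap k (ResidueField B))) : B →ₐ[k] k :=
  ((AlgEquiv.ofBijective (Algebra.ofId k (ResidueField B)) hres).symm : _ →ₐ[k] k).comp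
    (IsScalarTower.toAlgHom k B (ResidueField B))

lemma augmentation_eq_zero (hres : Function.Bijective (algebraMap k (ResidueField B)))
    {x : B} (hx : x ∈ maximalIdeal B) : augmentation hres x = 0 := by
  have : algebraMap B (ResidueField B) x = 0 := (residue_eq_zero_iff x).2 hx
  rw [augmentation, AlgHom.comp_apply, IsScalarTower.coe_toAlgHom', this, map_zero]

/-- The augmentation `B_i → k`. -/
def levelAug (hres : Function.Bijective (algebraMap k (ResidueField B))) (i : ℕ) :
    Level B i →ₐ[k] k :=
  Ideal.Quotient.liftₐ _ (augmentation hres) fun _ hx =>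
    augmentation_eq_zero hres (Ideal.pow_le_self (Nat.succ_ne_zero i) hx)

/-- The endomorphism `e_0` of `k` induced by `e : k → B`. -/
def residueEndo (hres : Function.Bijective (algebraMap k (ResidueField B))) (e : k →+* B) :
    k →+* k :=
  (augmentation hres).toRingHom.comp e

lemma levelAug_levelHom (hres : Function.Bijective (algebraMap k (ResidueField B)))
    (e : k →+* B) (i : ℕ) (x : k) :
    levelAug hres i (levelHom e i x) = residueEndo hres e x := rfl

end Local

end

/-!
The points of `τ(X, C, f)` with values in `U` are the `f`-semilinear morphisms `U ×_k C ⟶ X`; all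
arguments are made on these points (`ProlongationPt`).  Suppose that the augmentation `π : C → k`
has nilpotent kernel.  Then `U ⟶ U ×_k C` is surjective, so that a point factors through an open
subscheme of `X` as soon as its reduction does (`ProlongationPt.existsUnique_push_eq`).

*Existence and geometry.*  If `X = Spec A` is étale over an affine space `Spec k[x₁, …, xₙ]`, then a
semilinear homomorphism `A → S ⊗ C` amounts to its reduction `A → S` together with the nilpotent
parts of the images of the `xᵢ`, because étale algebras have unique lifts through nilpotent ideals.
So `τ(X, C, f)` is an affine space over the transform of `X` by the residual endomorphism `f₀` of
`k` (`exists_universal_semilinear`, `exists_prolongation_of_etale`).  A smooth scheme is covered by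
such charts.  The functor of points is a Zariski sheaf covered by the open subfunctors that belong
to the charts, hence is representable (`exists_representableBy_of_locally`,
`Prolongation.nonempty_of_smooth`).  By the same local description `τ(X, C, f)` is smooth and
geometrically irreducible over the transform, hence over `k` (`Prolongation.smooth_toTransform`,
`Prolongation.smooth_hom`).

*The torsor.*  Points with values in a fibre product of augmented algebras are compatible families
of points with values in the factors
(`ProlongationPt.existsUnique_comparePt_of_isFiberProduct`).  Let `A' → A` be a surjection whose
kernel `I` is annihilated by the augmentation ideal, and choose a basis of `I` with `m` elements.
Then `A' ×_A A' ≅ A' ×_k k[ε] ×_k ⋯ ×_k k[ε]`, with `m` factors `k[ε]`, by sending `(x, y)` to `x`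
and the coordinates of `y - x` (`isFiberProduct_pairCoord`).  On points this says that a pair of
points over `A'` with the same image over `A` is one point over `A'` together with `m` tangent
vectors of the transform at its reduction.  This defines the action and shows that it is simply
transitive; that it is an action follows from the same consideration for the triples
`A' ×_A A' ×_A A'` (`IsTranslate.trans`).  Local sections exist because points of smooth schemes
lift locally along nilpotent ideals (`ProlongationPt.exists_comparePt_eq_of_smooth`).  For the
quotients `B_{i+1} → B_i` the kernel is `𝔪^(i+1) / 𝔪^(i+2)`.
-/

noncomputable section

open scoped TensorProduct

/-! ### Points of prolongation spaces -/

namespace ProlongationPt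

section

variable {k : Type u} [CommRing k] {B C D : Type u} [CommRing B] [Algebra k B] [CommRing C]
  [Algebra k C] [CommRing D] [Algebra k D] {e : k →+* B} {f : k →+* C} {d : k →+* D}
  {X X' U V W : Over (Spec (CommRingCat.of k))}

/-- The underlying morphism `U ×_k B ⟶ X` of a point of a prolongation space. -/
def raw (g : ProlongationPt e X U) : pullback U.hom (specMap (algebraMap k B)) ⟶ X.left :=
  g.left ≫ pullback.fst X.hom (specMap e)

lemma raw_comm (g : ProlongationPt e X U) :
    raw g ≫ X.hom = pullback.snd U.hom (specMap (algebraMap k B)) ≫ specMap e :=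
  prolongationPt_comm g

lemma left_snd (g : ProlongationPt e X U) :
    g.left ≫ pullback.snd X.hom (specMap e) =
      pullback.snd U.hom (specMap (algebraMap k B)) :=
  Over.w g

lemma raw_injective : Function.Injective (raw : ProlongationPt e X U → _) := by
  intro g g' h
  apply Over.OverMorphism.ext
  apply pullback.hom_ext
  · exact h
  · exact (left_snd g).trans (left_snd g').symm

/-- A point of a prolongation space, from a morphism `U ×_k B ⟶ X` which is semilinear
with respect to `e`. -/
def mk (h : pullback U.hom (specMap (algebraMap k B)) ⟶ X.left)
    (w : h ≫ X.hom = pullback.snd U.hom (specMap (algebraMap k B)) ≫ specMap e) :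
    ProlongationPt e X U :=
  Over.homMk (pullback.lift h (pullback.snd _ _) w) (by exact pullback.lift_snd _ _ _)

@[simp]
lemma raw_mk (h : pullback U.hom (specMap (algebraMap k B)) ⟶ X.left)
    (w : h ≫ X.hom = pullback.snd U.hom (specMap (algebraMap k B)) ≫ specMap e) :
    raw (mk h w) = h :=
  pullback.lift_fst _ _ _

variable (B) in
/-- The morphism `U ×_k B ⟶ V ×_k B` induced by a morphism `U ⟶ V`. -/
def extendMap (φ : U ⟶ V) : pullback U.hom (specMap (algebraMap k B)) ⟶
    pullback V.hom (specMap (algebraMap k B)) :=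
  ((Over.pullback (specMap (algebraMap k B))).map φ).left

@[simp]
lemma extendMap_fst (φ : U ⟶ V) :
    extendMap B φ ≫ pullback.fst _ _ = pullback.fst _ _ ≫ φ.left :=
  pullback.lift_fst _ _ _

@[simp]
lemma extendMap_snd (φ : U ⟶ V) :
    extendMap B φ ≫ pullback.snd V.hom (specMap (algebraMap k B)) = pullback.snd _ _ :=
  pullback.lift_snd _ _ _

@[simp]
lemma extendMap_snd_assoc (φ : U ⟶ V) {Z : Scheme.{u}}
    (j : Spec (CommRingCat.of B) ⟶ Z) :
    extendMap B φ ≫ pullback.snd V.hom (specMap (algebraMap k B)) ≫ j = pullback.snd _ _ ≫ j := by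
  simp only [← Category.assoc, extendMap_snd]

/-- The pullback of a point along a morphism of test schemes. -/
def pull (φ : U ⟶ V) (g : ProlongationPt e X V) : ProlongationPt e X U :=
  (Over.pullback (specMap (algebraMap k B))).map φ ≫ g

@[simp]
lemma raw_pull (φ : U ⟶ V) (g : ProlongationPt e X V) :
    raw (pull φ g) = extendMap B φ ≫ raw g := by
  simp [raw, pull, extendMap]

@[simp]
lemma pull_id (g : ProlongationPt e X V) : pull (𝟙 V) g = g := by
  simp [pull]

lemma pull_comp (φ : U ⟶ V) (ψ : V ⟶ W) (g : ProlongationPt e X W) :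
    pull (φ ≫ ψ) g = pull φ (pull ψ g) := by
  simp [pull]

/-- The image of a point under a morphism of schemes over `k`. -/
def push (j : X ⟶ X') (g : ProlongationPt e X U) : ProlongationPt e X' U :=
  mk (raw g ≫ j.left) (by rw [Category.assoc, Over.w j, raw_comm])

@[simp]
lemma raw_push (j : X ⟶ X') (g : ProlongationPt e X U) : raw (push j g) = raw g ≫ j.left :=
  raw_mk _ _

lemma push_pull (j : X ⟶ X') (φ : U ⟶ V) (g : ProlongationPt e X V) :
    push j (pull φ g) = pull φ (push j g) :=
  raw_injective (by simp)

@[simp]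
lemma baseRestrict_fst (α : B →ₐ[k] C) (U : Over (Spec (CommRingCat.of k))) :
    baseRestrict α U ≫ pullback.fst _ _ = pullback.fst _ _ :=
  pullback.lift_fst _ _ _

@[simp]
lemma baseRestrict_fst_assoc (α : B →ₐ[k] C) (U : Over (Spec (CommRingCat.of k))) {Z : Scheme.{u}}
    (j : U.left ⟶ Z) :
    baseRestrict α U ≫ pullback.fst _ _ ≫ j = pullback.fst _ _ ≫ j := by
  simp only [← Category.assoc, baseRestrict_fst]

@[simp]
lemma baseRestrict_snd (α : B →ₐ[k] C) (U : Over (Spec (CommRingCat.of k))) :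
    baseRestrict α U ≫ pullback.snd U.hom (specMap (algebraMap k B)) =
      pullback.snd _ _ ≫ specMap α.toRingHom :=
  pullback.lift_snd _ _ _

@[simp]
lemma baseRestrict_snd_assoc (α : B →ₐ[k] C) (U : Over (Spec (CommRingCat.of k))) {Z : Scheme.{u}}
    (j : Spec (CommRingCat.of B) ⟶ Z) :
    baseRestrict α U ≫ pullback.snd U.hom (specMap (algebraMap k B)) ≫ j =
      pullback.snd _ _ ≫ specMap α.toRingHom ≫ j := by
  simp only [← Category.assoc, baseRestrict_snd]

lemma baseRestrict_extendMap (α : B →ₐ[k] C) (φ : U ⟶ V) :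
    extendMap C φ ≫ baseRestrict α V = baseRestrict α U ≫ extendMap B φ := by
  apply pullback.hom_ext <;> simp

lemma baseRestrict_extendMap_assoc (α : B →ₐ[k] C) (φ : U ⟶ V) {Z : Scheme.{u}}
    (j : pullback V.hom (specMap (algebraMap k B)) ⟶ Z) :
    extendMap C φ ≫ baseRestrict α V ≫ j = baseRestrict α U ≫ extendMap B φ ≫ j := by
  simp only [← Category.assoc, baseRestrict_extendMap]

lemma baseRestrict_comp (α : B →ₐ[k] C) (β : C →ₐ[k] D) (U : Over (Spec (CommRingCat.of k))) :
    baseRestrict (β.comp α) U = baseRestrict β U ≫ baseRestrict α U := by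
  apply pullback.hom_ext
  · simp
  · simp only [baseRestrict_snd, Category.assoc, baseRestrict_snd_assoc, ← Spec.map_comp,
      ← CommRingCat.ofHom_comp]
    rfl

@[simp]
lemma raw_comparePt (α : B →ₐ[k] C) (h : ∀ x, α (e x) = f x) (g : ProlongationPt e X U) :
    raw (comparePt α h g) = baseRestrict α U ≫ raw g :=
  pullback.lift_fst _ _ _

lemma comparePt_pull (α : B →ₐ[k] C) (h : ∀ x, α (e x) = f x) (φ : U ⟶ V)
    (g : ProlongationPt e X V) :
    comparePt α h (pull φ g) = pull φ (comparePt α h g) :=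
  raw_injective (by simp [baseRestrict_extendMap_assoc])

lemma comparePt_push (α : B →ₐ[k] C) (h : ∀ x, α (e x) = f x) (j : X ⟶ X')
    (g : ProlongationPt e X U) :
    comparePt α h (push j g) = push j (comparePt α h g) :=
  raw_injective (by simp)

lemma comparePt_comp (α : B →ₐ[k] C) (h : ∀ x, α (e x) = f x) (β : C →ₐ[k] D)
    (h' : ∀ x, β (f x) = d x) (γ : B →ₐ[k] D) (hγ : β.comp α = γ) (g : ProlongationPt e X U) :
    comparePt β h' (comparePt α h g) =
      comparePt γ (fun x => by rw [← hγ, AlgHom.comp_apply, h, h']) g := by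
  subst hγ
  exact raw_injective (by simp [baseRestrict_comp])

lemma comparePt_of_eq_id (α : B →ₐ[k] B) (hα : α = AlgHom.id k B) (h : ∀ x, α (e x) = e x)
    (g : ProlongationPt e X U) : comparePt α h g = g := by
  subst hα
  apply raw_injective
  have : baseRestrict (AlgHom.id k B) U = 𝟙 _ := by
    apply pullback.hom_ext
    · simp
    · rw [baseRestrict_snd, Category.id_comp]
      exact (congrArg (_ ≫ ·) (Spec.map_id _)).trans (Category.comp_id _)
  simp [this]

lemma comparePt_bijective (α : B →ₐ[k] C) (hα : Function.Bijective α)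
    (h : ∀ x, α (e x) = f x) :
    Function.Bijective (comparePt α h : ProlongationPt e X U → ProlongationPt f X U) := by
  let E := AlgEquiv.ofBijective α hα
  have h' : ∀ x, (E.symm : C →ₐ[k] B) (f x) = e x := fun x => by
    rw [← h]; exact E.symm_apply_apply _
  refine Function.bijective_iff_has_inverse.2 ⟨comparePt (E.symm : C →ₐ[k] B) h', fun g => ?_,
    fun g => ?_⟩
  · rw [comparePt_comp _ _ _ _ (AlgHom.id k B) (by ext x; exact E.symm_apply_apply x)]
    exact comparePt_of_eq_id _ rfl _ _
  · rw [comparePt_comp _ _ _ _ (AlgHom.id k C) (by ext x; exact E.apply_symm_apply x)]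
    exact comparePt_of_eq_id _ rfl _ _

/-- The closed immersion `U ⟶ U ×_k B` induced by an augmentation of `B`. -/
def augSection (π : B →ₐ[k] k) (U : Over (Spec (CommRingCat.of k))) :
    U.left ⟶ pullback U.hom (specMap (algebraMap k B)) :=
  pullback.lift (𝟙 U.left) (U.hom ≫ specMap π.toRingHom) (by
    rw [Category.assoc, ← Spec.map_comp, ← CommRingCat.ofHom_comp]
    have : (π.toRingHom).comp (algebraMap k B) = RingHom.id k := π.comp_algebraMap
    rw [this]
    simp)

lemma reducePt_eq (π : B →ₐ[k] k) (g : ProlongationPt e X U) :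
    reducePt π g = augSection π U ≫ raw g := rfl

@[simp]
lemma augSection_fst (π : B →ₐ[k] k) : augSection π U ≫ pullback.fst _ _ = 𝟙 _ :=
  pullback.lift_fst _ _ _

@[simp]
lemma augSection_fst_assoc (π : B →ₐ[k] k) {Z : Scheme.{u}}
    (j : U.left ⟶ Z) :
    augSection π U ≫ pullback.fst _ _ ≫ j = j := by
  simp only [← Category.assoc, augSection_fst, Category.id_comp]

@[simp]
lemma augSection_snd (π : B →ₐ[k] k) :
    augSection π U ≫ pullback.snd U.hom (specMap (algebraMap k B)) =
      U.hom ≫ specMap π.toRingHom :=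
  pullback.lift_snd _ _ _

@[simp]
lemma augSection_snd_assoc (π : B →ₐ[k] k) {Z : Scheme.{u}}
    (j : Spec (CommRingCat.of B) ⟶ Z) :
    augSection π U ≫ pullback.snd U.hom (specMap (algebraMap k B)) ≫ j =
      U.hom ≫ specMap π.toRingHom ≫ j := by
  simp only [← Category.assoc, augSection_snd]

lemma augSection_extendMap (π : B →ₐ[k] k) (φ : U ⟶ V) :
    augSection π U ≫ extendMap B φ = φ.left ≫ augSection π V := by
  apply pullback.hom_ext <;> simp

lemma augSection_extendMap_assoc (π : B →ₐ[k] k) (φ : U ⟶ V) {Z : Scheme.{u}}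
    (j : pullback V.hom (specMap (algebraMap k B)) ⟶ Z) :
    augSection π U ≫ extendMap B φ ≫ j = φ.left ≫ augSection π V ≫ j := by
  simp only [← Category.assoc, augSection_extendMap]

lemma augSection_baseRestrict (π : B →ₐ[k] k) (π' : C →ₐ[k] k) (α : B →ₐ[k] C)
    (h : π'.comp α = π) (U : Over (Spec (CommRingCat.of k))) :
    augSection π' U ≫ baseRestrict α U = augSection π U := by
  subst h
  apply pullback.hom_ext
  · simp
  · rw [Category.assoc, baseRestrict_snd, augSection_snd_assoc, augSection_snd, ← Spec.map_comp,
      ← CommRingCat.ofHom_comp]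
    rfl

lemma augSection_baseRestrict_assoc (π : B →ₐ[k] k) (π' : C →ₐ[k] k) (α : B →ₐ[k] C)
    (h : π'.comp α = π) (U : Over (Spec (CommRingCat.of k))) {Z : Scheme.{u}}
    (j : pullback U.hom (specMap (algebraMap k B)) ⟶ Z) :
    augSection π' U ≫ baseRestrict α U ≫ j = augSection π U ≫ j := by
  simp only [← Category.assoc, augSection_baseRestrict π π' α h U]

lemma reducePt_pull (π : B →ₐ[k] k) (φ : U ⟶ V) (g : ProlongationPt e X V) :
    reducePt π (pull φ g) = φ.left ≫ reducePt π g := by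
  simp [reducePt_eq, augSection_extendMap_assoc]

lemma reducePt_push (π : B →ₐ[k] k) (j : X ⟶ X') (g : ProlongationPt e X U) :
    reducePt π (push j g) = reducePt π g ≫ j.left := by
  simp [reducePt_eq]

lemma reducePt_comparePt (π : B →ₐ[k] k) (π' : C →ₐ[k] k) (α : B →ₐ[k] C)
    (hπ : π'.comp α = π) (h : ∀ x, α (e x) = f x) (g : ProlongationPt e X U) :
    reducePt π' (comparePt α h g) = reducePt π g := by
  simp [reducePt_eq, augSection_baseRestrict_assoc π π' α hπ]

/-- Points of `X^a` with values in `U ×_k B`, seen as points of `X`. -/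
def untwist {a : k →+* k} {b : k →+* B} (h : ∀ x, b (a x) = e x)
    (g : ProlongationPt b (transform a X) U) : ProlongationPt e X U :=
  mk (raw g ≫ pullback.fst X.hom (specMap a)) (by
    have := raw_comm g
    change raw g ≫ pullback.snd X.hom (specMap a) = _ at this
    rw [Category.assoc, pullback.condition, ← Category.assoc, this, Category.assoc, ← Spec.map_comp,
      ← CommRingCat.ofHom_comp]
    congr 3
    exact RingHom.ext h)

@[simp]
lemma raw_untwist {a : k →+* k} {b : k →+* B} (h : ∀ x, b (a x) = e x)
    (g : ProlongationPt b (transform a X) U) :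
    raw (untwist h g) = raw g ≫ pullback.fst X.hom (specMap a) :=
  raw_mk _ _

lemma untwist_bijective {a : k →+* k} {b : k →+* B} (h : ∀ x, b (a x) = e x) :
    Function.Bijective
      (untwist h : ProlongationPt b (transform a X) U → ProlongationPt e X U) := by
  constructor
  · intro g g' hg
    apply raw_injective
    have := congrArg raw hg
    simp only [raw_untwist] at this
    apply pullback.hom_ext this
    exact (raw_comm g).trans (raw_comm g').symm
  · intro g
    refine ⟨mk (pullback.lift (raw g)
      (pullback.snd U.hom (specMap (algebraMap k B)) ≫ specMap b) ?_) ?_, ?_⟩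
    · rw [raw_comm, Category.assoc, ← Spec.map_comp, ← CommRingCat.ofHom_comp]
      congr 3
      exact (RingHom.ext h).symm
    · exact pullback.lift_snd _ _ _
    · apply raw_injective
      rw [raw_untwist, raw_mk]
      exact pullback.lift_fst _ _ _

lemma untwist_pull {a : k →+* k} {b : k →+* B} (h : ∀ x, b (a x) = e x) (φ : U ⟶ V)
    (g : ProlongationPt b (transform a X) V) :
    untwist h (pull φ g) = pull φ (untwist h g) :=
  raw_injective (by simp)

lemma untwist_comparePt {a : k →+* k} {b : k →+* B} {c : k →+* C} (h : ∀ x, b (a x) = e x)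
    (α : B →ₐ[k] C) (hb : ∀ x, α (b x) = c x) (h' : ∀ x, c (a x) = f x)
    (g : ProlongationPt b (transform a X) U) :
    untwist h' (comparePt α hb g) =
      comparePt α (fun x => by rw [← h, hb, h']) (untwist h g) :=
  raw_injective (by simp)

lemma reducePt_untwist {a : k →+* k} {b : k →+* B} (h : ∀ x, b (a x) = e x) (π : B →ₐ[k] k)
    (g : ProlongationPt b (transform a X) U) :
    reducePt π (untwist h g) = reducePt π g ≫ pullback.fst X.hom (specMap a) := by
  simp [reducePt_eq]

end

end ProlongationPt

namespace Prolongation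

open ProlongationPt

variable {k : Type u} [CommRing k] {B C : Type u} [CommRing B] [Algebra k B] [CommRing C]
  [Algebra k C] {e : k →+* B} {f : k →+* C} {X U V : Over (Spec (CommRingCat.of k))}

/-- The point of the functor that corresponds to a morphism into the prolongation space. -/
def pt (P : Prolongation e X) (x : U ⟶ P.space) : ProlongationPt e X U :=
  P.repr.homEquiv x

lemma pt_bijective (P : Prolongation e X) :
    Function.Bijective (P.pt : (U ⟶ P.space) → ProlongationPt e X U) :=
  P.repr.homEquiv.bijective

lemma pt_injective (P : Prolongation e X) :
    Function.Injective (P.pt : (U ⟶ P.space) → ProlongationPt e X U) :=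
  P.repr.homEquiv.injective

/-- The morphism into the prolongation space that corresponds to a point of the functor. -/
def hom (P : Prolongation e X) (g : ProlongationPt e X U) : U ⟶ P.space :=
  P.repr.homEquiv.symm g

@[simp]
lemma pt_hom (P : Prolongation e X) (g : ProlongationPt e X U) : P.pt (P.hom g) = g :=
  P.repr.homEquiv.apply_symm_apply g

lemma pt_comp (P : Prolongation e X) (φ : U ⟶ V) (x : V ⟶ P.space) :
    P.pt (φ ≫ x) = pull φ (P.pt x) :=
  P.repr.homEquiv_comp φ x

lemma pt_eq_pull (P : Prolongation e X) (x : U ⟶ P.space) :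
    P.pt x = pull x (P.pt (𝟙 _)) := by
  rw [← pt_comp, Category.comp_id]

lemma pt_compare (α : B →ₐ[k] C) (h : ∀ x, α (e x) = f x) (P : Prolongation e X)
    (Q : Prolongation f X) (x : U ⟶ P.space) :
    Q.pt (x ≫ P.compare α h Q) = comparePt α h (P.pt x) := by
  rw [pt_comp, pt_eq_pull P x, comparePt_pull]
  congr 1
  exact Q.pt_hom _

/-- The first component of the morphism to the transform is the reduction of points. -/
lemma comp_toTransform_fst (P : Prolongation e X) (π : B →ₐ[k] k) (a : k →+* k)
    (h : ∀ x, π (e x) = a x) (x : U ⟶ P.space) :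
    (x ≫ P.toTransform π a h).left ≫ pullback.fst X.hom (specMap a) =
      reducePt π (P.pt x) := by
  rw [pt_eq_pull, reducePt_pull, Over.comp_left, Category.assoc]
  congr 1
  exact pullback.lift_fst _ _ _

lemma transform_hom_ext {a : k →+* k} {x y : U ⟶ transform a X}
    (h : x.left ≫ pullback.fst X.hom (specMap a) = y.left ≫ pullback.fst X.hom (specMap a)) :
    x = y := by
  apply Over.OverMorphism.ext
  apply pullback.hom_ext h
  exact (Over.w x).trans (Over.w y).symm

/-- A bijective homomorphism of algebras induces an isomorphism of prolongation spaces. -/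
lemma isIso_compare (α : B →ₐ[k] C) (hα : Function.Bijective α) (h : ∀ x, α (e x) = f x)
    (P : Prolongation e X) (Q : Prolongation f X) : IsIso (P.compare α h Q) := by
  obtain ⟨g, hg⟩ := (comparePt_bijective α hα h).2 (Q.pt (𝟙 Q.space))
  have h1 : P.hom g ≫ P.compare α h Q = 𝟙 _ :=
    Q.pt_injective (by rw [pt_compare, pt_hom, hg])
  refine ⟨P.hom g, P.pt_injective ((comparePt_bijective α hα h).1 ?_), h1⟩
  rw [← pt_compare _ _ _ Q, ← pt_compare _ _ _ Q, Category.assoc, h1]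
  simp

end Prolongation

namespace TangentScheme

open ProlongationPt

variable {k : Type u} [CommRing k] {Y U : Over (Spec (CommRingCat.of k))}

/-- The projection of the tangent bundle is the reduction of points. -/
lemma comp_proj_left (T : TangentScheme Y) (v : U ⟶ T.space) :
    (v ≫ T.proj).left = reducePt (TrivSqZeroExt.fstHom k k k) (Prolongation.pt T v) := by
  rw [Prolongation.pt_eq_pull, reducePt_pull]
  rfl

lemma raw_pt_zeroAt (T : TangentScheme Y) (a : U ⟶ Y) :
    raw (Prolongation.pt T (T.zeroAt a)) = pullback.fst _ _ ≫ a.left := by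
  have : Prolongation.pt T (T.zeroAt a) =
      (Over.pullback (specMap (algebraMap k (DualNumber k)))).map a :=
    Prolongation.pt_hom _ _
  rw [this]
  exact extendMap_fst a

end TangentScheme

/-! ### Infinitesimal thickenings -/

namespace ProlongationPt

section

variable {k : Type u} [CommRing k] {B : Type u} [CommRing B] [Algebra k B] {e : k →+* B}
  {X X' U V : Over (Spec (CommRingCat.of k))}

lemma surjective_specMap_of_isNilpotent (π : B →ₐ[k] k)
    (hπ : ∀ x, π x = 0 → IsNilpotent x) : Surjective (specMap π.toRingHom) := by
  constructor
  have hs : Function.Surjective π.toRingHom := fun x => ⟨algebraMap k B x, π.commutes x⟩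
  have := range_comap_of_surjective _ π.toRingHom hs
  rw [← Set.range_eq_univ]
  refine this.trans ?_
  exact (PrimeSpectrum.zeroLocus_eq_univ_iff _).2 fun x hx => hπ x hx

/-- The morphism `U ⟶ U ×_k B` is the base change of `Spec k ⟶ Spec B`. -/
lemma isPullback_augSection (π : B →ₐ[k] k) (U : Over (Spec (CommRingCat.of k))) :
    IsPullback (augSection π U) U.hom (pullback.snd U.hom (specMap (algebraMap k B)))
      (specMap π.toRingHom) := by
  have h := IsPullback.of_hasPullback U.hom (specMap (algebraMap k B))
  have hid : specMap π.toRingHom ≫ specMap (algebraMap k B) = 𝟙 _ := by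
    rw [← Spec.map_comp, ← CommRingCat.ofHom_comp]
    have : (π.toRingHom).comp (algebraMap k B) = RingHom.id k := π.comp_algebraMap
    rw [this]
    simp
  refine IsPullback.of_right ?_ (augSection_snd π) h
  rw [augSection_fst, hid]
  exact IsPullback.of_id_fst

lemma surjective_augSection (π : B →ₐ[k] k) (hπ : ∀ x, π x = 0 → IsNilpotent x)
    (U : Over (Spec (CommRingCat.of k))) : Surjective (augSection π U) := by
  have := surjective_specMap_of_isNilpotent π hπ
  exact MorphismProperty.of_isPullback (isPullback_augSection π U).flip this

/-- Since `U ⟶ U ×_k B` is surjective, a point of the prolongation space of `X` whose reduction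
lies in an open subscheme is a point of the prolongation space of that subscheme. -/
lemma existsUnique_push_eq (π : B →ₐ[k] k) (hπ : ∀ x, π x = 0 → IsNilpotent x)
    (j : X' ⟶ X) [IsOpenImmersion j.left] (g : ProlongationPt e X U)
    (hg : Set.range (reducePt π g) ⊆ Set.range j.left) :
    ∃! g' : ProlongationPt e X' U, push j g' = g := by
  have hsurj := (surjective_augSection π hπ U).surj
  have hr : Set.range (raw g) ⊆ Set.range j.left := by
    rintro _ ⟨z, rfl⟩
    obtain ⟨y, rfl⟩ := hsurj z
    apply hg
    exact ⟨y, by rw [reducePt_eq]; rfl⟩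
  refine ⟨mk (IsOpenImmersion.lift j.left (raw g) hr) ?_, ?_, ?_⟩
  · rw [← Over.w j, IsOpenImmersion.lift_fac_assoc, raw_comm]
  · apply raw_injective
    simp
  · intro g' h'
    apply raw_injective
    rw [raw_mk, ← cancel_mono j.left, IsOpenImmersion.lift_fac, ← h', raw_push]

lemma push_injective (j : X' ⟶ X) [IsOpenImmersion j.left] :
    Function.Injective (push j : ProlongationPt e X' U → ProlongationPt e X U) := by
  intro g g' h
  apply raw_injective
  rw [← cancel_mono j.left, ← raw_push, ← raw_push, h]

lemma range_reducePt_push (π : B →ₐ[k] k) (j : X' ⟶ X) (g : ProlongationPt e X' U) :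
    Set.range (reducePt π (push j g)) ⊆ Set.range j.left := by
  rw [reducePt_push]
  rintro _ ⟨z, rfl⟩
  exact ⟨reducePt π g z, rfl⟩

end

end ProlongationPt

/-! ### Affine schemes over a ring -/

section Affine

variable (k : Type u) [CommRing k]

/-- The spectrum of a `k`-algebra, as a scheme over `k`. -/
abbrev specOver (A : Type u) [CommRing A] [Algebra k A] : Over (Spec (CommRingCat.of k)) :=
  Over.mk (specMap (algebraMap k A))

variable {k} {A S S' : Type u} [CommRing A] [Algebra k A] [CommRing S] [Algebra k S] [CommRing S']
  [Algebra k S']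

/-- The morphism of spectra over `k` induced by a homomorphism of algebras. -/
def specOverMap (φ : A →ₐ[k] S) : specOver k S ⟶ specOver k A :=
  Over.homMk (specMap φ.toRingHom) (by
    change specMap _ ≫ specMap _ = specMap _
    rw [← Spec.map_comp, ← CommRingCat.ofHom_comp]
    congr 2
    exact φ.comp_algebraMap)

lemma specOverMap_bijective :
    Function.Bijective (specOverMap : (A →ₐ[k] S) → (specOver k S ⟶ specOver k A)) := by
  constructor
  · intro φ ψ h
    have := congrArg (fun h => h.left) h
    have := congrArg (fun f => f.hom) (Spec.map_injective this)
    exact AlgHom.ext fun x => congrArg (fun f : A →+* S => f x) this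
  · intro h
    obtain ⟨φ, hφ⟩ := Spec.map_surjective h.left
    have hw := Over.w h
    rw [← hφ] at hw
    have hw' := congrArg (fun f => f.hom) (Spec.map_injective ((Spec.map_comp _ _).trans hw))
    refine ⟨{ φ.hom with commutes' := fun x => congrArg (fun f : k →+* S => f x) hw' }, ?_⟩
    apply Over.OverMorphism.ext
    exact hφ

/-- Every point of a scheme over `k` has an arbitrarily small affine open neighbourhood. -/
lemma exists_specOver_openImmersion (U : Over (Spec (CommRingCat.of k))) (x : U.left)
    (O : U.left.Opens) (hx : x ∈ O) :
    ∃ (S : Type u) (_ : CommRing S) (_ : Algebra k S) (j : specOver k S ⟶ U),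
      IsOpenImmersion j.left ∧ x ∈ Set.range j.left ∧ Set.range j.left ⊆ O := by
  obtain ⟨R, f, hf, hxf, hO⟩ := Scheme.exists_affine_mem_range_and_range_subset hx
  obtain ⟨φ, hφ⟩ := Spec.map_surjective (f ≫ U.hom)
  let : Algebra k R := φ.hom.toAlgebra
  exact ⟨R, inferInstance, inferInstance, Over.homMk f hφ.symm, hf, hxf, hO⟩

end Affine

/-! ### Lifting ring homomorphisms through nilpotent ideals -/

section Lifting

variable {P A B C : Type*} [CommRing P] [CommRing A] [Algebra P A] [CommRing B] [CommRing C]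

/-- The lifting property of formally smooth algebras for plain ring homomorphisms.  The source and
the target need not carry a `P`-algebra structure, so it applies to homomorphisms which are
semilinear with respect to a ring homomorphism other than the structure map. -/
lemma Algebra.FormallySmooth.exists_ringHom_lift [Algebra.FormallySmooth P A] (p : B →+* C)
    (hp : Function.Surjective p) (hker : IsNilpotent (RingHom.ker p)) (s : P →+* B) (g : A →+* C)
    (hg : g.comp (algebraMap P A) = p.comp s) :
    ∃ φ : A →+* B, φ.comp (algebraMap P A) = s ∧ p.comp φ = g := by
  let : Algebra P B := s.toAlgebra
  let : Algebra P C := (p.comp s).toAlgebra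
  let p' : B →ₐ[P] C := { p with commutes' := fun _ => rfl }
  let g' : A →ₐ[P] C := { g with commutes' := fun x => RingHom.congr_fun hg x }
  let φ := Algebra.FormallySmooth.liftOfSurjective g' p' hp hker
  refine ⟨φ.toRingHom, φ.comp_algebraMap, ?_⟩
  ext x
  exact Algebra.FormallySmooth.liftOfSurjective_apply g' p' hp hker x

/-- The uniqueness of lifts for formally unramified algebras, for plain ring homomorphisms. -/
lemma Algebra.FormallyUnramified.ringHom_ext [Algebra.FormallyUnramified P A] (p : B →+* C)
    (hker : IsNilpotent (RingHom.ker p)) (φ φ' : A →+* B)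
    (h : φ.comp (algebraMap P A) = φ'.comp (algebraMap P A)) (h' : p.comp φ = p.comp φ') :
    φ = φ' := by
  let : Algebra P B := (φ.comp (algebraMap P A)).toAlgebra
  let φ₁ : A →ₐ[P] B := { φ with commutes' := fun _ => rfl }
  let φ₂ : A →ₐ[P] B := { φ' with commutes' := fun x => (RingHom.congr_fun h x).symm }
  have := Algebra.FormallyUnramified.lift_unique_of_ringHom p hker φ₁ φ₂ h'
  ext x
  exact AlgHom.congr_fun this x

end Lifting

section Tensor

variable {k : Type*} [CommRing k] {S S' C D : Type*} [CommRing S] [Algebra k S] [CommRing S']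
  [Algebra k S'] [CommRing C] [Algebra k C] [CommRing D] [Algebra k D]

/-- The homomorphism `S ⊗ C → S` induced by an augmentation of `C`. -/
def augTensor (S : Type*) [CommRing S] [Algebra k S] (π : C →ₐ[k] k) : S ⊗[k] C →ₐ[S] S :=
  (Algebra.TensorProduct.rid k S S).toAlgHom.comp (Algebra.TensorProduct.map (AlgHom.id S S) π)

@[simp]
lemma augTensor_tmul (π : C →ₐ[k] k) (s : S) (c : C) :
    augTensor S π (s ⊗ₜ c) = π c • s := by
  simp [augTensor]

lemma augTensor_map_left (π : C →ₐ[k] k) (ψ : S →ₐ[k] S') (x : S ⊗[k] C) :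
    augTensor S' π (Algebra.TensorProduct.map ψ (AlgHom.id k C) x) = ψ (augTensor S π x) := by
  induction x with
  | zero => simp
  | tmul x y => simp
  | add x y hx hy => simp only [map_add, hx, hy]

lemma isNilpotent_ker_tensorMap (S : Type*) [CommRing S] [Algebra k S] (α : C →ₐ[k] D)
    (hα : Function.Surjective α) (hker : IsNilpotent (RingHom.ker α)) :
    IsNilpotent (RingHom.ker (Algebra.TensorProduct.map (AlgHom.id k S) α)) := by
  rw [Algebra.TensorProduct.lTensor_ker α hα]
  obtain ⟨n, hn⟩ := hker
  refine ⟨n, ?_⟩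
  rw [← Ideal.map_pow, hn]
  exact Ideal.map_bot

lemma isNilpotent_ker_augTensor (S : Type*) [CommRing S] [Algebra k S] (π : C →ₐ[k] k)
    (hker : IsNilpotent (RingHom.ker π)) :
    IsNilpotent (RingHom.ker (augTensor S π)) := by
  have hs : Function.Surjective π := fun x => ⟨algebraMap k C x, π.commutes x⟩
  convert isNilpotent_ker_tensorMap S π hs hker using 1
  ext x
  simp only [RingHom.mem_ker, augTensor]
  exact (Algebra.TensorProduct.rid k S S).map_eq_zero_iff

/-- A basis `b` of the augmentation ideal of `C` is also a basis over `S` of the kernel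
of `S ⊗ C → S`. -/
lemma existsUnique_of_augTensor_eq_zero {k : Type*} [Field k] {C : Type*} [CommRing C]
    [Algebra k C] {S : Type*} [CommRing S] [Algebra k S] (π : C →ₐ[k] k) {ι : Type*} [Fintype ι]
    (b : Module.Basis ι k (LinearMap.ker π.toLinearMap)) (y : S ⊗[k] C)
    (hy : augTensor S π y = 0) : ∃! v : ι → S, y = ∑ l, v l ⊗ₜ[k] (b l : C) := by
  let M : Submodule k C := LinearMap.ker π.toLinearMap
  have hs : Function.Surjective π.toLinearMap := fun x => ⟨algebraMap k C x, π.commutes x⟩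
  have hex : Function.Exact (M.subtype.lTensor S) (π.toLinearMap.lTensor S) :=
    lTensor_exact S (LinearMap.exact_subtype_ker_map _) hs
  have hinj : Function.Injective (M.subtype.lTensor S) :=
    Module.Flat.lTensor_preserves_injective_linearMap _ M.injective_subtype
  have hy' : π.toLinearMap.lTensor S y = 0 :=
    (Algebra.TensorProduct.rid k S S).map_eq_zero_iff.1 hy
  obtain ⟨z, hz⟩ := (hex y).1 hy'
  let bS := Algebra.TensorProduct.basis S b
  have key : ∀ v : ι → S, M.subtype.lTensor S (∑ l, v l • bS l) = ∑ l, v l ⊗ₜ[k] (b l : C) := by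
    intro v
    simp [bS, Algebra.TensorProduct.basis_apply, TensorProduct.smul_tmul']
  refine ⟨fun l => bS.repr z l, ?_, ?_⟩
  · change y = ∑ l, (bS.repr z l) ⊗ₜ[k] (b l : C)
    rw [← key, bS.sum_repr, hz]
  · intro v hv
    rw [← key, ← hz] at hv
    have := hinj hv
    ext l
    rw [this, bS.repr_sum_self]

end Tensor

/-! ### Weil restriction of étale algebras over polynomial rings -/

section Etale

variable {k : Type u} [Field k] {C : Type u} [CommRing C] [Algebra k C] {σ : Type}
  {A : Type u} [CommRing A] [Algebra k A] [Algebra (MvPolynomial σ k) A]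
  [IsScalarTower k (MvPolynomial σ k) A]

/-- A semilinear homomorphism from an unramified algebra over a polynomial ring is determined by
the images of the coordinates and by its reduction. -/
lemma semilinear_ringHom_ext [Algebra.FormallyUnramified (MvPolynomial σ k) A] (f : k →+* C)
    {S : Type u} [CommRing S] [Algebra k S] (π : C →ₐ[k] k)
    (hπ : IsNilpotent (RingHom.ker π)) (φ φ' : A →+* S ⊗[k] C)
    (hφ : ∀ x, φ (algebraMap k A x) = 1 ⊗ₜ f x) (hφ' : ∀ x, φ' (algebraMap k A x) = 1 ⊗ₜ f x)
    (hX : ∀ i, φ (algebraMap (MvPolynomial σ k) A (.X i)) =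
      φ' (algebraMap (MvPolynomial σ k) A (.X i)))
    (hred : ∀ x, augTensor S π (φ x) = augTensor S π (φ' x)) : φ = φ' := by
  refine Algebra.FormallyUnramified.ringHom_ext (P := MvPolynomial σ k)
    (augTensor S π : S ⊗[k] C →+* S) (isNilpotent_ker_augTensor S π hπ) _ _ ?_
    (RingHom.ext hred)
  refine MvPolynomial.ringHom_ext (fun x => ?_) hX
  rw [← MvPolynomial.algebraMap_eq, RingHom.comp_apply, RingHom.comp_apply,
    ← IsScalarTower.algebraMap_apply, hφ, hφ']

/-- Let `A` be étale over a polynomial ring in the variables `σ` over `k`, let `A'` be the base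
change of `A` along the reduction `f₀` of `f : k → C`, and let `b` be a basis of the augmentation
ideal of `C`.  Then the polynomial ring over `A'` in the variables `σ × ι` represents
`f`-semilinear homomorphisms from `A` to `S ⊗ C`: such a homomorphism is determined by
its reduction to `S` and by the components along `b` of the images of the coordinates. -/
lemma exists_universal_semilinear [Algebra.FormallyEtale (MvPolynomial σ k) A] (f : k →+* C)
    (π : C →ₐ[k] k) (hπ : IsNilpotent (RingHom.ker π)) {ι : Type*} [Fintype ι]
    (b : Module.Basis ι k (LinearMap.ker π.toLinearMap)) (f₀ : k →+* k)
    (hf₀ : ∀ x, π (f x) = f₀ x) {A' : Type u} [CommRing A'] [Algebra k A'] (j : A →+* A')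
    (hj : ∀ x, j (algebraMap k A x) = algebraMap k A' (f₀ x))
    (huniv : ∀ (S : Type u) [CommRing S] [Algebra k S] (φ : A →+* S),
      (∀ x, φ (algebraMap k A x) = algebraMap k S (f₀ x)) →
      ∃! ψ : A' →ₐ[k] S, ∀ x, ψ (j x) = φ x) :
    ∃ υ : A →+* MvPolynomial (σ × ι) A' ⊗[k] C,
      (∀ x, υ (algebraMap k A x) = 1 ⊗ₜ f x) ∧
      (∀ x, augTensor _ π (υ x) = MvPolynomial.C (j x)) ∧
      ∀ (S : Type u) [CommRing S] [Algebra k S] (φ : A →+* S ⊗[k] C),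
        (∀ x, φ (algebraMap k A x) = 1 ⊗ₜ f x) →
        ∃! ψ : MvPolynomial (σ × ι) A' →ₐ[k] S,
          ∀ x, Algebra.TensorProduct.map ψ (AlgHom.id k C) (υ x) = φ x := by
  have hb : ∀ l, π (b l : C) = 0 := fun l => (b l).2
  let R := MvPolynomial (σ × ι) A'
  -- the generic images of the coordinates; `A` is étale over the polynomial ring, so that they
  -- extend to `A` once the reduction is prescribed
  let θ : MvPolynomial σ k →+* R ⊗[k] C := MvPolynomial.eval₂Hom
    ((Algebra.TensorProduct.includeRight : C →ₐ[k] R ⊗[k] C).toRingHom.comp f)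
    fun i => (MvPolynomial.C (j (algebraMap (MvPolynomial σ k) A (.X i))) : R) ⊗ₜ 1 +
      ∑ l, (MvPolynomial.X (i, l) : R) ⊗ₜ (b l : C)
  obtain ⟨υ, hυ₁, hυ₂⟩ := Algebra.FormallySmooth.exists_ringHom_lift (P := MvPolynomial σ k)
    (A := A) (augTensor R π : R ⊗[k] C →+* R)
    (fun x => ⟨x ⊗ₜ 1, by simp⟩) (isNilpotent_ker_augTensor R π hπ) θ
    ((MvPolynomial.C : A' →+* R).comp j) (by
      refine MvPolynomial.ringHom_ext (fun x => ?_) (fun i => ?_)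
      · have hx : algebraMap (MvPolynomial σ k) A (MvPolynomial.C x) = algebraMap k A x :=
          (IsScalarTower.algebraMap_apply k (MvPolynomial σ k) A x).symm
        have hR : algebraMap k R (f₀ x) = MvPolynomial.C (algebraMap k A' (f₀ x)) := rfl
        simp [θ, hj, hf₀, hx, Algebra.smul_def, hR]
      · simp [θ, hb])
  have hυk : ∀ x, υ (algebraMap k A x) = 1 ⊗ₜ f x := fun x => by
    rw [IsScalarTower.algebraMap_apply k (MvPolynomial σ k) A]
    exact (RingHom.congr_fun hυ₁ _).trans (by simp [θ, MvPolynomial.algebraMap_eq])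
  have hυX : ∀ i, υ (algebraMap (MvPolynomial σ k) A (.X i)) =
      (MvPolynomial.C (j (algebraMap (MvPolynomial σ k) A (.X i))) : R) ⊗ₜ 1 +
      ∑ l, (MvPolynomial.X (i, l) : R) ⊗ₜ (b l : C) := fun i =>
    (RingHom.congr_fun hυ₁ _).trans (by simp [θ])
  have hυred : ∀ x, augTensor R π (υ x) = MvPolynomial.C (j x) := fun x =>
    RingHom.congr_fun hυ₂ x
  refine ⟨υ, hυk, hυred, ?_⟩
  intro S _ _ φ hφ
  obtain ⟨ψ₀, hψ₀, hψ₀'⟩ := huniv S ((augTensor S π : S ⊗[k] C →+* S).comp φ) (fun x => by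
    simp [hφ, hf₀, Algebra.smul_def])
  have hcoord : ∀ i, ∃! v : ι → S, φ (algebraMap (MvPolynomial σ k) A (.X i)) -
      (augTensor S π (φ (algebraMap (MvPolynomial σ k) A (.X i)))) ⊗ₜ 1 =
        ∑ l, v l ⊗ₜ[k] (b l : C) := fun i =>
    existsUnique_of_augTensor_eq_zero π b _ (by simp)
  choose v hv hv' using hcoord
  refine ⟨MvPolynomial.aevalTower ψ₀ (fun p => v p.1 p.2), ?_, ?_⟩
  · intro x
    refine RingHom.congr_fun (semilinear_ringHom_ext (σ := σ) f π hπ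
      ((Algebra.TensorProduct.map (MvPolynomial.aevalTower ψ₀ (fun p : σ × ι => v p.1 p.2))
        (AlgHom.id k C)).toRingHom.comp υ) φ (fun x => ?_) hφ (fun i => ?_) fun x => ?_) x
    · simp [hυk]
    · have := hψ₀ (algebraMap (MvPolynomial σ k) A (.X i))
      simp only [RingHom.comp_apply, RingHom.coe_coe] at this
      have h2 := hv i
      simp only at h2
      simp [hυX, this, ← h2]
    · have := hψ₀ x
      simp only [RingHom.comp_apply, RingHom.coe_coe] at this
      refine (augTensor_map_left π _ _).trans ?_
      rw [hυred, ← this]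
      simp
  · intro ψ hψ
    have h0 : ψ.comp (IsScalarTower.toAlgHom k A' R) = ψ₀ := by
      apply hψ₀'
      intro x
      have := augTensor_map_left π ψ (υ x)
      rw [hψ, hυred] at this
      exact this.symm
    have h0' : ∀ a, ψ (MvPolynomial.C a) = ψ₀ a := fun a => AlgHom.congr_fun h0 a
    have hX : ∀ i, (fun l => ψ (.X (i, l))) = v i := by
      intro i
      apply hv'
      have := hψ (algebraMap (MvPolynomial σ k) A (.X i))
      have h1 := hψ₀ (algebraMap (MvPolynomial σ k) A (.X i))
      simp only [RingHom.comp_apply, RingHom.coe_coe] at h1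
      rw [← this] at h1 ⊢
      simp only [← h1]
      rw [hυX]
      simp [h0']
    apply MvPolynomial.algHom_ext'
    · rw [MvPolynomial.aevalTower_comp_toAlgHom]
      exact h0
    · rintro ⟨i, l⟩
      rw [MvPolynomial.aevalTower_X]
      exact congrFun (hX i) l

end Etale

/-! ### Fibre products of algebras -/

section FiberProduct

variable {k : Type*} [Field k] {G C C' D : Type*} [CommRing G] [Algebra k G] [CommRing C]
  [Algebra k C] [CommRing C'] [Algebra k C'] [CommRing D] [Algebra k D] {ι : Type*}

/-- The algebra `G` is the fibre product over `D` of `C` and of a family, indexed by `ι`, of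
copies of `C'`. -/
structure IsFiberProduct (p : G →ₐ[k] C) (p' : ι → G →ₐ[k] C') (α : C →ₐ[k] D)
    (β : C' →ₐ[k] D) : Prop where
  comm : ∀ j, α.comp p = β.comp (p' j)
  existsUnique : ∀ (c : C) (c' : ι → C'), (∀ j, α c = β (c' j)) →
    ∃! g, p g = c ∧ ∀ j, p' j g = c' j

lemma equivFinsuppOfBasisLeft_map {κ : Type*} [DecidableEq κ] {S : Type*} [CommRing S] [Algebra k S]
    (ℬ : Module.Basis κ k S) (α : C →ₐ[k] D) (x : S ⊗[k] C) (i : κ) :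
    TensorProduct.equivFinsuppOfBasisLeft (M := S) (N := D) ℬ
      (Algebra.TensorProduct.map (AlgHom.id k S) α x) i =
    α (TensorProduct.equivFinsuppOfBasisLeft (M := S) (N := C) ℬ x i) := by
  induction x with
  | zero => simp
  | tmul s c => simp
  | add x y hx hy => simp only [map_add, Finsupp.add_apply, hx, hy]

/-- Fibre products of algebras over a field are preserved by base change, as one sees on the
coordinates with respect to a basis of `S`. -/
lemma IsFiberProduct.existsUnique_tensor {p : G →ₐ[k] C} {p' : ι → G →ₐ[k] C'} {α : C →ₐ[k] D}
    {β : C' →ₐ[k] D} [Finite ι] (H : IsFiberProduct p p' α β) {S : Type*} [CommRing S]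
    [Algebra k S] (x : S ⊗[k] C) (x' : ι → S ⊗[k] C')
    (h : ∀ j, Algebra.TensorProduct.map (AlgHom.id k S) α x =
      Algebra.TensorProduct.map (AlgHom.id k S) β (x' j)) :
    ∃! y : S ⊗[k] G, Algebra.TensorProduct.map (AlgHom.id k S) p y = x ∧
      ∀ j, Algebra.TensorProduct.map (AlgHom.id k S) (p' j) y = x' j := by
  classical
  let ℬ := Module.Basis.ofVectorSpace k S
  let EG := TensorProduct.equivFinsuppOfBasisLeft (M := S) (N := G) ℬ
  let EC := TensorProduct.equivFinsuppOfBasisLeft (M := S) (N := C) ℬ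
  let EC' := TensorProduct.equivFinsuppOfBasisLeft (M := S) (N := C') ℬ
  have hx : ∀ i j, α (EC x i) = β (EC' (x' j) i) := fun i j => by
    rw [← equivFinsuppOfBasisLeft_map, ← equivFinsuppOfBasisLeft_map, h j]
  choose g hg hg' using fun i => H.existsUnique (EC x i) (fun j => EC' (x' j) i) (hx i)
  -- almost all coordinates vanish, since this holds for `x` and for the finitely many `x' j`
  have hfin : (Function.support g).Finite := by
    refine ((EC x).support.finite_toSet.union
      (Set.finite_iUnion fun j => (EC' (x' j)).support.finite_toSet)).subset ?_
    intro i hi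
    by_contra hcon
    simp only [Set.mem_union, Set.mem_iUnion, not_or, not_exists, Finset.mem_coe,
      Finsupp.mem_support_iff, not_not] at hcon
    refine hi ((hg' i 0 ⟨?_, fun j => ?_⟩).symm)
    · rw [map_zero, hcon.1]
    · rw [map_zero, hcon.2 j]
  refine ⟨EG.symm (Finsupp.ofSupportFinite g hfin), ⟨?_, fun j => ?_⟩, ?_⟩
  · apply EC.injective
    ext i
    rw [equivFinsuppOfBasisLeft_map]
    exact (congrArg (fun z : _ →₀ G => p (z i)) (EG.apply_symm_apply _)).trans (hg i).1
  · apply EC'.injective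
    ext i
    rw [equivFinsuppOfBasisLeft_map]
    exact (congrArg (fun z : _ →₀ G => p' j (z i)) (EG.apply_symm_apply _)).trans ((hg i).2 j)
  · rintro y ⟨hy, hy'⟩
    rw [LinearEquiv.eq_symm_apply]
    ext i
    apply hg'
    refine ⟨?_, fun j => ?_⟩
    · rw [← hy, equivFinsuppOfBasisLeft_map]
    · rw [← hy' j, equivFinsuppOfBasisLeft_map]

/-- Compatible ring homomorphisms into the base changes of the factors glue to one into the base
change of the fibre product. -/
lemma IsFiberProduct.existsUnique_ringHom {p : G →ₐ[k] C} {p' : ι → G →ₐ[k] C'}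
    {α : C →ₐ[k] D} {β : C' →ₐ[k] D} [Finite ι] (H : IsFiberProduct p p' α β) {S A : Type*}
    [CommRing S] [Algebra k S] [CommRing A] (φ : A →+* S ⊗[k] C) (φ' : ι → A →+* S ⊗[k] C')
    (h : ∀ j a, Algebra.TensorProduct.map (AlgHom.id k S) α (φ a) =
      Algebra.TensorProduct.map (AlgHom.id k S) β (φ' j a)) :
    ∃! ψ : A →+* S ⊗[k] G, (∀ a, Algebra.TensorProduct.map (AlgHom.id k S) p (ψ a) = φ a) ∧
      ∀ j a, Algebra.TensorProduct.map (AlgHom.id k S) (p' j) (ψ a) = φ' j a := by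
  choose g hg hg' using fun a => H.existsUnique_tensor (φ a) (fun j => φ' j a) fun j => h j a
  refine ⟨
    { toFun := g
      map_one' := (hg' 1 1 ⟨?_, fun j => ?_⟩).symm
      map_mul' := fun a b => (hg' (a * b) (g a * g b) ⟨?_, fun j => ?_⟩).symm
      map_zero' := (hg' 0 0 ⟨?_, fun j => ?_⟩).symm
      map_add' := fun a b => (hg' (a + b) (g a + g b) ⟨?_, fun j => ?_⟩).symm },
    ⟨fun a => (hg a).1, fun j a => (hg a).2 j⟩, ?_⟩
  any_goals simp only [map_one, map_zero]
  any_goals simp only [map_mul, map_add, (hg _).1, (hg _).2]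
  rintro ψ ⟨h1, h2⟩
  ext a
  exact hg' a _ ⟨h1 a, fun j => h2 j a⟩

end FiberProduct

/-! ### Points of affine schemes with values in affine schemes -/

namespace ProlongationPt

section

variable {k : Type u} [CommRing k] {B C : Type u} [CommRing B] [Algebra k B] [CommRing C]
  [Algebra k C] {e : k →+* B} {f : k →+* C} {A A' S S' : Type u} [CommRing A] [Algebra k A]
  [CommRing A'] [Algebra k A'] [CommRing S] [Algebra k S] [CommRing S'] [Algebra k S']

lemma specMap_injective {R R' : Type u} [CommRing R] [CommRing R'] {φ ψ : R →+* R'}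
    (h : specMap φ = specMap ψ) : φ = ψ :=
  congrArg (fun f => f.hom) (Spec.map_injective h)

lemma specMap_comp {R R' R'' : Type u} [CommRing R] [CommRing R'] [CommRing R'']
    (φ : R →+* R') (ψ : R' →+* R'') : specMap (ψ.comp φ) = specMap ψ ≫ specMap φ :=
  Spec.map_comp _ _

variable (k S B) in
/-- The identification of `Spec S ×_k B` with the spectrum of `S ⊗ B`. -/
def specIso : pullback (specOver k S).hom (specMap (algebraMap k B)) ≅
    Spec (CommRingCat.of (S ⊗[k] B)) :=
  pullbackSpecIso k S B

@[simp]
lemma specIso_inv_fst : (specIso k B S).inv ≫ pullback.fst (specOver k S).hom _ =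
    specMap Algebra.TensorProduct.includeLeftRingHom :=
  pullbackSpecIso_inv_fst k S B

@[simp]
lemma specIso_inv_fst_assoc {Z : Scheme.{u}}
    (j : Spec (CommRingCat.of S) ⟶ Z) :
    (specIso k B S).inv ≫ pullback.fst (specOver k S).hom (specMap (algebraMap k B)) ≫ j =
      specMap Algebra.TensorProduct.includeLeftRingHom ≫ j := by
  simp only [← Category.assoc, specIso_inv_fst]

@[simp]
lemma specIso_inv_snd : (specIso k B S).inv ≫ pullback.snd (specOver k S).hom _ =
    specMap (Algebra.TensorProduct.includeRight : B →ₐ[k] S ⊗[k] B).toRingHom :=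
  pullbackSpecIso_inv_snd k S B

@[simp]
lemma specIso_inv_snd_assoc {Z : Scheme.{u}}
    (j : Spec (CommRingCat.of B) ⟶ Z) :
    (specIso k B S).inv ≫ pullback.snd (specOver k S).hom (specMap (algebraMap k B)) ≫ j =
      specMap (Algebra.TensorProduct.includeRight : B →ₐ[k] S ⊗[k] B).toRingHom ≫ j := by
  simp only [← Category.assoc, specIso_inv_snd]

/-- The homomorphism `A → S ⊗ B` that corresponds to a point of the prolongation space of
`Spec A` with values in `Spec S`. -/
def toRing (g : ProlongationPt e (specOver k A) (specOver k S)) : A →+* S ⊗[k] B :=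
  (Spec.preimage ((specIso k B S).inv ≫ raw g)).hom

lemma specMap_toRing (g : ProlongationPt e (specOver k A) (specOver k S)) :
    specMap (toRing g) = (specIso k B S).inv ≫ raw g :=
  Spec.map_preimage _

lemma toRing_injective :
    Function.Injective
      (toRing : ProlongationPt e (specOver k A) (specOver k S) → (A →+* S ⊗[k] B)) := by
  intro g g' h
  apply raw_injective
  have h' := congrArg (specMap ·) h
  simp only [specMap_toRing] at h'
  exact (cancel_epi _).1 h'

/-- The homomorphism that corresponds to a point is semilinear with respect to `e`. -/
lemma toRing_algebraMap (g : ProlongationPt e (specOver k A) (specOver k S)) (x : k) :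
    toRing g (algebraMap k A x) = 1 ⊗ₜ e x := by
  have h : (toRing g).comp (algebraMap k A) =
      (Algebra.TensorProduct.includeRight : B →ₐ[k] S ⊗[k] B).toRingHom.comp e := by
    apply specMap_injective
    rw [specMap_comp, specMap_comp, specMap_toRing, Category.assoc]
    refine (congrArg (_ ≫ ·) (raw_comm g)).trans ?_
    exact specIso_inv_snd_assoc (specMap e)
  exact RingHom.congr_fun h x

lemma exists_toRing_eq (φ : A →+* S ⊗[k] B) (hφ : ∀ x, φ (algebraMap k A x) = 1 ⊗ₜ e x) :
    ∃ g : ProlongationPt e (specOver k A) (specOver k S), toRing g = φ := by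
  refine ⟨mk ((specIso k B S).hom ≫ specMap φ) ?_, ?_⟩
  · have : φ.comp (algebraMap k A) =
        (Algebra.TensorProduct.includeRight : B →ₐ[k] S ⊗[k] B).toRingHom.comp e :=
      RingHom.ext hφ
    rw [Category.assoc]
    refine (congrArg (_ ≫ ·) (specMap_comp _ _).symm).trans ?_
    rw [this, specMap_comp, ← specIso_inv_snd, Category.assoc]
    exact (specIso k B S).hom_inv_id_assoc _
  · apply specMap_injective
    rw [specMap_toRing, raw_mk, Iso.inv_hom_id_assoc]

lemma toRing_comparePt (α : B →ₐ[k] C) (h : ∀ x, α (e x) = f x)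
    (g : ProlongationPt e (specOver k A) (specOver k S)) (a : A) :
    toRing (comparePt α h g) a = Algebra.TensorProduct.map (AlgHom.id k S) α (toRing g a) := by
  have : toRing (comparePt α h g) =
      (Algebra.TensorProduct.map (AlgHom.id k S) α).toRingHom.comp (toRing g) := by
    apply specMap_injective
    rw [specMap_comp, specMap_toRing, specMap_toRing, raw_comparePt, ← Category.assoc,
      ← Category.assoc]
    congr 1
    rw [Iso.inv_comp_eq, ← Category.assoc, Iso.eq_comp_inv]
    rw [← cancel_epi (specIso k C S).inv, Iso.inv_hom_id_assoc,
      ← cancel_mono (specIso k B S).inv]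
    apply pullback.hom_ext
    · simp only [Category.assoc, Iso.hom_inv_id, Category.comp_id, baseRestrict_fst]
      rw [specIso_inv_fst, specIso_inv_fst, ← specMap_comp]
      refine congrArg (fun φ => specMap φ) (RingHom.ext fun s => ?_)
      simp
    · simp only [Category.assoc, Iso.hom_inv_id, Category.comp_id, baseRestrict_snd]
      rw [specIso_inv_snd, specIso_inv_snd_assoc, ← specMap_comp, ← specMap_comp]
      refine congrArg (fun φ => specMap φ) (RingHom.ext fun s => ?_)
      simp
  rw [this]
  rfl

lemma toRing_pull (ψ : S →ₐ[k] S') (g : ProlongationPt e (specOver k A) (specOver k S)) (a : A) :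
    toRing (pull (specOverMap ψ) g) a =
      Algebra.TensorProduct.map ψ (AlgHom.id k B) (toRing g a) := by
  have : toRing (pull (specOverMap ψ) g) =
      (Algebra.TensorProduct.map ψ (AlgHom.id k B)).toRingHom.comp (toRing g) := by
    apply specMap_injective
    rw [specMap_comp, specMap_toRing, specMap_toRing, raw_pull, ← Category.assoc,
      ← Category.assoc]
    congr 1
    rw [Iso.inv_comp_eq, ← Category.assoc, Iso.eq_comp_inv]
    rw [← cancel_epi (specIso k B S').inv, Iso.inv_hom_id_assoc,
      ← cancel_mono (specIso k B S).inv]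
    apply pullback.hom_ext
    · simp only [Category.assoc, Iso.hom_inv_id, Category.comp_id, extendMap_fst]
      rw [specIso_inv_fst, specIso_inv_fst_assoc]
      refine (specMap_comp _ _).symm.trans (Eq.trans ?_ (specMap_comp _ _))
      refine congrArg (fun φ => specMap φ) (RingHom.ext fun s => ?_)
      simp
    · simp only [Category.assoc, Iso.hom_inv_id, Category.comp_id, extendMap_snd]
      rw [specIso_inv_snd, specIso_inv_snd, ← specMap_comp]
      refine congrArg (fun φ => specMap φ) (RingHom.ext fun s => ?_)
      simp
  rw [this]
  rfl

lemma reducePt_toRing (π : B →ₐ[k] k) (g : ProlongationPt e (specOver k A) (specOver k S)) :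
    reducePt π g = specMap ((augTensor S π : S ⊗[k] B →+* S).comp (toRing g)) := by
  rw [specMap_comp, specMap_toRing, reducePt_eq, ← Category.assoc]
  congr 1
  rw [Iso.eq_comp_inv]
  rw [← cancel_mono (specIso k B S).inv, Category.assoc, Iso.hom_inv_id, Category.comp_id]
  apply pullback.hom_ext
  · rw [augSection_fst, Category.assoc, specIso_inv_fst, ← specMap_comp]
    refine (Spec.map_id _).symm.trans ?_
    change specMap (RingHom.id S) = _
    refine congrArg (fun φ => specMap φ) (RingHom.ext fun s => ?_)
    simp
  · rw [augSection_snd, Category.assoc, specIso_inv_snd]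
    refine (specMap_comp _ _).symm.trans (Eq.trans ?_ (specMap_comp _ _))
    refine congrArg (fun φ => specMap φ) (RingHom.ext fun s => ?_)
    simp [Algebra.smul_def]

end

end ProlongationPt

/-! ### Zariski descent -/

section Descent

/-- A sieve in the category of schemes over `S` is covering if it contains an open immersion
around every point. -/
lemma Scheme.mem_over_zariskiTopology {S : Scheme.{u}} {U : Over S} (R : Sieve U)
    (h : ∀ x : U.left, ∃ (V : Over S) (j : V ⟶ U), IsOpenImmersion j.left ∧
      x ∈ Set.range j.left ∧ R j) :
    R ∈ (Scheme.zariskiTopology.over S) U := by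
  rw [GrothendieckTopology.mem_over_iff, Scheme.mem_grothendieckTopology_iff]
  choose V j hj hx hR using h
  refine ⟨Scheme.Cover.mkOfCovers U.left (fun x => (V x).left) (fun x => (j x).left)
    (fun x => ⟨x, hx x⟩) hj, ?_⟩
  rintro _ _ ⟨x⟩
  rw [Sieve.overEquiv_iff]
  have hw : (j x).left ≫ U.hom = (V x).hom := Over.w (j x)
  let f : Over.mk ((j x).left ≫ U.hom) ⟶ V x := Over.homMk (𝟙 _) (by simp [hw])
  have : (Over.homMk (j x).left : Over.mk ((j x).left ≫ U.hom) ⟶ U) = f ≫ j x := by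
    ext1
    simp [f]
  exact this ▸ R.downward_closed (hR x) f

/-- The functor of points of a Weil restriction is a Zariski sheaf, since base change preserves
covers and representable functors are sheaves. -/
lemma isSheaf_weilFunctor {T S : Scheme.{u}} (p : T ⟶ S) (Y : Over T) :
    Presieve.IsSheaf (Scheme.zariskiTopology.over S) (weilFunctor p Y) := by
  refine Functor.op_comp_isSheaf_of_isSheaf_type (J := Scheme.zariskiTopology.over S)
    (K := Scheme.zariskiTopology.over T) (F := Over.pullback p) ?_
  exact GrothendieckTopology.Subcanonical.isSheaf_of_isRepresentable _

/-- In a sheaf, sections with a property that is stable under restriction and determines them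
can be constructed locally. -/
lemma exists_section_of_locally {C : Type*} [Category* C] {J : GrothendieckTopology C}
    {F : Cᵒᵖ ⥤ Type*} (hF : Presieve.IsSheaf J F) {U : C}
    (P : ∀ {V : C}, (V ⟶ U) → F.obj (op V) → Prop)
    (hP : ∀ {V W : C} (f : V ⟶ U) (g : W ⟶ V) (s : F.obj (op V)), P f s →
      P (g ≫ f) (F.map g.op s))
    (huniq : ∀ {V : C} (f : V ⟶ U) (s s' : F.obj (op V)), P f s → P f s' → s = s')
    (R : Sieve U) (hR : R ∈ J U) (hex : ∀ {V : C} (f : V ⟶ U), R f → ∃ s, P f s) :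
    ∃ s : F.obj (op U), ∀ {V : C} (f : V ⟶ U), R f → P f (F.map f.op s) := by
  let x : Presieve.FamilyOfElements F R.arrows := fun V f hf => (hex f hf).choose
  have hx : ∀ {V : C} (f : V ⟶ U) (hf : R f), P f (x f hf) := fun f hf => (hex f hf).choose_spec
  have hcompat : x.Compatible := by
    intro V₁ V₂ W g₁ g₂ f₁ f₂ h₁ h₂ hg
    refine huniq (g₁ ≫ f₁) _ _ (hP _ _ _ (hx f₁ h₁)) ?_
    rw [hg]
    exact hP _ _ _ (hx f₂ h₂)
  obtain ⟨s, hs, -⟩ := hF R hR x hcompat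
  refine ⟨s, fun {V} f hf => ?_⟩
  rw [hs f hf]
  exact hx f hf

end Descent

namespace ProlongationPt

section

variable {k : Type u} [CommRing k] {B : Type u} [CommRing B] [Algebra k B] {e : k →+* B}
  {X U : Over (Spec (CommRingCat.of k))}

lemma eq_of_locally (g g' : ProlongationPt e X U)
    (h : ∀ x : U.left, ∃ (V : Over (Spec (CommRingCat.of k))) (j : V ⟶ U),
      IsOpenImmersion j.left ∧ x ∈ Set.range j.left ∧ pull j g = pull j g') : g = g' := by
  let R : Sieve U :=
    { arrows := fun V j => pull j g = pull j g'
      downward_closed := fun {V W j} hj i => by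
        rw [pull_comp, pull_comp, hj] }
  have hR : R ∈ (Scheme.zariskiTopology.over _) U := Scheme.mem_over_zariskiTopology R h
  exact ((isSheaf_weilFunctor _ _) R hR).isSeparatedFor.ext fun {V} j hj => hj

/-- Points of a prolongation space with a property that is stable under restriction and determines
them can be constructed locally. -/
lemma exists_of_locally (P : ∀ {V : Over (Spec (CommRingCat.of k))}, (V ⟶ U) →
      ProlongationPt e X V → Prop)
    (hP : ∀ {V W : Over (Spec (CommRingCat.of k))} (f : V ⟶ U) (g : W ⟶ V)
      (s : ProlongationPt e X V), P f s → P (g ≫ f) (pull g s))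
    (huniq : ∀ {V : Over (Spec (CommRingCat.of k))} (f : V ⟶ U) (s s' : ProlongationPt e X V),
      P f s → P f s' → s = s')
    (h : ∀ x : U.left, ∃ (V : Over (Spec (CommRingCat.of k))) (j : V ⟶ U),
      IsOpenImmersion j.left ∧ x ∈ Set.range j.left ∧ ∃ s, P j s) :
    ∃ s : ProlongationPt e X U, ∀ x : U.left, ∃ (V : Over (Spec (CommRingCat.of k)))
      (j : V ⟶ U), IsOpenImmersion j.left ∧ x ∈ Set.range j.left ∧ P j (pull j s) := by
  let R : Sieve U :=
    { arrows := fun V j => ∃ s, P j s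
      downward_closed := fun {V W j} hj i => by
        obtain ⟨s, hs⟩ := hj
        exact ⟨pull i s, hP _ _ _ hs⟩ }
  have hR : R ∈ (Scheme.zariskiTopology.over _) U := Scheme.mem_over_zariskiTopology R h
  obtain ⟨s, hs⟩ := exists_section_of_locally (isSheaf_weilFunctor _ _) P hP huniq R hR
    fun f hf => hf
  refine ⟨s, fun x => ?_⟩
  obtain ⟨V, j, hj, hx, hs'⟩ := h x
  exact ⟨V, j, hj, hx, hs j hs'⟩

/-- Locally, a morphism of schemes is a morphism between affine schemes. -/
lemma exists_affine_nhds (a : U.left ⟶ X.left) (x : U.left) :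
    ∃ (A : Type u) (_ : CommRing A) (_ : Algebra k A) (j : specOver k A ⟶ X) (S : Type u)
      (_ : CommRing S) (_ : Algebra k S) (i : specOver k S ⟶ U),
      IsOpenImmersion j.left ∧ IsOpenImmersion i.left ∧ x ∈ Set.range i.left ∧
        Set.range (i.left ≫ a) ⊆ Set.range j.left := by
  obtain ⟨A, _, _, j, hj, hx, -⟩ := exists_specOver_openImmersion X (a x) ⊤ trivial
  obtain ⟨S, _, _, i, hi, hx', hO⟩ := exists_specOver_openImmersion U x
    (a ⁻¹ᵁ j.left.opensRange) hx
  refine ⟨A, _, _, j, S, _, _, i, hj, hi, hx', ?_⟩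
  rintro _ ⟨y, rfl⟩
  exact hO ⟨y, rfl⟩

end

/-! ### Points with values in fibre products of algebras -/

section FiberProduct

variable {k : Type u} [Field k] {G C C' D : Type u} [CommRing G] [Algebra k G] [CommRing C]
  [Algebra k C] [CommRing C'] [Algebra k C'] [CommRing D] [Algebra k D] {ι : Type*}
  {p : G →ₐ[k] C} {p' : ι → G →ₐ[k] C'} {α : C →ₐ[k] D} {β : C' →ₐ[k] D}
  {eG : k →+* G} {e : k →+* C} {e' : k →+* C'} {eD : k →+* D}
  {X U : Over (Spec (CommRingCat.of k))}

/-- A point with values in a fibre product of algebras is determined by its components. -/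
lemma comparePt_ext_of_isFiberProduct [Finite ι] (H : IsFiberProduct p p' α β) (π : C →ₐ[k] k)
    (hG : ∀ x, π (p x) = 0 → IsNilpotent x)
    (hp : ∀ x, p (eG x) = e x) (hp' : ∀ j x, p' j (eG x) = e' x)
    (g g' : ProlongationPt eG X U) (h : comparePt p hp g = comparePt p hp g')
    (h' : ∀ j, comparePt (p' j) (hp' j) g = comparePt (p' j) (hp' j) g') : g = g' := by
  have hred : reducePt (π.comp p) g = reducePt (π.comp p) g' := by
    rw [← reducePt_comparePt (π.comp p) π p rfl hp g, h, reducePt_comparePt _ π p rfl]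
  refine eq_of_locally g g' fun x => ?_
  obtain ⟨A, _, _, j, S, _, _, i, hj, hi, hx, hr⟩ :=
    exists_affine_nhds (X := X) (reducePt (π.comp p) g) x
  refine ⟨_, i, hi, hx, ?_⟩
  obtain ⟨g₁, hg₁, -⟩ := existsUnique_push_eq (π.comp p) hG j (pull i g)
    (by rwa [reducePt_pull])
  obtain ⟨g₁', hg₁', -⟩ := existsUnique_push_eq (π.comp p) hG j (pull i g')
    (by rwa [reducePt_pull, ← hred])
  rw [← hg₁, ← hg₁']
  congr 1
  have e1 : comparePt p hp g₁ = comparePt p hp g₁' := push_injective j (by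
    rw [← comparePt_push, ← comparePt_push, hg₁, hg₁', comparePt_pull, comparePt_pull, h])
  have e2 : ∀ l, comparePt (p' l) (hp' l) g₁ = comparePt (p' l) (hp' l) g₁' :=
    fun l => push_injective j (by
      rw [← comparePt_push, ← comparePt_push, hg₁, hg₁', comparePt_pull, comparePt_pull, h'])
  apply toRing_injective
  have := H.existsUnique_ringHom (toRing (comparePt p hp g₁))
    (fun l => toRing (comparePt (p' l) (hp' l) g₁)) (fun l a => by
      rw [toRing_comparePt, toRing_comparePt, ← AlgHom.comp_apply, ← AlgHom.comp_apply,
        ← Algebra.TensorProduct.map_id_comp, ← Algebra.TensorProduct.map_id_comp, H.comm l])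
  refine this.unique ⟨fun a => (toRing_comparePt _ _ _ _).symm,
    fun l a => (toRing_comparePt _ _ _ _).symm⟩ ⟨fun a => ?_, fun l a => ?_⟩
  · rw [← toRing_comparePt p hp, e1]
  · rw [← toRing_comparePt (p' l) (hp' l), e2]

/-- The points of a prolongation space with values in a fibre product of local algebras are
the compatible families of points with values in the factors. -/
theorem existsUnique_comparePt_of_isFiberProduct [Finite ι] (H : IsFiberProduct p p' α β)
    (π : D →ₐ[k] k)
    (hG : ∀ x, π (α (p x)) = 0 → IsNilpotent x)
    (hC : ∀ x, π (α x) = 0 → IsNilpotent x) (hC' : ∀ x, π (β x) = 0 → IsNilpotent x)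
    (hp : ∀ x, p (eG x) = e x) (hp' : ∀ j x, p' j (eG x) = e' x)
    (hα : ∀ x, α (e x) = eD x) (hβ : ∀ x, β (e' x) = eD x)
    (c : ProlongationPt e X U) (c' : ι → ProlongationPt e' X U)
    (h : ∀ j, comparePt α hα c = comparePt β hβ (c' j)) :
    ∃! g : ProlongationPt eG X U, comparePt p hp g = c ∧
      ∀ j, comparePt (p' j) (hp' j) g = c' j := by
  have huniq : ∀ {V : Over (Spec (CommRingCat.of k))} (f : V ⟶ U)
      (s s' : ProlongationPt eG X V),
      (comparePt p hp s = pull f c ∧ ∀ j, comparePt (p' j) (hp' j) s = pull f (c' j)) →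
      (comparePt p hp s' = pull f c ∧ ∀ j, comparePt (p' j) (hp' j) s' = pull f (c' j)) →
      s = s' := fun f s s' hs hs' =>
    comparePt_ext_of_isFiberProduct H (π.comp α) hG hp hp' s s' (hs.1.trans hs'.1.symm)
      fun j => (hs.2 j).trans (hs'.2 j).symm
  obtain ⟨s, hs⟩ := exists_of_locally (fun {V} (f : V ⟶ U) (s : ProlongationPt eG X V) =>
    comparePt p hp s = pull f c ∧ ∀ j, comparePt (p' j) (hp' j) s = pull f (c' j)) (by
      rintro V W f i s ⟨h1, h2⟩
      refine ⟨?_, fun j => ?_⟩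
      · rw [comparePt_pull, h1, pull_comp]
      · rw [comparePt_pull, h2, pull_comp]) huniq (by
    intro x
    obtain ⟨A, _, _, j, S, _, _, i, hj, hi, hx, hr⟩ :=
      exists_affine_nhds (X := X) (reducePt (π.comp α) c) x
    refine ⟨_, i, hi, hx, ?_⟩
    obtain ⟨c₁, hc₁, -⟩ := existsUnique_push_eq (π.comp α) hC j (pull i c)
      (by rwa [reducePt_pull])
    have hred : ∀ l, reducePt (π.comp β) (c' l) = reducePt (π.comp α) c := fun l => by
      rw [← reducePt_comparePt (π.comp β) π β rfl hβ, ← h, reducePt_comparePt _ π α rfl]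
    choose c₁' hc₁' _ using fun l => existsUnique_push_eq (π.comp β) hC' j (pull i (c' l))
      (by rwa [reducePt_pull, hred])
    have e1 : ∀ l, comparePt α hα c₁ = comparePt β hβ (c₁' l) := fun l => push_injective j (by
      rw [← comparePt_push, ← comparePt_push, hc₁, hc₁', comparePt_pull, comparePt_pull, h])
    obtain ⟨ψ, ⟨h1, h2⟩, -⟩ := H.existsUnique_ringHom (toRing c₁) (fun l => toRing (c₁' l))
      (fun l a => by rw [← toRing_comparePt α hα, ← toRing_comparePt β hβ, e1 l])
    obtain ⟨s, hs⟩ := exists_toRing_eq (e := eG) ψ (fun y => by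
      refine (H.existsUnique_tensor (S := S) (1 ⊗ₜ e y) (fun _ => 1 ⊗ₜ e' y) (fun l => ?_)).unique
        ⟨?_, fun l => ?_⟩ ⟨?_, fun l => ?_⟩
      · simp [hα, hβ]
      · rw [h1, toRing_algebraMap]
      · rw [h2, toRing_algebraMap]
      · simp [hp]
      · simp [hp'])
    refine ⟨push j s, ?_, fun l => ?_⟩
    · rw [comparePt_push, ← hc₁]
      congr 1
      exact toRing_injective (RingHom.ext fun a => by rw [toRing_comparePt, hs, h1])
    · rw [comparePt_push, ← hc₁']
      congr 1
      exact toRing_injective (RingHom.ext fun a => by rw [toRing_comparePt, hs, h2]))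
  refine ⟨s, ⟨eq_of_locally _ _ fun x => ?_, fun l => eq_of_locally _ _ fun x => ?_⟩, ?_⟩
  · obtain ⟨V, j, hj, hx, h1, h2⟩ := hs x
    exact ⟨V, j, hj, hx, by rw [← comparePt_pull, h1]⟩
  · obtain ⟨V, j, hj, hx, h1, h2⟩ := hs x
    exact ⟨V, j, hj, hx, by rw [← comparePt_pull, h2]⟩
  · rintro s' ⟨h1, h2⟩
    refine comparePt_ext_of_isFiberProduct H (π.comp α) hG hp hp' s' s ?_ fun l => ?_
    · rw [h1]
      refine eq_of_locally _ _ fun x => ?_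
      obtain ⟨V, j, hj, hx, h1, h2⟩ := hs x
      exact ⟨V, j, hj, hx, by rw [← comparePt_pull, h1]⟩
    · rw [h2]
      refine eq_of_locally _ _ fun x => ?_
      obtain ⟨V, j, hj, hx, h1, h2⟩ := hs x
      exact ⟨V, j, hj, hx, by rw [← comparePt_pull, h2]⟩

end FiberProduct

/-! ### Lifting points of smooth schemes -/

section Smooth

variable {k : Type u} [Field k] {B C : Type u} [CommRing B] [Algebra k B] [CommRing C]
  [Algebra k C] {e : k →+* B} {f : k →+* C} {X U : Over (Spec (CommRingCat.of k))}

lemma algebraSmooth_of_smooth_hom (A : Type u) [CommRing A] [Algebra k A]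
    [Smooth (specOver k A).hom] : Algebra.Smooth k A := by
  have h : Smooth (Spec.map (CommRingCat.ofHom (algebraMap k A))) :=
    inferInstanceAs (Smooth (specOver k A).hom)
  rw [HasRingHomProperty.Spec_iff (P := @Smooth)] at h
  exact RingHom.smooth_algebraMap.1 h

/-- Points of the prolongation space of a smooth scheme lift locally through a surjection of
algebras with nilpotent kernel. -/
theorem exists_comparePt_eq_of_smooth [Smooth X.hom] (α : B →ₐ[k] C)
    (hα : Function.Surjective α) (hker : IsNilpotent (RingHom.ker α))
    (h : ∀ x, α (e x) = f x) (π : C →ₐ[k] k) (hπ : ∀ x, π x = 0 → IsNilpotent x)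
    (c : ProlongationPt f X U) (x : U.left) :
    ∃ (V : Over (Spec (CommRingCat.of k))) (i : V ⟶ U) (g : ProlongationPt e X V),
      IsOpenImmersion i.left ∧ x ∈ Set.range i.left ∧ comparePt α h g = pull i c := by
  obtain ⟨A, _, _, j, S, _, _, i, hj, hi, hx, hr⟩ :=
    exists_affine_nhds (X := X) (reducePt π c) x
  obtain ⟨c₁, hc₁, -⟩ := existsUnique_push_eq π hπ j (pull i c) (by rwa [reducePt_pull])
  have : Smooth (specOver k A).hom := by
    rw [← Over.w j]
    infer_instance
  have := algebraSmooth_of_smooth_hom (k := k) A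
  obtain ⟨φ, hφ₁, hφ₂⟩ := Algebra.FormallySmooth.exists_ringHom_lift (P := k) (A := A)
    (Algebra.TensorProduct.map (AlgHom.id k S) α : S ⊗[k] B →+* S ⊗[k] C)
    (TensorProduct.map_surjective Function.surjective_id hα)
    (isNilpotent_ker_tensorMap S α hα hker)
    ((Algebra.TensorProduct.includeRight : B →ₐ[k] S ⊗[k] B).toRingHom.comp e) (toRing c₁)
    (by ext y; simp [toRing_algebraMap, h])
  obtain ⟨g, hg⟩ := exists_toRing_eq (e := e) φ (fun y => RingHom.congr_fun hφ₁ y)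
  refine ⟨_, i, push j g, hi, hx, ?_⟩
  rw [comparePt_push, ← hc₁]
  congr 1
  apply toRing_injective
  ext a
  rw [toRing_comparePt, hg]
  exact RingHom.congr_fun hφ₂ a

end Smooth

end ProlongationPt

/-! ### Prolongation spaces of affine schemes with étale coordinates -/

section AffineCase

open ProlongationPt

instance GeometricallyIrreducible.respectsIso :
    MorphismProperty.RespectsIso @GeometricallyIrreducible.{u} :=
  GeometricallyIrreducible.eq_geometrically ▸ inferInstance

lemma smooth_isZariskiLocalAtTarget : IsZariskiLocalAtTarget @Smooth.{u} :=
  HasRingHomProperty.instIsZariskiLocalAtTarget (P := @Smooth.{u}) (Q := RingHom.Smooth)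

lemma GeometricallyIrreducible.isZariskiLocalAtTarget :
    IsZariskiLocalAtTarget @GeometricallyIrreducible.{u} :=
  GeometricallyIrreducible.eq_geometrically ▸ inferInstance

lemma smooth_specMap_C (n : Type u) [Finite n] (R : Type u) [CommRing R] :
    Smooth (specMap (MvPolynomial.C : R →+* MvPolynomial n R)) := by
  have : Algebra.Smooth R (MvPolynomial n R) :=
    { formallySmooth := inferInstance, finitePresentation := inferInstance }
  rw [HasRingHomProperty.Spec_iff (P := @Smooth)]
  exact RingHom.smooth_algebraMap.2 this

lemma geometricallyIrreducible_specMap_C (n : Type u) (R : Type u) [CommRing R] :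
    GeometricallyIrreducible (specMap (MvPolynomial.C : R →+* MvPolynomial n R)) := by
  have h := AffineSpace.SpecIso_inv_over (n := n) (CommRingCat.of R)
  have h2 : GeometricallyIrreducible
      ((AffineSpace.SpecIso n (CommRingCat.of R)).inv ≫
        𝔸(n; Spec (CommRingCat.of R)) ↘ Spec (CommRingCat.of R)) :=
    (MorphismProperty.cancel_left_of_respectsIso @GeometricallyIrreducible.{u} _ _).2
      inferInstance
  rw [h] at h2
  exact h2

/-- The prolongation space given by a universal point. -/
def Prolongation.ofUniversal {k : Type u} [CommRing k] {C : Type u} [CommRing C] [Algebra k C]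
    {f : k →+* C} {X T : Over (Spec (CommRingCat.of k))} (υ : ProlongationPt f X T)
    (h : ∀ U : Over (Spec (CommRingCat.of k)),
      Function.Bijective (fun x : U ⟶ T => pull x υ)) : Prolongation f X where
  space := T
  repr :=
    { homEquiv := fun {U} => Equiv.ofBijective _ (h U)
      homEquiv_comp := fun x y => pull_comp x y υ }

/-- A point is universal if it is so for affine test schemes. -/
lemma ProlongationPt.pull_bijective_of_affine {k : Type u} [CommRing k] {C : Type u} [CommRing C]
    [Algebra k C] {f : k →+* C} {X T : Over (Spec (CommRingCat.of k))} (υ : ProlongationPt f X T)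
    (h : ∀ (S : Type u) [CommRing S] [Algebra k S],
      Function.Bijective (fun x : specOver k S ⟶ T => pull x υ))
    (U : Over (Spec (CommRingCat.of k))) : Function.Bijective (fun x : U ⟶ T => pull x υ) := by
  have hT : Presieve.IsSheaf (Scheme.zariskiTopology.over (Spec (CommRingCat.of k)))
      (yoneda.obj T) := GrothendieckTopology.Subcanonical.isSheaf_of_isRepresentable _
  have hinj : ∀ U, Function.Injective (fun x : U ⟶ T => pull x υ) := by
    intro U x y hxy
    let R : Sieve U :=
      { arrows := fun V j => j ≫ x = j ≫ y
        downward_closed := fun {V W j} hj i => by rw [Category.assoc, hj, Category.assoc] }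
    have hR : R ∈ (Scheme.zariskiTopology.over _) U := Scheme.mem_over_zariskiTopology R (by
      intro z
      obtain ⟨S, _, _, j, hj, hz, -⟩ := exists_specOver_openImmersion U z ⊤ trivial
      refine ⟨_, j, hj, hz, (h S).1 ?_⟩
      change pull (j ≫ x) υ = pull (j ≫ y) υ
      rw [pull_comp, pull_comp]
      exact congrArg (pull j) hxy)
    exact (hT R hR).isSeparatedFor.ext fun {V} j hj => hj
  refine ⟨hinj U, fun g => ?_⟩
  let R : Sieve U :=
    { arrows := fun V j => ∃ x : V ⟶ T, pull x υ = pull j g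
      downward_closed := fun {V W j} hj i => by
        obtain ⟨x, hx⟩ := hj
        exact ⟨i ≫ x, by rw [pull_comp, pull_comp, hx]⟩ }
  have hR : ∀ z : U.left, ∃ (V : Over (Spec (CommRingCat.of k))) (j : V ⟶ U),
      IsOpenImmersion j.left ∧ z ∈ Set.range j.left ∧ R j := by
    intro z
    obtain ⟨S, _, _, j, hj, hz, -⟩ := exists_specOver_openImmersion U z ⊤ trivial
    exact ⟨_, j, hj, hz, (h S).2 (pull j g)⟩
  obtain ⟨x, hx⟩ := exists_section_of_locally hT
    (fun {V} (j : V ⟶ U) (x : V ⟶ T) => pull x υ = pull j g)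
    (fun {V W} f i x hx => (pull_comp i x υ).trans (by rw [hx, pull_comp]))
    (fun {V} j x y hx hy => hinj V (hx.trans hy.symm)) R
    (Scheme.mem_over_zariskiTopology R hR) (fun {V} j hj => hj)
  refine ⟨x, eq_of_locally _ _ fun z => ?_⟩
  obtain ⟨V, j, hj, hz, hRj⟩ := hR z
  refine ⟨V, j, hj, hz, ?_⟩
  exact (pull_comp j x υ).symm.trans (hx j hRj)

variable {k : Type u} [Field k] {C : Type u} [CommRing C] [Algebra k C]

/-- The prolongation space of an affine scheme which is étale over an affine space is an affine
space over the transform of that scheme. -/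
lemma exists_prolongation_of_etale {n : ℕ} {A : Type u} [CommRing A] [Algebra k A]
    [Algebra (MvPolynomial (Fin n) k) A] [IsScalarTower k (MvPolynomial (Fin n) k) A]
    [Algebra.Etale (MvPolynomial (Fin n) k) A] [Module.Finite k C] (f : k →+* C) (π : C →ₐ[k] k)
    (hπ : IsNilpotent (RingHom.ker π)) (f₀ : k →+* k) (hf₀ : ∀ x, π (f x) = f₀ x) :
    ∃ P : Prolongation f (specOver k A), Smooth (P.toTransform π f₀ hf₀).left ∧
      GeometricallyIrreducible (P.toTransform π f₀ hf₀).left := by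
  let Q : CommRingCat.{u} := pushout (CommRingCat.ofHom (algebraMap k A)) (CommRingCat.ofHom f₀)
  let inl : CommRingCat.of A ⟶ Q := pushout.inl _ _
  let inr : CommRingCat.of k ⟶ Q := pushout.inr _ _
  have hpo : IsPushout (CommRingCat.ofHom (algebraMap k A)) (CommRingCat.ofHom f₀) inl inr :=
    IsPushout.of_hasPushout _ _
  -- `A'` is the coordinate ring of the transform of `Spec A`
  let A' : Type u := Q
  let : CommRing A' := inferInstanceAs (CommRing Q)
  let : Algebra k A' := inr.hom.toAlgebra
  let j : A →+* A' := inl.hom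
  have hj : ∀ x, j (algebraMap k A x) = algebraMap k A' (f₀ x) := fun x =>
    congrArg (fun φ => φ.hom x) hpo.w
  have huniv : ∀ (S : Type u) [CommRing S] [Algebra k S] (φ : A →+* S),
      (∀ x, φ (algebraMap k A x) = algebraMap k S (f₀ x)) →
      ∃! ψ : A' →ₐ[k] S, ∀ x, ψ (j x) = φ x := by
    intro S _ _ φ hφ
    have hw : CommRingCat.ofHom (algebraMap k A) ≫ CommRingCat.ofHom φ =
        CommRingCat.ofHom f₀ ≫ CommRingCat.ofHom (algebraMap k S) := by
      ext x
      exact hφ x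
    have h1 := hpo.inl_desc _ _ hw
    have h2 := hpo.inr_desc _ _ hw
    refine ⟨{ (hpo.desc _ _ hw).hom with commutes' := fun x => congrArg (fun φ => φ.hom x) h2 },
      fun x => congrArg (fun φ => φ.hom x) h1, ?_⟩
    intro ψ hψ
    have : CommRingCat.ofHom ψ.toRingHom = hpo.desc _ _ hw := by
      apply hpo.hom_ext
      · rw [h1]
        ext x
        exact hψ x
      · rw [h2]
        ext x
        exact ψ.commutes x
    ext x
    exact congrArg (fun φ => φ.hom x) this
  obtain ⟨υ, hυk, hυred, hυ⟩ := exists_universal_semilinear (σ := Fin n) f π hπ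
    ((Module.finBasis k (LinearMap.ker π.toLinearMap)).reindex Equiv.ulift.{u}.symm) f₀ hf₀ j hj
    huniv
  let ι := ULift.{u} (Fin (Module.finrank k (LinearMap.ker π.toLinearMap)))
  let R := MvPolynomial (Fin n × ι) A'
  obtain ⟨u, hu⟩ := exists_toRing_eq (e := f) (S := R) υ hυk
  have hbij : ∀ (S : Type u) [CommRing S] [Algebra k S],
      Function.Bijective (fun x : specOver k S ⟶ specOver k R => pull x u) := by
    intro S _ _
    constructor
    · intro x y hxy
      obtain ⟨φ, rfl⟩ := specOverMap_bijective.2 x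
      obtain ⟨ψ, rfl⟩ := specOverMap_bijective.2 y
      congr 1
      refine (hυ S (toRing (pull (specOverMap φ) u)) (toRing_algebraMap _)).unique (fun a => ?_)
        (fun a => ?_)
      · rw [toRing_pull, hu]
      · rw [show pull (specOverMap φ) u = pull (specOverMap ψ) u from hxy, toRing_pull, hu]
    · intro g
      obtain ⟨ψ, hψ, -⟩ := hυ S (toRing g) (toRing_algebraMap _)
      refine ⟨specOverMap ψ, toRing_injective (RingHom.ext fun a => ?_)⟩
      rw [toRing_pull, hu, hψ]
  refine ⟨Prolongation.ofUniversal u (pull_bijective_of_affine u hbij), ?_⟩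
  set P := Prolongation.ofUniversal u (pull_bijective_of_affine u hbij)
  have hpb : IsPullback (specMap j) (specMap (algebraMap k A')) (specOver k A).hom
      (specMap f₀) := isPullback_SpecMap_of_isPushout _ _ _ _ hpo
  have hu1 : P.pt (𝟙 _) = u := pull_id u
  have hred : reducePt π u = specMap (MvPolynomial.C : A' →+* R) ≫ specMap j := by
    rw [reducePt_toRing, hu, ← specMap_comp]
    exact congrArg (fun φ => specMap φ) (RingHom.ext hυred)
  have hfac : (P.toTransform π f₀ hf₀).left =
      specMap (MvPolynomial.C : A' →+* R) ≫ hpb.isoPullback.hom := by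
    apply pullback.hom_ext
    · have := P.comp_toTransform_fst π f₀ hf₀ (𝟙 _)
      rw [Category.id_comp, hu1] at this
      refine this.trans (hred.trans ?_)
      exact (congrArg (specMap (MvPolynomial.C : A' →+* R) ≫ ·)
        hpb.isoPullback_hom_fst.symm).trans (Category.assoc _ _ _).symm
    · refine (Over.w (P.toTransform π f₀ hf₀)).trans ((specMap_comp _ _).trans ?_)
      exact (congrArg (specMap (MvPolynomial.C : A' →+* R) ≫ ·)
        hpb.isoPullback_hom_snd.symm).trans (Category.assoc _ _ _).symm
  have h1 := smooth_specMap_C (Fin n × ι) A'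
  have h2 := geometricallyIrreducible_specMap_C (Fin n × ι) A'
  rw [hfac]
  have : MorphismProperty.RespectsIso @Smooth.{u} :=
    MorphismProperty.IsStableUnderBaseChange.respectsIso
  exact ⟨(MorphismProperty.cancel_right_of_respectsIso
    (P := @Smooth.{u}) (f := specMap (MvPolynomial.C : A' →+* R))
    (g := hpb.isoPullback.hom)).2 h1, (MorphismProperty.cancel_right_of_respectsIso
    (P := @GeometricallyIrreducible.{u}) (f := specMap (MvPolynomial.C : A' →+* R))
    (g := hpb.isoPullback.hom)).2 h2⟩

/-- Every point of a smooth scheme over `k` has an affine open neighbourhood which is étale over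
an affine space. -/
lemma exists_etale_nhds (X : Over (Spec (CommRingCat.of k))) [Smooth X.hom] (x : X.left) :
    ∃ (A : Type u) (_ : CommRing A) (_ : Algebra k A) (n : ℕ)
      (_ : Algebra (MvPolynomial (Fin n) k) A) (_ : IsScalarTower k (MvPolynomial (Fin n) k) A)
      (_ : Algebra.Etale (MvPolynomial (Fin n) k) A) (j : specOver k A ⟶ X),
      IsOpenImmersion j.left ∧ x ∈ Set.range j.left := by
  obtain ⟨A, _, _, j, hj, ⟨y, hy⟩, -⟩ := exists_specOver_openImmersion X x ⊤ trivial
  have : Smooth (specOver k A).hom := by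
    rw [← Over.w j]
    infer_instance
  have hs := algebraSmooth_of_smooth_hom (k := k) A
  let p : PrimeSpectrum A := y
  have : Algebra.IsSmoothAt k p.asIdeal :=
    Algebra.FormallySmooth.comp k A (Localization.AtPrime p.asIdeal)
  obtain ⟨a, ha, n, _, _, h⟩ :=
    Algebra.IsSmoothAt.exists_isStandardEtale_mvPolynomial (R := k) (p := p.asIdeal)
  have he : Algebra.Etale (MvPolynomial (Fin n) k) (Localization.Away a) := inferInstance
  refine ⟨Localization.Away a, inferInstance, inferInstance, n, inferInstance, inferInstance, he,
    specOverMap (IsScalarTower.toAlgHom k A (Localization.Away a)) ≫ j, ?_, ?_⟩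
  · have : IsOpenImmersion (specOverMap (IsScalarTower.toAlgHom k A (Localization.Away a))).left :=
      IsOpenImmersion.of_isLocalization a
    rw [Over.comp_left]
    infer_instance
  · have : p ∈ Set.range (PrimeSpectrum.comap (algebraMap A (Localization.Away a))) := by
      rw [PrimeSpectrum.localization_away_comap_range (Localization.Away a) a]
      exact ha
    obtain ⟨q, hq⟩ := this
    exact ⟨q, (congrArg j.left hq).trans hy⟩

end AffineCase

/-! ### Representability of sheaves on schemes over a base -/

section Total

variable {S : Scheme.{u}}

/-- Two sections of the total presheaf are equal if their structure morphisms are equal and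
their second components correspond under the resulting identification. -/
lemma totalPresheaf_ext {G : (Over S)ᵒᵖ ⥤ Type u} {U : Scheme.{u}} {s s' : U ⟶ S}
    {g : G.obj (op (Over.mk s))} {g' : G.obj (op (Over.mk s'))} (h : s' = s)
    (hg : G.map (Over.homMk (𝟙 U) (by simp [h]) : Over.mk s' ⟶ Over.mk s).op g = g') :
    (⟨s, g⟩ : Σ s : U ⟶ S, G.obj (op (Over.mk s))) = ⟨s', g'⟩ := by
  subst h
  have : (Over.homMk (𝟙 U) (by simp) : Over.mk s' ⟶ Over.mk s') = 𝟙 _ := rfl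
  rw [this, op_id, G.map_id] at hg
  subst hg
  rfl

/-- The presheaf on all schemes whose sections over `U` are the pairs of a morphism `U ⟶ S` and a
section of `G` over the resulting scheme over `S`. -/
def totalPresheaf (G : (Over S)ᵒᵖ ⥤ Type u) : Scheme.{u}ᵒᵖ ⥤ Type u where
  obj U := Σ s : U.unop ⟶ S, G.obj (op (Over.mk s))
  map φ := ↾fun x => ⟨φ.unop ≫ x.1, G.map (Over.homMk φ.unop).op x.2⟩
  map_id U := by
    refine ConcreteCategory.hom_ext _ _ fun x => ?_
    refine totalPresheaf_ext (Category.id_comp x.1).symm ?_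
    rw [← Functor.map_comp_apply, ← op_comp]
    have h : (Over.homMk (𝟙 U.unop) (by simp) : Over.mk x.1 ⟶ Over.mk (𝟙 U.unop ≫ x.1)) ≫
        (Over.homMk (𝟙 U.unop) rfl : Over.mk (𝟙 U.unop ≫ x.1) ⟶ Over.mk x.1) = 𝟙 (Over.mk x.1) :=
      Over.OverMorphism.ext (by simp)
    exact (congrArg (fun φ : Over.mk x.1 ⟶ Over.mk x.1 => G.map φ.op x.2) h).trans
      (Functor.map_id_apply G (op (Over.mk x.1)) x.2)
  map_comp φ ψ := by
    refine ConcreteCategory.hom_ext _ _ fun x => ?_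
    refine totalPresheaf_ext (Category.assoc _ _ _).symm ?_
    change _ = G.map (Over.homMk ψ.unop :
      Over.mk (ψ.unop ≫ φ.unop ≫ x.1) ⟶ Over.mk (φ.unop ≫ x.1)).op
      (G.map (Over.homMk φ.unop : Over.mk (φ.unop ≫ x.1) ⟶ Over.mk x.1).op x.2)
    rw [← Functor.map_comp_apply, ← op_comp, ← Functor.map_comp_apply, ← op_comp]
    exact congrArg (fun f : Over.mk _ ⟶ Over.mk x.1 => G.map f.op x.2)
      (Over.OverMorphism.ext (by simp))

variable {G : (Over S)ᵒᵖ ⥤ Type u}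

/-- The section of the total presheaf given by a section over a scheme over `S`. -/
def totalMk {U : Over S} (g : G.obj (op U)) : (totalPresheaf G).obj (op U.left) :=
  ⟨U.hom, g⟩

lemma totalMk_injective {U : Over S} :
    Function.Injective (totalMk : G.obj (op U) → (totalPresheaf G).obj (op U.left)) := by
  intro g g' h
  exact eq_of_heq (Sigma.mk.inj h).2

lemma exists_totalMk_eq {U : Over S} (x : (totalPresheaf G).obj (op U.left)) (h : x.1 = U.hom) :
    ∃ g : G.obj (op U), totalMk g = x := by
  obtain ⟨s, g⟩ := x
  subst h
  exact ⟨g, rfl⟩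

lemma totalPresheaf_map_totalMk {U V : Over S} (φ : U ⟶ V) (g : G.obj (op V)) :
    (totalPresheaf G).map φ.left.op (totalMk g) = totalMk (G.map φ.op g) := by
  refine totalPresheaf_ext (Over.w φ).symm ?_
  rw [← Functor.map_comp_apply, ← op_comp]
  exact congrArg (fun f : U ⟶ V => G.map f.op g) (Over.OverMorphism.ext (by simp))

lemma exists_homMk_of_map_totalMk {U V : Over S} (φ : U.left ⟶ V.left) (g : G.obj (op V))
    (h : G.obj (op U)) (H : (totalPresheaf G).map φ.op (totalMk g) = totalMk h) :
    ∃ f : U ⟶ V, f.left = φ ∧ G.map f.op g = h := by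
  have hw : φ ≫ V.hom = U.hom := (Sigma.mk.inj H).1
  refine ⟨Over.homMk φ hw, rfl, totalMk_injective ?_⟩
  rw [← totalPresheaf_map_totalMk]
  exact H

/-- Given a compatible family of pairs, the morphisms to `S` glue because `S` represents a Zariski
sheaf, and then the sections glue because `G` is a sheaf. -/
lemma isSheaf_totalPresheaf (hG : Presieve.IsSheaf (Scheme.zariskiTopology.over S) G) :
    Presieve.IsSheaf Scheme.zariskiTopology (totalPresheaf G) := by
  intro U R hR x hx
  have hS : Presieve.IsSheaf Scheme.zariskiTopology (yoneda.obj S) :=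
    GrothendieckTopology.Subcanonical.isSheaf_of_isRepresentable _
  obtain ⟨s, hs, hs'⟩ := hS R hR (fun V f hf => (x f hf).1) (by
    intro V₁ V₂ W g₁ g₂ f₁ f₂ h₁ h₂ hg
    exact congrArg (·.1) (hx g₁ g₂ h₁ h₂ hg))
  let R' : Sieve (Over.mk s) := (Sieve.overEquiv (Over.mk s)).symm R
  have hR' : R' ∈ (Scheme.zariskiTopology.over S) (Over.mk s) := by
    rw [GrothendieckTopology.mem_over_iff]
    exact ((Sieve.overEquiv (Over.mk s)).apply_symm_apply R).symm ▸ hR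
  have hR'' : ∀ {V : Over S} (f : V ⟶ Over.mk s), R' f ↔ R f.left := fun f =>
    Sieve.overEquiv_symm_iff _ _
  obtain ⟨σ, hσ⟩ := exists_section_of_locally hG
    (fun {V} (f : V ⟶ Over.mk s) (g : G.obj (op V)) => ∃ hf : R f.left, totalMk g = x f.left hf)
    (by
      rintro V W f φ g ⟨hf, hg⟩
      refine ⟨R.downward_closed hf φ.left, ?_⟩
      rw [← totalPresheaf_map_totalMk, hg]
      exact Presieve.compatible_iff_sieveCompatible x |>.1 hx _ _ _ |>.symm)
    (by
      rintro V f g g' ⟨hf, hg⟩ ⟨_, hg'⟩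
      exact totalMk_injective (hg.trans hg'.symm)) R' hR' (by
      intro V f hf
      have hf' : R f.left := (hR'' f).1 hf
      obtain ⟨g, hg⟩ := exists_totalMk_eq (U := V) (x f.left hf')
        ((hs f.left hf').symm.trans (Over.w f))
      exact ⟨g, hf', hg⟩)
  refine ⟨totalMk σ, ?_, ?_⟩
  · intro V f hf
    obtain ⟨hf', h⟩ := hσ (Over.homMk f : Over.mk (f ≫ s) ⟶ Over.mk s) ((hR'' _).2 hf)
    rw [← totalPresheaf_map_totalMk] at h
    exact h
  · rintro ⟨s', σ'⟩ h
    have hss : s' = s := hs' s' fun V f hf => congrArg (·.1) (h f hf)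
    subst hss
    refine congrArg totalMk ((hG R' hR').isSeparatedFor.ext fun {V} f hf => ?_)
    apply totalMk_injective
    rw [← totalPresheaf_map_totalMk, ← totalPresheaf_map_totalMk]
    obtain ⟨hf', h'⟩ := hσ f hf
    rw [totalPresheaf_map_totalMk f σ, h']
    exact h f.left hf'

/-- A Zariski sheaf on schemes over `S` is representable if it is covered by open subfunctors
which are representable. -/
theorem exists_representableBy_of_locally (hG : Presieve.IsSheaf (Scheme.zariskiTopology.over S) G)
    {ι : Type u} (T : ι → Over S) (t : ∀ i, G.obj (op (T i)))
    (hopen : ∀ (i : ι) (U : Over S) (g : G.obj (op U)), ∃ (V : Over S) (o : V ⟶ U) (a : V ⟶ T i),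
      IsOpenImmersion o.left ∧ G.map a.op (t i) = G.map o.op g ∧
      ∀ (W : Over S) (φ : W ⟶ U) (b : W ⟶ T i), G.map b.op (t i) = G.map φ.op g →
        ∃ l : W ⟶ V, l ≫ o = φ ∧ l ≫ a = b)
    (hcover : ∀ (U : Over S) (g : G.obj (op U)) (x : U.left), ∃ (i : ι) (V : Over S) (o : V ⟶ U)
      (a : V ⟶ T i), IsOpenImmersion o.left ∧ x ∈ Set.range o.left ∧
        G.map a.op (t i) = G.map o.op g) :
    ∃ Y : Over S, Nonempty (G.RepresentableBy Y) := by
  let F : Sheaf Scheme.zariskiTopology (Type u) :=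
    ⟨totalPresheaf G, (isSheaf_iff_isSheaf_of_type _ _).2 (isSheaf_totalPresheaf hG)⟩
  let f : ∀ i, yoneda.obj (T i).left ⟶ F.1 := fun i => yonedaEquiv.symm (totalMk (t i))
  have hf : ∀ i, IsOpenImmersion.presheaf (f i) := by
    intro i
    refine MorphismProperty.relative.of_exists fun Z γ => ?_
    obtain ⟨⟨s, g⟩, rfl⟩ := yonedaEquiv.symm.surjective γ
    obtain ⟨V, o, a, ho, hao, hl⟩ := hopen i (Over.mk s) g
    refine ⟨V.left, yoneda.map a.left, o.left, ?_, ho⟩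
    refine IsPullback.of_forall_isPullback_app fun W => ?_
    rw [Types.isPullback_iff]
    have hF : ∀ {A B D : Scheme.{u}} (φ : A ⟶ B) (ψ : B ⟶ D) (x : F.1.obj (op D)),
        F.1.map (φ ≫ ψ).op x = F.1.map φ.op (F.1.map ψ.op x) := fun φ ψ x =>
      F.1.map_comp_apply ψ.op φ.op x
    refine ⟨?_, ?_, ?_⟩
    · refine ConcreteCategory.hom_ext _ _ fun ψ => ?_
      change F.1.map (ψ ≫ a.left).op (totalMk (t i)) =
        F.1.map (ψ ≫ o.left).op (totalMk (U := Over.mk s) g)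
      rw [hF, hF]
      congr 1
      refine (totalPresheaf_map_totalMk a (t i)).trans ?_
      rw [hao]
      exact (totalPresheaf_map_totalMk o g).symm
    · rintro ψ ψ' ⟨-, h⟩
      exact (cancel_mono o.left).1 h
    · intro x₂ x₃ h
      let φ : Over.mk (x₃ ≫ s) ⟶ Over.mk s := Over.homMk x₃
      have h' : F.1.map (Quiver.Hom.op x₂) (totalMk (t i)) = totalMk (G.map φ.op g) :=
        h.trans (totalPresheaf_map_totalMk φ g)
      obtain ⟨b, hb, hbt⟩ := exists_homMk_of_map_totalMk (U := Over.mk (x₃ ≫ s)) _ _ _ h'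
      obtain ⟨l, hlo, hla⟩ := hl _ φ b hbt
      refine ⟨l.left, ?_, congrArg (fun f => f.left) hlo⟩
      exact (congrArg (fun f => f.left) hla).trans hb
  have : Presheaf.IsLocallySurjective Scheme.zariskiTopology (Sigma.desc f) := by
    refine ⟨fun {Z} x => ?_⟩
    obtain ⟨s, g⟩ := x
    choose i V o a ho hx ha using hcover (Over.mk s) g
    rw [Scheme.mem_grothendieckTopology_iff]
    refine ⟨Scheme.Cover.mkOfCovers Z (fun x => (V x).left) (fun x => (o x).left)
      (fun x => ⟨x, hx x⟩) ho, ?_⟩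
    rintro _ _ ⟨x⟩
    refine ⟨(Sigma.ι (fun i => yoneda.obj (T i).left) (i x)).app _ (a x).left, ?_⟩
    have hι : Sigma.ι (fun i => yoneda.obj (T i).left) (i x) ≫ Sigma.desc f = f (i x) :=
      Sigma.ι_desc _ _
    refine (congrArg (fun η : yoneda.obj (T (i x)).left ⟶ F.1 =>
      η.app (op (V x).left) (a x).left) hι).trans ?_
    exact (totalPresheaf_map_totalMk (a x) (t (i x))).trans ((congrArg totalMk (ha x)).trans
      (totalPresheaf_map_totalMk (o x) g).symm)
  obtain ⟨Y, ⟨R⟩⟩ := Scheme.LocalRepresentability.isRepresentable (F := F) hf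
  obtain ⟨⟨s, g⟩, hsg⟩ : ∃ x : (totalPresheaf G).obj (op Y), R.homEquiv (𝟙 Y) = x := ⟨_, rfl⟩
  have hR : ∀ {W : Scheme.{u}} (φ : W ⟶ Y),
      R.homEquiv φ = F.1.map φ.op (totalMk (U := Over.mk s) g) := fun φ => by
    rw [R.homEquiv_eq, hsg]
    rfl
  have hbij : ∀ U : Over S, Function.Bijective (fun φ : U ⟶ Over.mk s => G.map φ.op g) := by
    intro U
    constructor
    · intro φ ψ h
      apply Over.OverMorphism.ext
      apply R.homEquiv.injective
      rw [hR, hR]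
      refine (totalPresheaf_map_totalMk φ g).trans ?_
      exact (congrArg totalMk h).trans (totalPresheaf_map_totalMk ψ g).symm
    · intro h
      obtain ⟨φ, hφ⟩ := R.homEquiv.surjective (totalMk h)
      rw [hR] at hφ
      obtain ⟨f, -, hf⟩ := exists_homMk_of_map_totalMk (V := Over.mk s) φ g h hφ
      exact ⟨f, hf⟩
  exact ⟨Over.mk s, ⟨{
    homEquiv := fun {U} => Equiv.ofBijective _ (hbij U)
    homEquiv_comp := fun φ ψ => G.map_comp_apply ψ.op φ.op g }⟩⟩

end Total

/-! ### Prolongation spaces of smooth schemes -/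

section SmoothCase

open ProlongationPt Prolongation

variable {k : Type u} [Field k] {C : Type u} [CommRing C] [Algebra k C] {f : k →+* C}
  {X X' : Over (Spec (CommRingCat.of k))}

/-- Over an open subscheme `X'` of `X`, the prolongation space of `X` is that of `X'`. -/
lemma Prolongation.isPullback_toTransform (P : Prolongation f X) (P' : Prolongation f X')
    (j : X' ⟶ X) [IsOpenImmersion j.left] (π : C →ₐ[k] k) (hπ : ∀ x, π x = 0 → IsNilpotent x)
    (f₀ : k →+* k) (hf₀ : ∀ x, π (f x) = f₀ x) :
    IsPullback (P.hom (push j (P'.pt (𝟙 _)))) (P'.toTransform π f₀ hf₀)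
      (P.toTransform π f₀ hf₀) ((Over.pullback (specMap f₀)).map j) := by
  have hj : ∀ {U : Over (Spec (CommRingCat.of k))} (y : U ⟶ transform f₀ X'),
      (y ≫ (Over.pullback (specMap f₀)).map j).left ≫ pullback.fst X.hom (specMap f₀) =
        (y.left ≫ pullback.fst X'.hom (specMap f₀)) ≫ j.left := fun y => by
    rw [Over.comp_left, Category.assoc, Category.assoc]
    congr 1
    exact pullback.lift_fst _ _ _
  have hpt : ∀ {U : Over (Spec (CommRingCat.of k))} (x : U ⟶ P'.space),
      P.pt (x ≫ P.hom (push j (P'.pt (𝟙 _)))) = push j (P'.pt x) := fun x => by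
    rw [pt_comp, pt_hom, pt_eq_pull P' x, push_pull]
  have hw : P.hom (push j (P'.pt (𝟙 _))) ≫ P.toTransform π f₀ hf₀ =
      P'.toTransform π f₀ hf₀ ≫ (Over.pullback (specMap f₀)).map j := by
    apply Prolongation.transform_hom_ext
    rw [hj, Prolongation.comp_toTransform_fst, pt_hom, reducePt_push,
      ← Category.id_comp (P'.toTransform π f₀ hf₀), Prolongation.comp_toTransform_fst]
  have key : ∀ {U : Over (Spec (CommRingCat.of k))} (x : U ⟶ P.space) (y : U ⟶ transform f₀ X'),
      x ≫ P.toTransform π f₀ hf₀ = y ≫ (Over.pullback (specMap f₀)).map j →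
      ∃ l : U ⟶ P'.space, l ≫ P.hom (push j (P'.pt (𝟙 _))) = x ∧
        l ≫ P'.toTransform π f₀ hf₀ = y := by
    intro U x y h
    have hr : reducePt π (P.pt x) = (y.left ≫ pullback.fst X'.hom (specMap f₀)) ≫ j.left := by
      rw [← hj, ← h, Prolongation.comp_toTransform_fst]
    obtain ⟨g, hg, -⟩ := existsUnique_push_eq π hπ j (P.pt x) (by
      rw [hr]
      rintro _ ⟨z, rfl⟩
      exact ⟨_, rfl⟩)
    refine ⟨P'.hom g, P.pt_injective ?_, Prolongation.transform_hom_ext ?_⟩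
    · rw [hpt, pt_hom, hg]
    · rw [Prolongation.comp_toTransform_fst, pt_hom, ← cancel_mono j.left, ← reducePt_push, hg, hr]
  have hinj : ∀ {U : Over (Spec (CommRingCat.of k))} (l l' : U ⟶ P'.space),
      l ≫ P.hom (push j (P'.pt (𝟙 _))) = l' ≫ P.hom (push j (P'.pt (𝟙 _))) → l = l' := by
    intro U l l' h
    apply P'.pt_injective
    apply push_injective j
    rw [← hpt, h, hpt]
  exact ⟨⟨hw⟩, ⟨PullbackCone.IsLimit.mk _ (fun s => (key _ _ s.condition).choose)
    (fun s => (key _ _ s.condition).choose_spec.1) (fun s => (key _ _ s.condition).choose_spec.2)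
    (fun s m h₁ _ => hinj _ _ (h₁.trans (key _ _ s.condition).choose_spec.1.symm))⟩⟩

/-- Smooth schemes are covered by open subschemes which have prolongation spaces, and these are
smooth and geometrically irreducible over the transforms. -/
lemma exists_prolongation_nhds [Module.Finite k C] [Smooth X.hom] (f : k →+* C) (π : C →ₐ[k] k)
    (hπ : IsNilpotent (RingHom.ker π)) (f₀ : k →+* k) (hf₀ : ∀ x, π (f x) = f₀ x) (x : X.left) :
    ∃ (X' : Over (Spec (CommRingCat.of k))) (j : X' ⟶ X) (P' : Prolongation f X'),
      IsOpenImmersion j.left ∧ x ∈ Set.range j.left ∧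
      Smooth (P'.toTransform π f₀ hf₀).left ∧
      GeometricallyIrreducible (P'.toTransform π f₀ hf₀).left := by
  obtain ⟨A, _, _, n, _, _, _, j, hj, hx⟩ := exists_etale_nhds X x
  obtain ⟨P', h₁, h₂⟩ := exists_prolongation_of_etale (A := A) (n := n) f π hπ f₀ hf₀
  exact ⟨_, j, P', hj, hx, h₁, h₂⟩

lemma isNilpotent_of_isNilpotent_ker {π : C →ₐ[k] k} (hπ : IsNilpotent (RingHom.ker π)) {x : C}
    (hx : π x = 0) : IsNilpotent x := by
  obtain ⟨n, hn⟩ := hπ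
  exact ⟨n, by simpa [hn] using Ideal.pow_mem_pow (RingHom.mem_ker.2 hx) n⟩

/-- Prolongation spaces of smooth schemes exist.  Since reduction is a bijection on the underlying
spaces of `U` and `U ×_k C`, an open cover of `X` gives a cover of the functor of points by open
subfunctors; those over étale charts are representable. -/
theorem Prolongation.nonempty_of_smooth [Module.Finite k C] [Smooth X.hom] (f : k →+* C)
    (π : C →ₐ[k] k) (hπ : IsNilpotent (RingHom.ker π)) : Nonempty (Prolongation f X) := by
  have hπ' := fun x (hx : π x = 0) => isNilpotent_of_isNilpotent_ker hπ hx
  choose X' j P' hj hx _ _ using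
    exists_prolongation_nhds (X := X) f π hπ (π.toRingHom.comp f) (fun _ => rfl)
  have hpush : ∀ (x : X.left) {U : Over (Spec (CommRingCat.of k))} (a : U ⟶ (P' x).space),
      pull a (push (j x) ((P' x).pt (𝟙 _))) = push (j x) ((P' x).pt a) := fun x U a => by
    rw [pt_eq_pull (P' x) a, push_pull]
  have hO : ∀ (x : X.left) (U : Over (Spec (CommRingCat.of k))) (g : ProlongationPt f X U),
      ∃ (V : Over (Spec (CommRingCat.of k))) (o : V ⟶ U) (a : V ⟶ (P' x).space),
      IsOpenImmersion o.left ∧ Set.range o.left = reducePt π g ⁻¹' Set.range (j x).left ∧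
        push (j x) ((P' x).pt a) = pull o g := by
    intro x U g
    let O : U.left.Opens := reducePt π g ⁻¹ᵁ (j x).left.opensRange
    let o : Over.mk (O.ι ≫ U.hom) ⟶ U := Over.homMk O.ι
    have ho : Set.range o.left = reducePt π g ⁻¹' Set.range (j x).left :=
      Scheme.Opens.range_ι O
    obtain ⟨g', hg', -⟩ := existsUnique_push_eq π hπ' (j x) (pull o g) (by
      rw [reducePt_pull]
      rintro _ ⟨z, rfl⟩
      exact ho.le ⟨z, rfl⟩)
    exact ⟨_, o, (P' x).hom g', inferInstanceAs (IsOpenImmersion O.ι), ho, by rw [pt_hom, hg']⟩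
  have hR := exists_representableBy_of_locally
    (G := weilFunctor (specMap (algebraMap k C)) (transform f X)) (isSheaf_weilFunctor _ _)
    (fun x : X.left => (P' x).space) (fun x => push (j x) ((P' x).pt (𝟙 _)))
    (by
      intro x U (g : ProlongationPt f X U)
      obtain ⟨V, o, a, ho, hor, hoa⟩ := hO x U g
      refine ⟨V, o, a, ho, (hpush x a).trans hoa, fun W φ b h => ?_⟩
      have hb : push (j x) ((P' x).pt b) = pull φ g := (hpush x b).symm.trans h
      have hr : Set.range φ.left ⊆ Set.range o.left := by
        rw [hor]
        rintro _ ⟨z, rfl⟩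
        refine range_reducePt_push π (j x) ((P' x).pt b) ?_
        rw [hb, reducePt_pull]
        exact ⟨z, rfl⟩
      let l : W ⟶ V := Over.homMk (IsOpenImmersion.lift o.left φ.left hr) (by
        rw [← Over.w o, IsOpenImmersion.lift_fac_assoc, Over.w φ])
      have hl : l ≫ o = φ := Over.OverMorphism.ext (IsOpenImmersion.lift_fac _ _ _)
      refine ⟨l, hl, (P' x).pt_injective (push_injective (j x) ?_)⟩
      rw [pt_comp, push_pull, hoa, hb, ← pull_comp, hl])
    (by
      intro U (g : ProlongationPt f X U) z
      obtain ⟨V, o, a, ho, hor, hoa⟩ := hO (reducePt π g z) U g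
      refine ⟨reducePt π g z, V, o, a, ho, ?_, (hpush _ a).trans hoa⟩
      rw [hor]
      exact hx _)
  obtain ⟨Y, ⟨R⟩⟩ := hR
  exact ⟨⟨Y, R⟩⟩

lemma isPullback_transform_map (f₀ : k →+* k) (j : X' ⟶ X) :
    IsPullback ((Over.pullback (specMap f₀)).map j).left (pullback.fst X'.hom (specMap f₀))
      (pullback.fst X.hom (specMap f₀)) j.left := by
  have h₁ := (IsPullback.of_hasPullback X.hom (specMap f₀)).flip
  have h₂ := (IsPullback.of_hasPullback X'.hom (specMap f₀)).flip
  refine IsPullback.of_right ?_ (pullback.lift_fst _ _ _) h₁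
  rw [Over.w j]
  exact (show ((Over.pullback (specMap f₀)).map j).left ≫ pullback.snd X.hom (specMap f₀) =
    pullback.snd X'.hom (specMap f₀) from pullback.lift_snd _ _ _) ▸ h₂

/-- The prolongation space of a smooth scheme is, locally on the transform, an affine space over
it.  Smoothness and geometric irreducibility follow, both being local on the target. -/
theorem Prolongation.smooth_toTransform [Module.Finite k C] [Smooth X.hom] (P : Prolongation f X)
    (π : C →ₐ[k] k) (hπ : IsNilpotent (RingHom.ker π)) (f₀ : k →+* k)
    (hf₀ : ∀ x, π (f x) = f₀ x) : Smooth (P.toTransform π f₀ hf₀).left ∧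
      GeometricallyIrreducible (P.toTransform π f₀ hf₀).left := by
  choose X' j P' hj hx h₁ h₂ using exists_prolongation_nhds (X := X) f π hπ f₀ hf₀
  have hopen : ∀ x, IsOpenImmersion ((Over.pullback (specMap f₀)).map (j x)).left := fun x =>
    MorphismProperty.of_isPullback (isPullback_transform_map f₀ (j x)).flip (hj x)
  let 𝒰 : (transform f₀ X).left.OpenCover :=
    Scheme.Cover.mkOfCovers X.left (fun x => (transform f₀ (X' x)).left)
      (fun x => ((Over.pullback (specMap f₀)).map (j x)).left)
      (fun y => by
        obtain ⟨w, hw⟩ := hx (pullback.fst X.hom (specMap f₀) y)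
        refine ⟨pullback.fst X.hom (specMap f₀) y, ?_⟩
        obtain ⟨z, hz, -⟩ := Scheme.exists_preimage_of_isPullback
          (isPullback_transform_map f₀ (j (pullback.fst X.hom (specMap f₀) y))) y w hw.symm
        exact ⟨z, hz⟩)
      hopen
  have := smooth_isZariskiLocalAtTarget.{u}
  have := GeometricallyIrreducible.isZariskiLocalAtTarget.{u}
  have h := fun x => ((P.isPullback_toTransform (P' x) (j x) π
      (fun x (hx : π x = 0) => isNilpotent_of_isNilpotent_ker hπ hx) f₀ hf₀).map (Over.forget _))
  constructor
  · refine IsZariskiLocalAtTarget.of_openCover (P := @Smooth.{u}) 𝒰 fun x => ?_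
    have : MorphismProperty.RespectsIso @Smooth.{u} :=
      MorphismProperty.IsStableUnderBaseChange.respectsIso
    refine (MorphismProperty.cancel_left_of_respectsIso (P := @Smooth.{u})
      (h x).isoPullback.hom _).1 ?_
    have h₃ : (h x).isoPullback.hom ≫ 𝒰.pullbackHom (P.toTransform π f₀ hf₀).left x =
        ((P' x).toTransform π f₀ hf₀).left := (h x).isoPullback_hom_snd
    rw [h₃]
    exact h₁ x
  · refine IsZariskiLocalAtTarget.of_openCover (P := @GeometricallyIrreducible.{u}) 𝒰 fun x => ?_
    refine (MorphismProperty.cancel_left_of_respectsIso (P := @GeometricallyIrreducible.{u})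
      (h x).isoPullback.hom _).1 ?_
    have h₃ : (h x).isoPullback.hom ≫ 𝒰.pullbackHom (P.toTransform π f₀ hf₀).left x =
        ((P' x).toTransform π f₀ hf₀).left := (h x).isoPullback_hom_snd
    rw [h₃]
    exact h₂ x

/-- The prolongation space is smooth and geometrically irreducible over the transform, which is
so over `k`, being a base change of `X`. -/
theorem Prolongation.smooth_hom [Module.Finite k C] [Smooth X.hom] [GeometricallyIrreducible X.hom]
    (P : Prolongation f X) (π : C →ₐ[k] k) (hπ : IsNilpotent (RingHom.ker π)) :
    Smooth P.space.hom ∧ GeometricallyIrreducible P.space.hom := by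
  obtain ⟨h₁, h₂⟩ := P.smooth_toTransform π hπ (π.toRingHom.comp f) (fun _ => rfl)
  have h₃ : Smooth (transform (π.toRingHom.comp f) X).hom :=
    inferInstanceAs (Smooth (pullback.snd X.hom _))
  have h₄ : GeometricallyIrreducible (transform (π.toRingHom.comp f) X).hom :=
    inferInstanceAs (GeometricallyIrreducible (pullback.snd X.hom _))
  rw [← Over.w (P.toTransform π (π.toRingHom.comp f) (fun _ => rfl))]
  exact ⟨inferInstance, GeometricallyIrreducible.comp _ _⟩

end SmoothCase

/-! ### Small extensions of algebras -/

section FiberProductAlgebra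

variable {k : Type u} [Field k] {C C' D R : Type u} [CommRing C] [Algebra k C] [CommRing C']
  [Algebra k C'] [CommRing D] [Algebra k D] [CommRing R] [Algebra k R]

/-- The fibre product of two algebras over a third one. -/
def FiberProd (α : C →ₐ[k] D) (β : C' →ₐ[k] D) : Type u :=
  AlgHom.equalizer (α.comp (AlgHom.fst k C C')) (β.comp (AlgHom.snd k C C'))

namespace FiberProd

variable (α : C →ₐ[k] D) (β : C' →ₐ[k] D)

instance : CommRing (FiberProd α β) :=
  inferInstanceAs (CommRing (AlgHom.equalizer (α.comp (AlgHom.fst k C C'))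
    (β.comp (AlgHom.snd k C C'))))

instance : Algebra k (FiberProd α β) :=
  inferInstanceAs (Algebra k (AlgHom.equalizer (α.comp (AlgHom.fst k C C'))
    (β.comp (AlgHom.snd k C C'))))

/-- The inclusion of the fibre product into the product. -/
def val : FiberProd α β →ₐ[k] C × C' :=
  Subalgebra.val (AlgHom.equalizer (α.comp (AlgHom.fst k C C')) (β.comp (AlgHom.snd k C C')))

/-- The first projection. -/
def fst : FiberProd α β →ₐ[k] C := (AlgHom.fst k C C').comp (val α β)

/-- The second projection. -/
def snd : FiberProd α β →ₐ[k] C' := (AlgHom.snd k C C').comp (val α β)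

variable {α β}

lemma ext {x y : FiberProd α β} (h₁ : fst α β x = fst α β y) (h₂ : snd α β x = snd α β y) :
    x = y :=
  Subtype.ext (Prod.ext h₁ h₂)

lemma condition (x : FiberProd α β) : α (fst α β x) = β (snd α β x) := x.2

/-- The element of the fibre product with given components. -/
def mk (c : C) (c' : C') (h : α c = β c') : FiberProd α β := ⟨(c, c'), h⟩

/-- The homomorphism into the fibre product with given components. -/
def lift (φ : R →+* C) (ψ : R →+* C') (h : ∀ x, α (φ x) = β (ψ x)) : R →+* FiberProd α β :=
  (φ.prod ψ).codRestrict
    (AlgHom.equalizer (α.comp (AlgHom.fst k C C')) (β.comp (AlgHom.snd k C C'))) h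

/-- The homomorphism of algebras into the fibre product with given components. -/
def liftₐ (φ : R →ₐ[k] C) (ψ : R →ₐ[k] C') (h : ∀ x, α (φ x) = β (ψ x)) : R →ₐ[k] FiberProd α β :=
  (φ.prod ψ).codRestrict
    (AlgHom.equalizer (α.comp (AlgHom.fst k C C')) (β.comp (AlgHom.snd k C C'))) h

variable (α β) in
lemma isFiberProduct : IsFiberProduct (fst α β) (fun _ : Unit => snd α β) α β where
  comm _ := AlgHom.ext condition
  existsUnique c c' h :=
    ⟨mk c (c' ()) (h ()), ⟨rfl, fun _ => rfl⟩, fun _ h' => ext h'.1 (h'.2 ())⟩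

lemma isNilpotent {x : FiberProd α β} (h₁ : IsNilpotent (fst α β x))
    (h₂ : IsNilpotent (snd α β x)) : IsNilpotent x := by
  obtain ⟨n, hn⟩ := h₁
  obtain ⟨m, hm⟩ := h₂
  refine ⟨n + m, ext ?_ ?_⟩
  · rw [map_pow, pow_add, hn, zero_mul, map_zero]
  · rw [map_pow, pow_add, hm, mul_zero, map_zero]

end FiberProd

end FiberProductAlgebra

section SquareZero

variable {k : Type u} [Field k]

/-- The homomorphism `x ↦ ρ x + δ x` into a square-zero extension, for a derivation `δ` with
respect to `ρ`. -/
def trivSqZeroExtHom {R : Type*} [CommRing R] [Algebra k R] {M : Type*} [AddCommGroup M]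
    [Module k M] [Module kᵐᵒᵖ M] [IsCentralScalar k M] (ρ : R →ₐ[k] k) (δ : R →ₗ[k] M)
    (hδ : ∀ x y, δ (x * y) = ρ x • δ y + ρ y • δ x) : R →ₐ[k] TrivSqZeroExt k M :=
  AlgHom.ofLinearMap ((TrivSqZeroExt.inlAlgHom k k M).toLinearMap ∘ₗ ρ.toLinearMap +
      TrivSqZeroExt.inrHom k M ∘ₗ δ)
    (by
      have h : δ 1 = 0 := by simpa using hδ 1 1
      simp [h])
    (fun x y => by
      ext
      · simp
      · simp [hδ])

section

variable {R : Type*} [CommRing R] [Algebra k R] {M : Type*} [AddCommGroup M]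
    [Module k M] [Module kᵐᵒᵖ M] [IsCentralScalar k M] (ρ : R →ₐ[k] k) (δ : R →ₗ[k] M)
    (hδ : ∀ x y, δ (x * y) = ρ x • δ y + ρ y • δ x)

@[simp]
lemma fst_trivSqZeroExtHom (x : R) : (trivSqZeroExtHom ρ δ hδ x).fst = ρ x := by
  simp [trivSqZeroExtHom]

@[simp]
lemma snd_trivSqZeroExtHom (x : R) : (trivSqZeroExtHom ρ δ hδ x).snd = δ x := by
  simp [trivSqZeroExtHom]

end

/-- The algebra `k[ε₁, ε₂]/(ε₁, ε₂)²` is the fibre product of two copies of `k[ε]` over `k`. -/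
lemma isFiberProduct_trivSqZeroExt :
    IsFiberProduct (TrivSqZeroExt.map (LinearMap.fst k k k) : TrivSqZeroExt k (k × k) →ₐ[k] _)
      (fun _ : Unit => TrivSqZeroExt.map (LinearMap.snd k k k))
      (TrivSqZeroExt.fstHom k k k) (TrivSqZeroExt.fstHom k k k) where
  comm _ := by ext <;> simp
  existsUnique c c' h := by
    refine ⟨TrivSqZeroExt.inl c.fst + TrivSqZeroExt.inr (c.snd, (c' ()).snd), ⟨?_, fun _ => ?_⟩, ?_⟩
    · ext <;> simp
    · ext
      · simpa using h ()
      · simp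
    · rintro y ⟨h₁, h₂⟩
      ext
      · simp [← h₁]
      · simp [← h₁]
      · simp [← h₂ ()]

lemma TrivSqZeroExt.isNilpotent_of_fst_eq_zero {M : Type*} [AddCommGroup M]
    [Module k M] [Module kᵐᵒᵖ M] [IsCentralScalar k M] (x : TrivSqZeroExt k M) (hx : x.fst = 0) :
    IsNilpotent x :=
  ⟨2, by
    ext
    · simp [hx]
    · simp [pow_two, hx]⟩

end SquareZero

section SmallExtension

variable {k : Type u} [Field k] {A' A : Type u} [CommRing A'] [Algebra k A'] [CommRing A]
  [Algebra k A] (α : A' →ₐ[k] A) (π : A →ₐ[k] k)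

/-- The difference `y - x` of a pair of elements with `α x = α y`. -/
def pairDiff : FiberProd α α →ₗ[k] LinearMap.ker α.toLinearMap :=
  ((FiberProd.snd α α).toLinearMap - (FiberProd.fst α α).toLinearMap).codRestrict _ fun x => by
    simp [FiberProd.condition x]

lemma coe_pairDiff (x : FiberProd α α) :
    (pairDiff α x : A') = FiberProd.snd α α x - FiberProd.fst α α x := rfl

variable {α} in
/-- The difference is a derivation with respect to the augmentation. -/
lemma pairDiff_mul (hI : ∀ x y, α x = 0 → π (α y) = 0 → x * y = 0) (x y : FiberProd α α) :
    pairDiff α (x * y) = π (α (FiberProd.fst α α x)) • pairDiff α y +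
      π (α (FiberProd.fst α α y)) • pairDiff α x := by
  have h₁ := hI (FiberProd.snd α α y - FiberProd.fst α α y)
    (FiberProd.snd α α x - algebraMap k A' (π (α (FiberProd.fst α α x))))
    (by simp [FiberProd.condition y]) (by simp [FiberProd.condition x])
  have h₂ := hI (FiberProd.snd α α x - FiberProd.fst α α x)
    (FiberProd.fst α α y - algebraMap k A' (π (α (FiberProd.fst α α y))))
    (by simp [FiberProd.condition x]) (by simp)
  apply Subtype.ext
  rw [Submodule.coe_add, Submodule.coe_smul, Submodule.coe_smul, coe_pairDiff, coe_pairDiff,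
    coe_pairDiff, Algebra.smul_def, Algebra.smul_def, map_mul, map_mul]
  linear_combination h₁ + h₂

variable {ι : Type*} (b : Module.Basis ι k (LinearMap.ker α.toLinearMap))
  (hI : ∀ x y, α x = 0 → π (α y) = 0 → x * y = 0)

variable {α} in
/-- The homomorphism to `k[ε]` that maps a pair `(x, y)` with `α x = α y` to
`π (α x) + ε λ(y - x)`, where `λ` is the `i`-th coordinate with respect to a basis `b` of the
kernel of `α`.  It is multiplicative because the augmentation ideal of `A'` annihilates that
kernel. -/
def pairCoord (i : ι) : FiberProd α α →ₐ[k] DualNumber k :=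
  trivSqZeroExtHom (π.comp (α.comp (FiberProd.fst α α))) (b.coord i ∘ₗ pairDiff α) fun x y => by
    simp [pairDiff_mul π hI]

@[simp]
lemma fst_pairCoord (i : ι) (x : FiberProd α α) :
    TrivSqZeroExt.fst (pairCoord π b hI i x) = π (α (FiberProd.fst α α x)) :=
  fst_trivSqZeroExtHom _ _ _ _

@[simp]
lemma snd_pairCoord (i : ι) (x : FiberProd α α) :
    TrivSqZeroExt.snd (pairCoord π b hI i x) = b.repr (pairDiff α x) i :=
  snd_trivSqZeroExtHom _ _ _ _

/-- The algebra of pairs `A' ×_A A'` is the fibre product over `k` of `A'` and of `m` copies of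
`k[ε]`: a pair `(x, y)` is determined by `x` and by the coordinates of `y - x`. -/
lemma isFiberProduct_pairCoord [Fintype ι] :
    IsFiberProduct (FiberProd.fst α α) (pairCoord π b hI) (π.comp α)
      (TrivSqZeroExt.fstHom k k k) where
  comm i := by
    ext x
    simp
  existsUnique c c' h := by
    let d := b.equivFun.symm fun i => TrivSqZeroExt.snd (c' i)
    have hd : α d = 0 := d.2
    have hcd : α c = α (c + d) := by rw [map_add, hd, add_zero]
    refine ⟨FiberProd.mk c (c + d) hcd, ⟨rfl, fun i => ?_⟩, ?_⟩
    · have hdiff : pairDiff α (FiberProd.mk c (c + d) hcd) = d :=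
        Subtype.ext (add_sub_cancel_left c (d : A'))
      ext
      · rw [fst_pairCoord]
        exact h i
      · rw [snd_pairCoord, hdiff]
        exact congrFun (b.equivFun.apply_symm_apply _) i
    · rintro y ⟨h₁, h₂⟩
      have hdiff : pairDiff α y = d := b.equivFun.injective (by
        ext i
        rw [LinearEquiv.apply_symm_apply, ← h₂ i, snd_pairCoord, Module.Basis.equivFun_apply])
      refine FiberProd.ext h₁ ?_
      change _ = c + (d : A')
      rw [← hdiff, coe_pairDiff, h₁]
      ring

/-- The triples `(x, y, z)` of elements of `A'` with the same image in `A`. -/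
abbrev TripleProd : Type u := FiberProd (FiberProd.snd α α) (FiberProd.fst α α)

namespace TripleProd

/-- The pair `(x, y)` of a triple `(x, y, z)`. -/
abbrev left : TripleProd α →ₐ[k] FiberProd α α :=
  FiberProd.fst (FiberProd.snd α α) (FiberProd.fst α α)

/-- The pair `(y, z)` of a triple `(x, y, z)`. -/
abbrev right : TripleProd α →ₐ[k] FiberProd α α :=
  FiberProd.snd (FiberProd.snd α α) (FiberProd.fst α α)

/-- The pair `(x, z)` of a triple `(x, y, z)`. -/
def outer : TripleProd α →ₐ[k] FiberProd α α :=
  FiberProd.liftₐ ((FiberProd.fst α α).comp (left α)) ((FiberProd.snd α α).comp (right α))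
    fun x => by
      rw [AlgHom.comp_apply, AlgHom.comp_apply, FiberProd.condition, FiberProd.condition x,
        FiberProd.condition]

lemma fst_comp_outer : (FiberProd.fst α α).comp (outer α) = (FiberProd.fst α α).comp (left α) :=
  rfl

lemma snd_comp_outer : (FiberProd.snd α α).comp (outer α) = (FiberProd.snd α α).comp (right α) :=
  rfl

lemma pairDiff_outer (x : TripleProd α) :
    pairDiff α (outer α x) = pairDiff α (right α x) + pairDiff α (left α x) := by
  have h : FiberProd.snd α α (left α x) = FiberProd.fst α α (right α x) := FiberProd.condition x
  apply Subtype.ext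
  rw [Submodule.coe_add, coe_pairDiff, coe_pairDiff, coe_pairDiff, h]
  change FiberProd.snd α α (right α x) - FiberProd.fst α α (left α x) = _
  ring

lemma snd_left (x : TripleProd α) :
    α (FiberProd.snd α α (left α x)) = α (FiberProd.fst α α (left α x)) :=
  (FiberProd.condition _).symm

lemma fst_right (x : TripleProd α) :
    α (FiberProd.fst α α (right α x)) = α (FiberProd.fst α α (left α x)) := by
  rw [← FiberProd.condition x, ← FiberProd.condition]

variable {α} in
/-- The homomorphism to `k[ε₁, ε₂]/(ε₁, ε₂)²` that maps a triple `(x, y, z)` to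
`π (α x) + ε₁ λ(z - y) + ε₂ λ(y - x)`, with `λ` as in `pairCoord`. -/
def coord (i : ι) : TripleProd α →ₐ[k] TrivSqZeroExt k (k × k) :=
  trivSqZeroExtHom (π.comp (α.comp ((FiberProd.fst α α).comp (left α))))
    (((b.coord i ∘ₗ pairDiff α) ∘ₗ (right α).toLinearMap).prod
      ((b.coord i ∘ₗ pairDiff α) ∘ₗ (left α).toLinearMap)) fun x y => by
    apply Prod.ext
    · simp [pairDiff_mul π hI, fst_right]
    · simp [pairDiff_mul π hI]

lemma map_fst_coord (i : ι) :
    (TrivSqZeroExt.map (LinearMap.fst k k k)).comp (coord π b hI i) =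
      (pairCoord π b hI i).comp (right α) := by
  ext x
  · simp [coord, fst_right]
  · simp [coord]

lemma map_snd_coord (i : ι) :
    (TrivSqZeroExt.map (LinearMap.snd k k k)).comp (coord π b hI i) =
      (pairCoord π b hI i).comp (left α) := by
  ext x
  · simp [coord]
  · simp [coord]

lemma map_add_coord (i : ι) :
    (TrivSqZeroExt.map (LinearMap.fst k k k + LinearMap.snd k k k)).comp
      (coord π b hI i) = (pairCoord π b hI i).comp (outer α) := by
  ext x
  · simp only [coord, AlgHom.comp_apply, TrivSqZeroExt.fst_map, fst_trivSqZeroExtHom,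
      fst_pairCoord]
    rfl
  · simp [coord, pairDiff_outer]

end TripleProd

end SmallExtension

/-! ### Addition of tangent vectors -/

section Bijective

open ProlongationPt

variable {k : Type u} [CommRing k] {B C : Type u} [CommRing B] [Algebra k B] [CommRing C]
  [Algebra k C] {e : k →+* B} {f : k →+* C} {X U : Over (Spec (CommRingCat.of k))}

lemma ProlongationPt.fst_augSection (π : B →ₐ[k] k) (hπ : Function.Injective π) :
    pullback.fst U.hom (specMap (algebraMap k B)) ≫ augSection π U = 𝟙 _ := by
  have h : (algebraMap k B).comp π.toRingHom = RingHom.id B :=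
    RingHom.ext fun x => hπ (π.commutes _)
  apply pullback.hom_ext
  · rw [Category.assoc, augSection_fst, Category.comp_id, Category.id_comp]
  · rw [Category.assoc, augSection_snd, ← Category.assoc, pullback.condition, Category.assoc,
      ← specMap_comp, h, Category.id_comp]
    exact (congrArg (_ ≫ ·) (Spec.map_id _)).trans (Category.comp_id _)

/-- If the augmentation is injective, then it is bijective and `U ×_k B = U`. -/
lemma ProlongationPt.reducePt_injective (π : B →ₐ[k] k) (hπ : Function.Injective π) :
    Function.Injective (reducePt π : ProlongationPt e X U → _) := by
  intro g g' h
  apply raw_injective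
  rw [← Category.id_comp (raw g), ← Category.id_comp (raw g'), ← fst_augSection π hπ,
    Category.assoc, Category.assoc, ← reducePt_eq, ← reducePt_eq, h]

/-- Points over `k` are the same as their reductions, so equality of their images over `k` can be
tested on reductions. -/
lemma ProlongationPt.comparePt_eq_comparePt_iff (π : B →ₐ[k] k) (π' : C →ₐ[k] k) {a : k →+* k}
    (h : ∀ x, π (e x) = a x) (h' : ∀ x, π' (f x) = a x) (g : ProlongationPt e X U)
    (g' : ProlongationPt f X U) :
    comparePt π h g = comparePt π' h' g' ↔ reducePt π g = reducePt π' g' := by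
  rw [← (reducePt_injective (AlgHom.id k k) Function.injective_id).eq_iff,
    reducePt_comparePt π _ π rfl, reducePt_comparePt π' _ π' rfl]

/-- If the augmentation is bijective, the prolongation space is a transform. -/
lemma Prolongation.isIso_toTransform (P : Prolongation e X) (π : B →ₐ[k] k)
    (hπ : Function.Injective π) (a : k →+* k) (h : ∀ x, π (e x) = a x) :
    IsIso (P.toTransform π a h) := by
  let g : ProlongationPt e X (transform a X) :=
    mk (pullback.fst _ _ ≫ pullback.fst X.hom (specMap a)) (by
      have h' : (algebraMap k B).comp a = e :=
        RingHom.ext fun x => hπ ((π.commutes _).trans (h x).symm)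
      rw [Category.assoc, pullback.condition, ← h', specMap_comp, ← Category.assoc,
        ← Category.assoc, ← pullback.condition]
      rfl)
  have hg : reducePt π g = pullback.fst X.hom (specMap a) := by
    rw [reducePt_eq, raw_mk, ← Category.assoc, augSection_fst, Category.id_comp]
  have h1 : P.hom g ≫ P.toTransform π a h = 𝟙 _ := transform_hom_ext (by
    rw [comp_toTransform_fst, pt_hom, hg]
    exact (Category.id_comp _).symm)
  refine ⟨P.hom g, P.pt_injective (reducePt_injective π hπ ?_), h1⟩
  rw [pt_comp, reducePt_pull, pt_hom, hg, ← comp_toTransform_fst P π a h, Category.id_comp]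

end Bijective

namespace TangentScheme

open ProlongationPt

variable {k : Type u} [Field k] {Y U : Over (Spec (CommRingCat.of k))}

/-- Two tangent vectors at the same point define a unique point over `k[ε₁, ε₂]/(ε₁, ε₂)²`. -/
lemma existsUnique_pair (v w : ProlongationPt (algebraMap k (DualNumber k)) Y U)
    (h : reducePt (TrivSqZeroExt.fstHom k k k) v = reducePt (TrivSqZeroExt.fstHom k k k) w) :
    ∃! z : ProlongationPt (algebraMap k (TrivSqZeroExt k (k × k))) Y U,
      comparePt (TrivSqZeroExt.map (LinearMap.fst k k k)) (AlgHom.commutes _) z = v ∧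
      comparePt (TrivSqZeroExt.map (LinearMap.snd k k k)) (AlgHom.commutes _) z = w := by
  have := existsUnique_comparePt_of_isFiberProduct (eD := algebraMap k k)
    (isFiberProduct_trivSqZeroExt (k := k)) (AlgHom.id k k)
    (fun x hx => TrivSqZeroExt.isNilpotent_of_fst_eq_zero x (by simpa using hx))
    (fun x hx => TrivSqZeroExt.isNilpotent_of_fst_eq_zero x hx)
    (fun x hx => TrivSqZeroExt.isNilpotent_of_fst_eq_zero x hx)
    (AlgHom.commutes _) (fun _ => AlgHom.commutes _) (AlgHom.commutes _) (AlgHom.commutes _) v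
    (fun _ => w) (fun _ => (comparePt_eq_comparePt_iff _ _ _ _ _ _).2 h)
  simpa only [forall_const] using this

lemma IsSum.comp_proj_eq {T : TangentScheme Y} {v w s : U ⟶ T.space} (h : T.IsSum v w s) :
    v ≫ T.proj = w ≫ T.proj ∧ s ≫ T.proj = v ≫ T.proj := by
  obtain ⟨z, h₁, h₂, h₃⟩ := h
  have : ∀ (l : k × k →ₗ[k] k) (x : U ⟶ T.space),
      comparePt (TrivSqZeroExt.map l) (AlgHom.commutes _) z = Prolongation.pt T x →
      (x ≫ T.proj).left = reducePt (TrivSqZeroExt.fstHom k k (k × k)) z := fun l x hx => by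
    rw [comp_proj_left, ← hx]
    exact reducePt_comparePt _ _ _ (by ext <;> simp) _ _
  exact ⟨Over.OverMorphism.ext ((this _ v h₁).trans (this _ w h₂).symm),
    Over.OverMorphism.ext ((this _ s h₃).trans (this _ v h₁).symm)⟩

lemma IsSum.unique {T : TangentScheme Y} {v w s s' : U ⟶ T.space} (h : T.IsSum v w s)
    (h' : T.IsSum v w s') : s = s' := by
  have hvw := congrArg (fun f => f.left) h.comp_proj_eq.1
  rw [comp_proj_left, comp_proj_left] at hvw
  obtain ⟨z, h₁, h₂, h₃⟩ := h
  obtain ⟨z', h₁', h₂', h₃'⟩ := h'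
  have : z = z' := (existsUnique_pair _ _ hvw).unique ⟨h₁, h₂⟩ ⟨h₁', h₂'⟩
  subst this
  exact Prolongation.pt_injective T (h₃.symm.trans h₃')

lemma exists_isAddition (T : TangentScheme Y) :
    ∃ add : pullback T.proj T.proj ⟶ T.space, T.IsAddition add := by
  obtain ⟨z, ⟨h₁, h₂⟩, -⟩ := existsUnique_pair
    (Prolongation.pt T (pullback.fst T.proj T.proj))
    (Prolongation.pt T (pullback.snd T.proj T.proj))
    (by rw [← comp_proj_left, ← comp_proj_left, pullback.condition])
  let add : pullback T.proj T.proj ⟶ T.space := Prolongation.hom T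
    (comparePt (TrivSqZeroExt.map (LinearMap.fst k k k + LinearMap.snd k k k))
      (AlgHom.commutes _) z)
  have hsum : T.IsSum (pullback.fst T.proj T.proj) (pullback.snd T.proj T.proj) add :=
    ⟨z, h₁, h₂, (Prolongation.pt_hom T _).symm⟩
  refine ⟨add, hsum.comp_proj_eq.2, fun U v w h => ⟨pull (pullback.lift v w h) z, ?_, ?_, ?_⟩⟩
  · rw [comparePt_pull, h₁, ← Prolongation.pt_comp, pullback.lift_fst]
    rfl
  · rw [comparePt_pull, h₂, ← Prolongation.pt_comp, pullback.lift_snd]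
    rfl
  · rw [comparePt_pull]
    exact (Prolongation.pt_comp T _ _).trans (congrArg _ (Prolongation.pt_hom T _)) |>.symm

end TangentScheme

/-! ### The torsor given by a small extension -/

section Translate

open ProlongationPt

variable {k : Type u} [Field k] {A' A : Type u} [CommRing A'] [Algebra k A'] [CommRing A]
  [Algebra k A] {α : A' →ₐ[k] A} (π : A →ₐ[k] k) {m : ℕ}
  (b : Module.Basis (Fin m) k (LinearMap.ker α.toLinearMap))
  (hI : ∀ x y, α x = 0 → π (α y) = 0 → x * y = 0) {e' : k →+* A'} {e : k →+* A} {a : k →+* k}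
  {X U V : Over (Spec (CommRingCat.of k))}

variable (α e') in
/-- The diagonal homomorphism given by `e'`. -/
def pairHom : k →+* FiberProd α α := FiberProd.lift e' e' fun _ => rfl

variable (α e') in
/-- The diagonal homomorphism into triples given by `e'`. -/
def tripleHom : k →+* TripleProd α := FiberProd.lift (pairHom α e') (pairHom α e') fun _ => rfl

lemma fst_pairHom (x : k) : FiberProd.fst α α (pairHom α e' x) = e' x := rfl

lemma snd_pairHom (x : k) : FiberProd.snd α α (pairHom α e' x) = e' x := rfl

lemma left_tripleHom (x : k) : TripleProd.left α (tripleHom α e' x) = pairHom α e' x := rfl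

lemma right_tripleHom (x : k) : TripleProd.right α (tripleHom α e' x) = pairHom α e' x := rfl

lemma outer_tripleHom (x : k) : TripleProd.outer α (tripleHom α e' x) = pairHom α e' x := rfl

lemma FiberProd.comp_snd : α.comp (FiberProd.snd α α) = α.comp (FiberProd.fst α α) :=
  AlgHom.ext fun x => (FiberProd.condition x).symm

variable (α) in
/-- The diagonal homomorphism. -/
def FiberProd.diag : A' →ₐ[k] FiberProd α α :=
  FiberProd.liftₐ (AlgHom.id k A') (AlgHom.id k A') fun _ => rfl

lemma FiberProd.fst_comp_diag : (FiberProd.fst α α).comp (FiberProd.diag α) = AlgHom.id k A' :=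
  rfl

lemma FiberProd.snd_comp_diag : (FiberProd.snd α α).comp (FiberProd.diag α) = AlgHom.id k A' :=
  rfl

lemma diag_apply (x : k) : FiberProd.diag α (e' x) = pairHom α e' x := rfl

lemma pairDiff_diag (x : A') : pairDiff α (FiberProd.diag α x) = 0 := Subtype.ext (sub_self x)

include hI in
lemma pairCoord_pairHom (ha : ∀ x, π (α (e' x)) = a x) (j : Fin m) (x : k) :
    pairCoord π b hI j (pairHom α e' x) = (algebraMap k (DualNumber k)).comp a x := by
  rw [← diag_apply]
  ext
  · rw [fst_pairCoord]
    exact ha x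
  · rw [snd_pairCoord, pairDiff_diag]
    simp [TrivSqZeroExt.algebraMap_eq_inl]

/-- The point `c'` is the translate of `c` by the tangent vectors `v`: there is a point with values
in the algebra of pairs `A' ×_A A'` whose components are `c` and `c'`, and whose images under the
coordinates `pairCoord` are the `v j`.  Here a tangent vector of the transform `X^a` is encoded as
a point of `X` over `k[ε]` that is semilinear with respect to `a`. -/
def IsTranslate (ha : ∀ x, π (α (e' x)) = a x) (c : ProlongationPt e' X U)
    (v : Fin m → ProlongationPt ((algebraMap k (DualNumber k)).comp a) X U)
    (c' : ProlongationPt e' X U) : Prop :=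
  ∃ g : ProlongationPt (pairHom α e') X U, comparePt (FiberProd.fst α α) fst_pairHom g = c ∧
    (∀ j, comparePt (pairCoord π b hI j) (pairCoord_pairHom π b hI ha j) g = v j) ∧
    comparePt (FiberProd.snd α α) snd_pairHom g = c'

namespace IsTranslate

variable {π b hI} {ha : ∀ x, π (α (e' x)) = a x} {c c' : ProlongationPt e' X U}
    {v : Fin m → ProlongationPt ((algebraMap k (DualNumber k)).comp a) X U}

lemma pull (h : IsTranslate π b hI ha c v c') (φ : V ⟶ U) :
    IsTranslate π b hI ha (ProlongationPt.pull φ c) (fun j => ProlongationPt.pull φ (v j))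
      (ProlongationPt.pull φ c') := by
  obtain ⟨g, h₁, h₂, h₃⟩ := h
  exact ⟨ProlongationPt.pull φ g, by rw [comparePt_pull, h₁],
    fun j => by rw [comparePt_pull, h₂], by rw [comparePt_pull, h₃]⟩

lemma comparePt_eq (h : IsTranslate π b hI ha c v c') (he : ∀ x, α (e' x) = e x) :
    comparePt α he c' = comparePt α he c := by
  obtain ⟨g, rfl, -, rfl⟩ := h
  rw [comparePt_comp _ _ _ _ (α.comp (FiberProd.fst α α)) rfl,
    comparePt_comp _ _ _ _ _ FiberProd.comp_snd]

lemma reducePt_eq (h : IsTranslate π b hI ha c v c') (j : Fin m) :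
    reducePt (TrivSqZeroExt.fstHom k k k) (v j) = reducePt (π.comp α) c := by
  obtain ⟨g, rfl, h₂, -⟩ := h
  rw [← h₂ j, reducePt_comparePt ((π.comp α).comp (FiberProd.fst α α)),
    reducePt_comparePt ((π.comp α).comp (FiberProd.fst α α)) _ _ rfl]
  ext x
  simp

end IsTranslate

lemma isNilpotent_fiberProd (hA' : ∀ x, π (α x) = 0 → IsNilpotent x) (x : FiberProd α α)
    (hx : π (α (FiberProd.fst α α x)) = 0) : IsNilpotent x :=
  FiberProd.isNilpotent (hA' _ hx) (hA' _ (by rw [← FiberProd.condition x, hx]))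

lemma isNilpotent_tripleProd (hA' : ∀ x, π (α x) = 0 → IsNilpotent x) (x : TripleProd α)
    (hx : π (α (FiberProd.fst α α (TripleProd.left α x))) = 0) : IsNilpotent x :=
  FiberProd.isNilpotent (isNilpotent_fiberProd π hA' _ hx)
    (isNilpotent_fiberProd π hA' _ (by rw [TripleProd.fst_right, hx]))

variable (hA' : ∀ x, π (α x) = 0 → IsNilpotent x)
  (ha : ∀ x, π (α (e' x)) = a x)

include hA' in
/-- A point together with tangent vectors at its reduction is the same as a point with values in
the algebra of pairs, by `isFiberProduct_pairCoord`. -/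
lemma existsUnique_pairPt (c : ProlongationPt e' X U)
    (v : Fin m → ProlongationPt ((algebraMap k (DualNumber k)).comp a) X U)
    (h : ∀ j, reducePt (TrivSqZeroExt.fstHom k k k) (v j) = reducePt (π.comp α) c) :
    ∃! g : ProlongationPt (pairHom α e') X U, comparePt (FiberProd.fst α α) fst_pairHom g = c ∧
      ∀ j, comparePt (pairCoord π b hI j) (pairCoord_pairHom π b hI ha j) g = v j :=
  existsUnique_comparePt_of_isFiberProduct (eD := a) (isFiberProduct_pairCoord α π b hI)
    (AlgHom.id k k) (isNilpotent_fiberProd π hA') hA'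
    (fun x hx => TrivSqZeroExt.isNilpotent_of_fst_eq_zero x hx) _ _ ha
    (fun x => by simp [TrivSqZeroExt.algebraMap_eq_inl]) c v
    (fun j => (comparePt_eq_comparePt_iff _ _ _ _ _ _).2 (h j).symm)

include hA' in
lemma existsUnique_isTranslate (c : ProlongationPt e' X U)
    (v : Fin m → ProlongationPt ((algebraMap k (DualNumber k)).comp a) X U)
    (h : ∀ j, reducePt (TrivSqZeroExt.fstHom k k k) (v j) = reducePt (π.comp α) c) :
    ∃! c', IsTranslate π b hI ha c v c' := by
  obtain ⟨g, ⟨h₁, h₂⟩, hu⟩ := existsUnique_pairPt π b hI hA' ha c v h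
  refine ⟨_, ⟨g, h₁, h₂, rfl⟩, ?_⟩
  rintro _ ⟨g', h₁', h₂', rfl⟩
  rw [hu g' ⟨h₁', h₂'⟩]

include hA' in
/-- Two points with the same image over `A` form a point with values in the algebra of pairs,
hence differ by a unique translation. -/
lemma existsUnique_isTranslate_of_comparePt_eq (he : ∀ x, α (e' x) = e x)
    (c c' : ProlongationPt e' X U) (h : comparePt α he c = comparePt α he c') :
    ∃! v, IsTranslate π b hI ha c v c' := by
  obtain ⟨g, ⟨h₁, h₂⟩, hu⟩ := existsUnique_comparePt_of_isFiberProduct (eD := e)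
    (eG := pairHom α e') (FiberProd.isFiberProduct α α) π (isNilpotent_fiberProd π hA') hA' hA'
    fst_pairHom (fun _ => snd_pairHom) he he c (fun _ => c') (fun _ => h)
  refine ⟨_, ⟨g, h₁, fun _ => rfl, h₂ ()⟩, ?_⟩
  rintro v ⟨g', h₁', h₂', h₃'⟩
  funext j
  rw [← h₂', hu g' ⟨h₁', fun _ => h₃'⟩]

include ha in
lemma ofId_comp_apply (x : k) : (Algebra.ofId k (DualNumber k)).comp (π.comp α) (e' x) =
    (algebraMap k (DualNumber k)).comp a x :=
  congrArg (algebraMap k (DualNumber k)) (ha x)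

/-- Translation by zero: the point over the pairs is the diagonal one. -/
lemma isTranslate_self (c : ProlongationPt e' X U) :
    IsTranslate π b hI ha c (fun _ => comparePt ((Algebra.ofId k (DualNumber k)).comp (π.comp α))
      (ofId_comp_apply π ha) c) c := by
  refine ⟨comparePt (FiberProd.diag α) diag_apply c, ?_, fun j => ?_, ?_⟩
  · rw [comparePt_comp _ _ _ _ _ FiberProd.fst_comp_diag, comparePt_of_eq_id _ rfl]
  · refine comparePt_comp _ _ _ _ _ ?_ _
    ext x
    · rw [AlgHom.comp_apply, fst_pairCoord]
      rfl
    · rw [AlgHom.comp_apply, snd_pairCoord, pairDiff_diag]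
      simp [Algebra.ofId_apply, TrivSqZeroExt.algebraMap_eq_inl]
  · rw [comparePt_comp _ _ _ _ _ FiberProd.snd_comp_diag, comparePt_of_eq_id _ rfl]

include hA' in
/-- Two points over the pairs which agree in the middle form a point over the triples. -/
lemma exists_triplePt (g g' : ProlongationPt (pairHom α e') X U)
    (h : comparePt (FiberProd.snd α α) snd_pairHom g =
      comparePt (FiberProd.fst α α) fst_pairHom g') :
    ∃ t : ProlongationPt (tripleHom α e') X U,
      comparePt (TripleProd.left α) left_tripleHom t = g ∧
      comparePt (TripleProd.right α) right_tripleHom t = g' := by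
  have h₁ : ∀ x : TripleProd α,
      (π.comp α) (FiberProd.snd α α (TripleProd.left α x)) = 0 → IsNilpotent x := fun x hx =>
    isNilpotent_tripleProd π hA' x ((congrArg π (TripleProd.snd_left α x)).symm.trans hx)
  have h₂ : ∀ x : FiberProd α α, (π.comp α) (FiberProd.snd α α x) = 0 → IsNilpotent x :=
    fun x hx => isNilpotent_fiberProd π hA' x ((congrArg π (FiberProd.condition x)).trans hx)
  have H := existsUnique_comparePt_of_isFiberProduct (ι := Unit) (G := TripleProd α)
    (C := FiberProd α α) (C' := FiberProd α α) (D := A') (p := TripleProd.left α)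
    (p' := fun _ => TripleProd.right α) (α := FiberProd.snd α α) (β := FiberProd.fst α α)
    (eG := tripleHom α e') (e := pairHom α e') (e' := pairHom α e') (eD := e') (X := X) (U := U)
    (FiberProd.isFiberProduct (FiberProd.snd α α) (FiberProd.fst α α)) (π.comp α) h₁ h₂
    (isNilpotent_fiberProd π hA') left_tripleHom (fun _ => right_tripleHom) snd_pairHom fst_pairHom
    g (fun _ => g') (fun _ => h)
  obtain ⟨t, ⟨ht, ht'⟩, -⟩ := H
  exact ⟨t, ht, ht' ()⟩

lemma map_algebraMap_comp (l : k × k →ₗ[k] k) (a : k →+* k) (x : k) :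
    TrivSqZeroExt.map l ((algebraMap k (TrivSqZeroExt k (k × k))).comp a x) =
      (algebraMap k (DualNumber k)).comp a x :=
  (TrivSqZeroExt.map l).commutes (a x)

include ha in
lemma coord_tripleHom (j : Fin m) (x : k) : TripleProd.coord π b hI j (tripleHom α e' x) =
    (algebraMap k (TrivSqZeroExt k (k × k))).comp a x := by
  have h : pairDiff α (pairHom α e' x) = 0 := pairDiff_diag (e' x)
  apply TrivSqZeroExt.ext
  · rw [TripleProd.coord, fst_trivSqZeroExtHom]
    exact ha x
  · rw [TripleProd.coord, snd_trivSqZeroExtHom]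
    apply Prod.ext
    · change b.coord j (pairDiff α (pairHom α e' x)) = 0
      rw [h, map_zero]
    · change b.coord j (pairDiff α (pairHom α e' x)) = 0
      rw [h, map_zero]

include hA' in
/-- Successive translations add tangent vectors. -/
lemma IsTranslate.trans {c c₁ c₂ : ProlongationPt e' X U}
    {v w : Fin m → ProlongationPt ((algebraMap k (DualNumber k)).comp a) X U}
    (h : IsTranslate π b hI ha c w c₁) (h' : IsTranslate π b hI ha c₁ v c₂) :
    ∃ z : Fin m → ProlongationPt ((algebraMap k (TrivSqZeroExt k (k × k))).comp a) X U,
      (∀ j, comparePt (TrivSqZeroExt.map (LinearMap.fst k k k)) (map_algebraMap_comp _ a)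
        (z j) = v j) ∧
      (∀ j, comparePt (TrivSqZeroExt.map (LinearMap.snd k k k)) (map_algebraMap_comp _ a)
        (z j) = w j) ∧
      IsTranslate π b hI ha c (fun j => comparePt
        (TrivSqZeroExt.map (LinearMap.fst k k k + LinearMap.snd k k k))
        (map_algebraMap_comp _ a) (z j)) c₂ := by
  obtain ⟨g, h₁, h₂, h₃⟩ := h
  obtain ⟨g', h₁', h₂', h₃'⟩ := h'
  obtain ⟨t, ht, ht'⟩ := exists_triplePt π hA' g g' (h₃.trans h₁'.symm)
  have hz := coord_tripleHom π b hI ha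
  refine ⟨fun j => comparePt (TripleProd.coord π b hI j) (hz j) t, fun j => ?_, fun j => ?_,
    comparePt (TripleProd.outer α) outer_tripleHom t, ?_, fun j => ?_, ?_⟩
  · rw [comparePt_comp _ _ _ _ _ (TripleProd.map_fst_coord α π b hI j), ← h₂', ← ht',
      comparePt_comp _ _ _ _ ((pairCoord π b hI j).comp (TripleProd.right α)) rfl]
  · rw [comparePt_comp _ _ _ _ _ (TripleProd.map_snd_coord α π b hI j), ← h₂, ← ht,
      comparePt_comp _ _ _ _ ((pairCoord π b hI j).comp (TripleProd.left α)) rfl]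
  · rw [← h₁, ← ht, comparePt_comp _ _ _ _ _ (TripleProd.fst_comp_outer α),
      comparePt_comp _ _ _ _ ((FiberProd.fst α α).comp (TripleProd.left α)) rfl]
  · rw [comparePt_comp _ _ _ _ ((pairCoord π b hI j).comp (TripleProd.outer α)) rfl]
    exact (comparePt_comp _ _ _ _ _ (TripleProd.map_add_coord α π b hI j) _).symm
  · rw [← h₃', ← ht', comparePt_comp _ _ _ _ _ (TripleProd.snd_comp_outer α),
      comparePt_comp _ _ _ _ ((FiberProd.snd α α).comp (TripleProd.right α)) rfl]

end Translate

section Torsor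

open ProlongationPt

variable {k : Type u} [Field k] {A' A : Type u} [CommRing A'] [Algebra k A'] [CommRing A]
  [Algebra k A] {α : A' →ₐ[k] A} {π : A →ₐ[k] k} {m : ℕ}
  {e' : k →+* A'} {e : k →+* A} {a : k →+* k}
  {X U V : Over (Spec (CommRingCat.of k))}

namespace TangentScheme

/-- A tangent vector of the transform of `X`, as a semilinear point of `X` over `k[ε]`. -/
def vec (T : TangentScheme (transform a X)) (v : U ⟶ T.space) :
    ProlongationPt ((algebraMap k (DualNumber k)).comp a) X U :=
  untwist (fun _ => rfl) (Prolongation.pt T v)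

variable (T : TangentScheme (transform a X))

lemma vec_injective : Function.Injective (T.vec : (U ⟶ T.space) → _) :=
  (untwist_bijective _).1.comp (Prolongation.pt_injective T)

lemma vec_surjective : Function.Surjective (T.vec : (U ⟶ T.space) → _) :=
  (untwist_bijective _).2.comp (Prolongation.pt_bijective T).2

lemma vec_comp (φ : U ⟶ V) (v : V ⟶ T.space) : T.vec (φ ≫ v) = pull φ (T.vec v) := by
  rw [vec, Prolongation.pt_comp, untwist_pull]
  rfl

lemma reducePt_vec (v : U ⟶ T.space) : reducePt (TrivSqZeroExt.fstHom k k k) (T.vec v) =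
    (v ≫ T.proj).left ≫ pullback.fst X.hom (specMap a) := by
  rw [vec, reducePt_untwist, ← comp_proj_left]

/-- The zero vector at the image of a point `c` corresponds to the point of `X` over `k[ε]` that
is obtained from `c` along `A' → k → k[ε]`. -/
lemma vec_zeroAt (P : Prolongation e' X) (ρ : A' →ₐ[k] k) (ha : ∀ x, ρ (e' x) = a x)
    (h : ∀ x, (Algebra.ofId k (DualNumber k)).comp ρ (e' x) =
      (algebraMap k (DualNumber k)).comp a x)
    (c : U ⟶ P.space) : T.vec (T.zeroAt (c ≫ P.toTransform ρ a ha)) =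
      comparePt ((Algebra.ofId k (DualNumber k)).comp ρ) h (P.pt c) := by
  have h' : baseRestrict ((Algebra.ofId k (DualNumber k)).comp ρ) U =
      pullback.fst _ _ ≫ augSection ρ U := by
    apply pullback.hom_ext
    · rw [baseRestrict_fst, Category.assoc, augSection_fst, Category.comp_id]
    · rw [baseRestrict_snd, Category.assoc, augSection_snd, ← Category.assoc, pullback.condition,
        Category.assoc, ← specMap_comp]
      rfl
  apply raw_injective
  rw [vec, raw_untwist, raw_pt_zeroAt, raw_comparePt, h', Category.assoc, Category.assoc,
    Prolongation.comp_toTransform_fst, reducePt_eq]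

/-- Sums of tangent vectors of the transform can be tested on semilinear points of `X`. -/
lemma isSum_of_vec {v w s : U ⟶ T.space}
    (z : ProlongationPt ((algebraMap k (TrivSqZeroExt k (k × k))).comp a) X U)
    (h₁ : comparePt (TrivSqZeroExt.map (LinearMap.fst k k k)) (map_algebraMap_comp _ a) z = T.vec v)
    (h₂ : comparePt (TrivSqZeroExt.map (LinearMap.snd k k k)) (map_algebraMap_comp _ a) z = T.vec w)
    (h₃ : comparePt (TrivSqZeroExt.map (LinearMap.fst k k k + LinearMap.snd k k k))
      (map_algebraMap_comp _ a) z = T.vec s) : T.IsSum v w s := by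
  obtain ⟨z', rfl⟩ := (untwist_bijective (b := algebraMap k (TrivSqZeroExt k (k × k)))
    (fun _ => rfl)).2 z
  refine ⟨z', ?_, ?_, ?_⟩
  all_goals
    apply (untwist_bijective (b := algebraMap k (DualNumber k))
      (e := (algebraMap k (DualNumber k)).comp a) (fun _ => rfl)).1
    refine (untwist_comparePt
      (e := (algebraMap k (TrivSqZeroExt k (k × k))).comp a) (fun _ => rfl) _ (AlgHom.commutes _)
      (fun _ => rfl) z').trans ?_
    assumption

end TangentScheme

/-- Let `α : A' → A` be a surjection whose kernel is annihilated by the augmentation ideal and has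
a basis of `m` elements.  Then the prolongation space for `A'` is a torsor over that for `A` under
the `m`-th power of the tangent bundle of the transform. -/
theorem exists_isTangentTorsor [Smooth X.hom]
    (b : Module.Basis (Fin m) k (LinearMap.ker α.toLinearMap))
    (hI : ∀ x y, α x = 0 → π (α y) = 0 → x * y = 0) (hα : Function.Surjective α)
    (hker : IsNilpotent (RingHom.ker α)) (hA : ∀ x, π x = 0 → IsNilpotent x)
    (he : ∀ x, α (e' x) = e x) (ha : ∀ x, π (e x) = a x) (P : Prolongation e' X)
    (Q : Prolongation e X) (T : TangentScheme (transform a X))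
    (add : pullback T.proj T.proj ⟶ T.space) (hadd : T.IsAddition add) :
    ∃ γ, IsTangentTorsor T add (P.compare α he Q) (Q.toTransform π a ha) m γ := by
  have hA' : ∀ x, π (α x) = 0 → IsNilpotent x := fun x hx => by
    obtain ⟨n, hn⟩ := hA _ hx
    obtain ⟨l, hl⟩ := hker
    have hmem : x ^ n ∈ RingHom.ker α := by rw [RingHom.mem_ker, map_pow, hn]
    exact ⟨n * l, by rw [pow_mul]; simpa [hl] using Ideal.pow_mem_pow hmem l⟩
  have ha' : ∀ x, π (α (e' x)) = a x := fun x => by rw [he, ha]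
  have ha'' : ∀ x, (π.comp α) (e' x) = a x := ha'
  have hqr : P.compare α he Q ≫ Q.toTransform π a ha = P.toTransform (π.comp α) a ha'' := by
    apply Prolongation.transform_hom_ext
    rw [Prolongation.comp_toTransform_fst, ← Category.id_comp (P.compare α he Q),
      Prolongation.pt_compare, ← Category.id_comp (P.toTransform _ a ha''),
      Prolongation.comp_toTransform_fst]
    exact reducePt_comparePt _ _ _ rfl _ _
  have hred : ∀ {U : Over (Spec (CommRingCat.of k))} (c : U ⟶ P.space) (v : U ⟶ T.space),
      v ≫ T.proj = c ≫ P.compare α he Q ≫ Q.toTransform π a ha ↔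
      reducePt (TrivSqZeroExt.fstHom k k k) (T.vec v) = reducePt (π.comp α) (P.pt c) := by
    intro U c v
    rw [hqr, T.reducePt_vec, ← Prolongation.comp_toTransform_fst P (π.comp α) a ha'']
    exact ⟨fun h => by rw [h], fun h => Prolongation.transform_hom_ext h⟩
  -- `γ` is the translate of the universal point by the universal tangent vectors
  let G := pullback (T.powProj m) (P.compare α he Q ≫ Q.toTransform π a ha)
  obtain ⟨c', hc', -⟩ := existsUnique_isTranslate π b hI hA' ha' (P.pt (pullback.snd _ _ : G ⟶ _))
    (fun j => T.vec (T.coord (pullback.fst _ _ : G ⟶ _) j)) (fun j => (hred _ _).1 (by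
      rw [T.coord_proj, pullback.condition]))
  let γ : G ⟶ P.space := P.hom c'
  have hγ : ∀ {U : Over (Spec (CommRingCat.of k))} (c : U ⟶ P.space) (y : U ⟶ T.pow m)
      (hy : y ≫ T.powProj m = c ≫ P.compare α he Q ≫ Q.toTransform π a ha),
      IsTranslate π b hI ha' (P.pt c) (fun j => T.vec (T.coord y j))
        (P.pt (pullback.lift y c hy ≫ γ)) := by
    intro U c y hy
    have h := hc'.pull (pullback.lift y c hy)
    rw [← Prolongation.pt_comp, pullback.lift_snd] at h
    simp only [← T.vec_comp] at h
    have h₁ : ∀ j, pullback.lift y c hy ≫ T.coord (pullback.fst _ _ : G ⟶ _) j = T.coord y j :=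
      fun j => by rw [← Category.assoc, pullback.lift_fst]
    simp only [h₁] at h
    rw [Prolongation.pt_comp, Prolongation.pt_hom]
    exact h
  have hγ' : ∀ {U : Over (Spec (CommRingCat.of k))} (c d : U ⟶ P.space) (y : U ⟶ T.pow m)
      (hy : y ≫ T.powProj m = c ≫ P.compare α he Q ≫ Q.toTransform π a ha),
      IsTranslate π b hI ha' (P.pt c) (fun j => T.vec (T.coord y j)) (P.pt d) →
      pullback.lift y c hy ≫ γ = d := by
    intro U c d y hy h
    refine P.pt_injective ((existsUnique_isTranslate π b hI hA' ha' _ _ fun j => ?_).unique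
      (hγ c y hy) h)
    exact (hred _ _).1 (by rw [T.coord_proj, hy])
  have hover : γ ≫ P.compare α he Q = pullback.snd _ _ ≫ P.compare α he Q := by
    apply Q.pt_injective
    rw [Prolongation.pt_compare, Prolongation.pt_compare, Prolongation.pt_hom]
    exact hc'.comparePt_eq he
  refine ⟨γ, ⟨hover, ?_, ?_, ?_, ?_⟩⟩
  · intro U c y hy hy0
    apply hγ'
    simp only [hy0, hqr]
    simp only [T.vec_zeroAt P (π.comp α) ha'' (ofId_comp_apply π ha')]
    exact isTranslate_self π b hI ha' _
  · intro U c y z s hy hz hs hsum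
    apply hγ'
    have h₁ := hγ c z hz
    obtain ⟨x, hx₁, hx₂, hx₃⟩ := h₁.trans π b hI hA' ha' (hγ (pullback.lift z c hz ≫ γ) y (by
      rw [hy, Category.assoc, ← Category.assoc γ, hover, Category.assoc,
        pullback.lift_snd_assoc]))
    convert hx₃ using 1
    funext j
    obtain ⟨s', hs'⟩ := T.vec_surjective (comparePt
        (TrivSqZeroExt.map (LinearMap.fst k k k + LinearMap.snd k k k))
        (map_algebraMap_comp _ a) (x j))
    have := T.isSum_of_vec (x j) (hx₁ j) (hx₂ j) hs'.symm
    rw [← hs', hsum j]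
    exact congrArg _ ((hadd.2 _ _ _).unique this)
  · intro U c c' hcc'
    have hcomp : comparePt α he (P.pt c) = comparePt α he (P.pt c') := by
      rw [← Prolongation.pt_compare α he P Q, hcc', Prolongation.pt_compare]
    obtain ⟨v, hv, hu⟩ := existsUnique_isTranslate_of_comparePt_eq π b hI hA' ha' he _ _ hcomp
    choose w hw using fun j => T.vec_surjective (v j)
    have hbase : ∀ j, w j ≫ T.proj = c ≫ P.compare α he Q ≫ Q.toTransform π a ha := fun j =>
      (hred _ _).2 (by rw [hw, hv.reducePt_eq])
    refine ⟨WidePullback.lift (c ≫ P.compare α he Q ≫ Q.toTransform π a ha) w hbase,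
      ⟨WidePullback.lift_base _ _ _ _, ?_⟩, ?_⟩
    · apply hγ'
      simp only [TangentScheme.coord, WidePullback.lift_π, hw]
      exact hv
    · rintro y ⟨hy, hyc⟩
      have h := hγ c y hy
      rw [hyc] at h
      apply WidePullback.hom_ext
      · intro j
        rw [WidePullback.lift_π]
        apply T.vec_injective
        rw [hw, ← hu _ h]
      · rw [WidePullback.lift_base]
        exact hy
  · intro x
    -- local sections are local lifts of the universal point of `Q`
    obtain ⟨V, i, g, hi, hx, hg⟩ :=
      exists_comparePt_eq_of_smooth α hα hker he π hA (Q.pt (𝟙 Q.space)) x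
    have hs : P.hom g ≫ P.compare α he Q = i := by
      apply Q.pt_injective
      rw [Prolongation.pt_compare, Prolongation.pt_hom, hg, ← Prolongation.pt_eq_pull]
    refine ⟨i.left.opensRange, hx, i.left.isoOpensRange.inv ≫ (P.hom g).left, ?_⟩
    rw [Category.assoc, ← Over.comp_left, hs, Scheme.Hom.isoOpensRange_inv_comp]

end Torsor

/-! ### The filtration of a local algebra -/

lemma isNilpotent_ker_of_mul_eq_zero {R A C : Type*} [CommRing R] [CommRing A] [CommRing C]
    [Algebra R A] [Algebra R C] (f : A →ₐ[R] C) (h : ∀ x y, f x = 0 → f y = 0 → x * y = 0) :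
    IsNilpotent (RingHom.ker f) := by
  refine ⟨2, ?_⟩
  rw [pow_two]
  exact le_bot_iff.1 (Ideal.mul_le.2 fun x hx y hy => h x y hx hy)

section Filtration

open IsLocalRing

variable {k : Type u} [Field k] {B : Type u} [CommRing B] [Algebra k B] [IsLocalRing B]
  (hres : Function.Bijective (algebraMap k (ResidueField B)))

lemma ker_augmentation : RingHom.ker (augmentation hres) = maximalIdeal B := by
  refine (IsLocalRing.eq_maximalIdeal (RingHom.ker_isMaximal_of_surjective _ fun x =>
    ⟨algebraMap k B x, (augmentation hres).commutes x⟩))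

lemma isNilpotent_maximalIdeal [Module.Finite k B] : IsNilpotent (maximalIdeal B) := by
  have : IsArtinianRing B := IsArtinianRing.of_finite k B
  rw [← IsLocalRing.jacobson_eq_maximalIdeal ⊥ bot_ne_top]
  exact IsArtinianRing.isNilpotent_jacobson_bot

lemma isNilpotent_ker_augmentation [Module.Finite k B] :
    IsNilpotent (RingHom.ker (augmentation hres)) := by
  rw [ker_augmentation]
  exact isNilpotent_maximalIdeal (k := k)

lemma ker_levelAug (i : ℕ) : RingHom.ker (levelAug hres i) =
    (maximalIdeal B).map (Ideal.Quotient.mk (maximalIdeal B ^ (i + 1))) := by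
  ext x
  obtain ⟨x, rfl⟩ := Ideal.Quotient.mk_surjective x
  rw [← Ideal.mem_comap (f := Ideal.Quotient.mk _) (K := Ideal.map _ _),
    Ideal.comap_map_of_surjective' _ Ideal.Quotient.mk_surjective, Ideal.mk_ker,
    sup_eq_left.2 (Ideal.pow_le_self (Nat.succ_ne_zero i))]
  exact (SetLike.ext_iff.1 (ker_augmentation hres) x :)

lemma isNilpotent_ker_levelAug (i : ℕ) : IsNilpotent (RingHom.ker (levelAug hres i)) := by
  refine ⟨i + 1, ?_⟩
  rw [ker_levelAug, ← Ideal.map_pow, Ideal.map_quotient_self]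
  rfl

lemma mk_mem_ker_levelMap {i : ℕ} {x : B} :
    levelMap k B i (Ideal.Quotient.mk _ x) = 0 ↔ x ∈ maximalIdeal B ^ (i + 1) :=
  Ideal.Quotient.eq_zero_iff_mem

lemma surjective_levelMap (i : ℕ) : Function.Surjective (levelMap k B i) :=
  Ideal.Quotient.factor_surjective (Ideal.pow_le_pow_right (Nat.le_succ (i + 1)))

/-- The kernel of `B_{i+1} → B_i` is annihilated by the maximal ideal. -/
lemma levelMap_mul_eq_zero (i : ℕ) (x y : Level B (i + 1)) (hx : levelMap k B i x = 0)
    (hy : levelAug hres i (levelMap k B i y) = 0) : x * y = 0 := by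
  obtain ⟨x, rfl⟩ := Ideal.Quotient.mk_surjective x
  obtain ⟨y, rfl⟩ := Ideal.Quotient.mk_surjective y
  have hy : y ∈ maximalIdeal B := by
    rw [← ker_augmentation hres]
    exact hy
  rw [← map_mul, Ideal.Quotient.eq_zero_iff_mem, pow_succ]
  exact Ideal.mul_mem_mul (mk_mem_ker_levelMap.1 hx) hy

/-- The square of the kernel is the image of `𝔪^(2i+2)`, which is contained in `𝔪^(i+2)`. -/
lemma isNilpotent_ker_levelMap (i : ℕ) : IsNilpotent (RingHom.ker (levelMap k B i)) := by
  refine isNilpotent_ker_of_mul_eq_zero _ fun x y hx hy => ?_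
  obtain ⟨x, rfl⟩ := Ideal.Quotient.mk_surjective x
  obtain ⟨y, rfl⟩ := Ideal.Quotient.mk_surjective y
  rw [← map_mul, Ideal.Quotient.eq_zero_iff_mem, pow_succ]
  exact Ideal.mul_mem_mul (mk_mem_ker_levelMap.1 hx)
    (Ideal.pow_le_self (Nat.succ_ne_zero i) (mk_mem_ker_levelMap.1 hy))

/-- The kernel of `B_{i+1} → B_i` is `𝔪^(i+1) / 𝔪^(i+2)`. -/
def gradedEquivKer (i : ℕ) : (↥(maximalIdeal B ^ (i + 1)) ⧸
      (maximalIdeal B ^ (i + 2)).submoduleOf (maximalIdeal B ^ (i + 1))) ≃ₗ[k]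
    LinearMap.ker (levelMap k B i).toLinearMap :=
  LinearEquiv.ofBijective
    (LinearMap.codRestrict _
      (((Submodule.mapQ ((maximalIdeal B ^ (i + 2)).submoduleOf (maximalIdeal B ^ (i + 1)))
        (maximalIdeal B ^ (i + 2)) (Submodule.subtype _) le_rfl)).restrictScalars k)
      fun x => by
        obtain ⟨x, rfl⟩ := Submodule.Quotient.mk_surjective _ x
        exact (mk_mem_ker_levelMap (k := k)).2 x.2)
    (by
      constructor
      · rw [← LinearMap.ker_eq_bot, LinearMap.ker_codRestrict, LinearMap.ker_eq_bot']
        intro x hx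
        obtain ⟨x, rfl⟩ := Submodule.Quotient.mk_surjective _ x
        exact (Submodule.Quotient.mk_eq_zero _).2
          ((Submodule.Quotient.mk_eq_zero (maximalIdeal B ^ (i + 2))).1 hx)
      · rintro ⟨x, hx⟩
        obtain ⟨x, rfl⟩ := Ideal.Quotient.mk_surjective x
        exact ⟨Submodule.Quotient.mk ⟨x, (mk_mem_ker_levelMap (k := k)).1 hx⟩, rfl⟩)

lemma exists_basis_ker_levelMap [Module.Finite k B] (i : ℕ) : Nonempty
    (Module.Basis (Fin (gradedDim k B i)) k (LinearMap.ker (levelMap k B i).toLinearMap)) :=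
  ⟨(Module.finBasisOfFinrankEq k _ (gradedEquivKer i).finrank_eq.symm)⟩

end Filtration

end

theorem mainTheorem4 {k : Type u} [Field k] {B : Type u} [CommRing B] [Algebra k B]
    [Module.Finite k B] [IsLocalRing B]
    (hres : Function.Bijective (algebraMap k (IsLocalRing.ResidueField B)))
    (e : k →+* B) (X : Over (Spec (CommRingCat.of k)))
    [Smooth X.hom] [GeometricallyIrreducible X.hom] :
    -- all the spaces concerned exist
    (Nonempty (Prolongation e X) ∧ (∀ i, Nonempty (Prolongation (levelHom e i) X)) ∧
      Nonempty (TangentScheme (transform (residueEndo hres e) X))) ∧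
    ∀ τ : ∀ i, Prolongation (levelHom e i) X,
      -- the sequence starts at the transform of `X` and ends at the prolongation of `X`
      IsIso ((τ 0).toTransform (levelAug hres 0) (residueEndo hres e)
        (levelAug_levelHom hres e 0)) ∧
      (∀ d, IsLocalRing.maximalIdeal B ^ (d + 1) = ⊥ → ∀ P : Prolongation e X,
        IsIso (P.compare (Ideal.Quotient.mkₐ k _) (fun _ => rfl) (τ d))) ∧
      (∀ i, Smooth (τ i).space.hom ∧ GeometricallyIrreducible (τ i).space.hom) ∧
      (∀ T : TangentScheme (transform (residueEndo hres e) X),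
        ∃ add : pullback T.proj T.proj ⟶ T.space, T.IsAddition add ∧
          ∀ i, ∃ γ, IsTangentTorsor T add
            ((τ (i + 1)).compare (levelMap k B i) (levelMap_levelHom e i) (τ i))
            ((τ i).toTransform (levelAug hres i) (residueEndo hres e)
              (levelAug_levelHom hres e i))
            (gradedDim k B i) γ) ∧
      (∀ P : Prolongation e X, Smooth P.space.hom ∧ GeometricallyIrreducible P.space.hom) := by
  have : Smooth (transform (residueEndo hres e) X).hom :=
    inferInstanceAs (Smooth (pullback.snd X.hom _))
  have : Module.Finite k (DualNumber k) := inferInstanceAs (Module.Finite k (k × k))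
  have hε := isNilpotent_ker_of_mul_eq_zero (TrivSqZeroExt.fstHom k k k) fun x y hx hy => by
    have hx : x.fst = 0 := hx
    have hy : y.fst = 0 := hy
    exact TrivSqZeroExt.ext (by simp [hx]) (by simp [hx, hy])
  refine ⟨⟨Prolongation.nonempty_of_smooth e _ (isNilpotent_ker_augmentation hres),
    fun i => Prolongation.nonempty_of_smooth _ _ (isNilpotent_ker_levelAug hres i),
    Prolongation.nonempty_of_smooth _ _ hε⟩, fun τ => ⟨?_, ?_, ?_, ?_, ?_⟩⟩
  · refine Prolongation.isIso_toTransform _ _ ?_ _ _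
    rw [RingHom.injective_iff_ker_eq_bot]
    refine (ker_levelAug hres 0).trans ?_
    rw [Ideal.map_eq_bot_iff_le_ker, Ideal.mk_ker, zero_add, pow_one]
  · intro d hd P
    refine Prolongation.isIso_compare _ ⟨?_, Ideal.Quotient.mk_surjective⟩ _ _ _
    rw [RingHom.injective_iff_ker_eq_bot]
    exact Ideal.mk_ker.trans hd
  · exact fun i => (τ i).smooth_hom _ (isNilpotent_ker_levelAug hres i)
  · intro T
    obtain ⟨add, hadd⟩ := T.exists_isAddition
    refine ⟨add, hadd, fun i => ?_⟩
    obtain ⟨b⟩ := exists_basis_ker_levelMap (k := k) (B := B) i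
    exact exists_isTangentTorsor b (levelMap_mul_eq_zero hres i) (surjective_levelMap i)
      (isNilpotent_ker_levelMap i)
      (fun x hx => isNilpotent_of_isNilpotent_ker (isNilpotent_ker_levelAug hres i) hx) _ _ _ _ T
      add hadd
  · exact fun P => P.smooth_hom _ (isNilpotent_ker_augmentation hres)
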